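/- Fix an infinite supply of standard names and of function symbols. A function term is $f(n_1,\ldots,n_j)$ with names $n_i$; a literal is $t=n$ or $\neg\, t=n$ (also written $t\neq n$) with $t$ a function term and $n$ a name; formulas are built from the expressions $t=n$ by $\neg$, $\lor$ and belief operators $\mathbf B_k$ ($k\ge 0$), with $\land,\to$ the usual abbreviations, and are objective if they contain no $\mathbf B_k$. A clause is a finite set of literals; a non-empty clause is identified with the disjunction of its elements. A clause $c_1$ subsumes $c_2$ iff for every $t=n\in c_1$ either $t=n\in c_2$ or $t\neq n'\in c_2$ for some $n'\ne n$, and every $t\neq n\in c_1$ is in $c_2$. Two literals are complementary if they are $t=n$ and $t\neq n$, or $t=n$ and $t=n'$ with $n,n'$ distinct; unit propagation of a clause $c$ and a literal $\ell$ removes from $c$ all literals complementary to $\ell$. For a set $s$ of clauses, $\mathrm{UP}(s)$ is its closure under subsumption and under unit propagation with literals $\ell$ for which $\{\ell\}$ is in the closure. Truth is defined by: $s\models c$ iff $c\in \mathrm{UP}(s)$ for a clause $c$; $s\models(\alpha\lor\beta)$ iff $s\models\alpha$ or $s\models\beta$ if $(\alpha\lor\beta)$ is not a clause; $s\models\neg(\alpha\lor\beta)$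 iff $s\models\neg\alpha$ and $s\models\neg\beta$; $s\models\neg\neg\alpha$ iff $s\models\alpha$; $s\models\mathbf B_0\alpha$ iff $s\models\alpha$; $s\models\mathbf B_{k+1}\alpha$ iff for some function term $t$, for all names $n$, $s\cup\{t=n\}\models\mathbf B_k\alpha$; $s\models\neg\mathbf B_k\alpha$ iff $s\not\models\mathbf B_k\alpha$. A formula is valid if it is true in every set of clauses. Limited Belief Reasoning is the problem: given objective formulas $\mathrm{KB}$ and $\alpha$, $\mathrm{KB}$ in conjunctive normal form, and $k\ge 0$ (written in binary), decide whether $\mathbf B_0\mathrm{KB}\to\mathbf B_k\alpha$ is valid. Let $|\mathrm{KB}|,|\alpha|$ be the lengths of the formulas as strings over a finite alphabet (names and function symbols being written in binary). The machines are multi-stack (equivalently, multi-tape) Turing machines. Then: 1. For every constant $k$, Limited Belief Reasoning at belief level $k$ is in PTIME. 2. For every constant $c$, Limited Belief Reasoning, with the belief level as part of the input, restricted to inputs in which $\mathrm{KB}$ and $\alpha$ mention at most $c$ function terms is in PTIME. 3. There is one decision procedure for Limited Belief Reasoning that, on every input $(\mathrm{KB},\alpha,k)$, runs in time $\mathcal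 O\bigl(2^k(|\mathrm{KB}|+|\alpha|)^{k+3}\bigr)$, with an absolute constant; so for each fixed $k$ it runs in time polynomial of degree $k+3$. 4. The belief level $|F|$ suffices: if $F$ is a finite set of function terms that contains all those mentioned in $\mathrm{KB}$ and $\alpha$, and $k\ge|F|$, then $\mathbf B_0\mathrm{KB}\to\mathbf B_k\alpha$ is valid iff $\mathbf B_0\mathrm{KB}\to\mathbf B_{|F|}\alpha$ is valid. -/

import Mathlib

namespace LimitedBelief

/-! ### The language -/

/-- Standard names: a countably infinite supply. Distinct numbers are distinct names. -/
abbrev Name := ℕ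

/-- A function term `f(n₁,…,n_j)`. The function symbol is determined by an index together with its
arity `j` (the length of `args`), so there are infinitely many function symbols of each arity. -/
structure FunTerm where
  sym : ℕ
  args : List Name
  deriving DecidableEq

/-- A literal `t = n` or `¬ t = n`, with `t` a function term and `n` a standard name. -/
inductive Literal where
  | eq (t : FunTerm) (n : Name)
  | ne (t : FunTerm) (n : Name)
  deriving DecidableEq

/-- Formulas: `t = n`, `¬ α`, `(α ∨ β)`, `B_k α`. The negative literal `¬ t = n` is the expression
`neg (eq t n)`. -/
inductive Formula where
  | eq (t : FunTerm) (n : Name)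
  | neg (a : Formula)
  | or (a b : Formula)
  | bel (k : ℕ) (a : Formula)

/-- The abbreviation `α ∧ β`. -/
def Formula.and (a b : Formula) : Formula := .neg (.or (.neg a) (.neg b))

/-- The abbreviation `α → β`. -/
def Formula.imp (a b : Formula) : Formula := .or (.neg a) b

/-- A formula is objective if it does not mention any belief operator. -/
def Formula.Objective : Formula → Prop
  | .eq _ _ => True
  | .neg a => a.Objective
  | .or a b => a.Objective ∧ b.Objective
  | .bel _ _ => False

/-- The function terms mentioned in a formula. -/
def Formula.funTerms : Formula → Finset FunTerm
  | .eq t _ => {t}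
  | .neg a => a.funTerms
  | .or a b => a.funTerms ∪ b.funTerms
  | .bel _ a => a.funTerms

/-- A clause is a (finite) set of literals. -/
abbrev Clause := Finset Literal

/-- The clause that a formula is identified with, if the formula is a disjunction of literals
(with any bracketing); `none` for all other formulas. -/
def Formula.toClause : Formula → Option Clause
  | .eq t n => some {Literal.eq t n}
  | .neg (.eq t n) => some {Literal.ne t n}
  | .or a b =>
    match a.toClause, b.toClause with
    | some c, some d => some (c ∪ d)
    | _, _ => none
  | _ => none

/-- Conjunctive normal form: a conjunction of disjunctions of literals. -/
inductive Formula.IsCNF : Formula → Prop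
  | clause {a : Formula} {c : Clause} (h : a.toClause = some c) : IsCNF a
  | and {a b : Formula} (ha : IsCNF a) (hb : IsCNF b) : IsCNF (a.and b)

/-! ### The semantics -/

/-- `Subsumes c d`: the clause `c` subsumes the clause `d`. -/
def Subsumes (c d : Clause) : Prop :=
  (∀ t n, Literal.eq t n ∈ c → Literal.eq t n ∈ d ∨ ∃ n', n' ≠ n ∧ Literal.ne t n' ∈ d) ∧
  (∀ t n, Literal.ne t n ∈ c → Literal.ne t n ∈ d)

/-- Two literals are complementary if they are `t = n` and `¬ t = n` (in either order), or `t = n`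
and `t = n'` for distinct names `n`, `n'`. -/
def Complementary : Literal → Literal → Prop
  | .eq t n, .eq t' n' => t = t' ∧ n ≠ n'
  | .eq t n, .ne t' n' => t = t' ∧ n = n'
  | .ne t n, .eq t' n' => t = t' ∧ n = n'
  | .ne _ _, .ne _ _ => False

instance (l l' : Literal) : Decidable (Complementary l l') := by
  cases l <;> cases l' <;> unfold Complementary <;> infer_instance

/-- Unit propagation of the clause `c` and the literal `l`: remove from `c` all literals
complementary to `l`. -/
def propagate (c : Clause) (l : Literal) : Clause :=
  c.filter (fun l' => ¬ Complementary l' l)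

/-- The closure of a set of clauses under unit propagation and subsumption. -/
inductive UP (s : Set Clause) : Clause → Prop
  | base {c : Clause} (h : c ∈ s) : UP s c
  | prop {c : Clause} {l : Literal} (hc : UP s c) (hl : UP s {l}) : UP s (propagate c l)
  | sub {c d : Clause} (hc : UP s c) (h : Subsumes c d) : UP s d

/-- The truth relation of limited belief between a set of clauses and a formula. -/
def Sat : Set Clause → Formula → Prop
  | s, .eq t n => UP s {Literal.eq t n}
  | s, .or a b =>
    match (Formula.or a b).toClause with
    | some c => UP s c
    | none => Sat s a ∨ Sat s b
  | s, .bel 0 a => Sat s a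
  | s, .bel (k + 1) a => ∃ t : FunTerm, ∀ n : Name, Sat (s ∪ {{Literal.eq t n}}) (.bel k a)
  | s, .neg (.eq t n) => UP s {Literal.ne t n}
  | s, .neg (.or a b) => Sat s (.neg a) ∧ Sat s (.neg b)
  | s, .neg (.neg a) => Sat s a
  | s, .neg (.bel k a) => ¬ Sat s (.bel k a)
termination_by _ a => sizeOf a

/-- A formula is valid if it is true in every set of clauses. -/
def Valid (a : Formula) : Prop := ∀ s : Set Clause, Sat s a

/-! ### The reasoning problem -/

/-- An instance of Limited Belief Reasoning: objective formulas `kb` in CNF and `query`, and a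
belief level. -/
structure Instance where
  kb : Formula
  query : Formula
  level : ℕ
  kb_cnf : kb.IsCNF
  query_objective : query.Objective

namespace Instance

/-- The formula `B_0 KB → B_k α` of an instance. -/
def formula (x : Instance) : Formula := (Formula.bel 0 x.kb).imp (.bel x.level x.query)

/-- The question of Limited Belief Reasoning: is `B_0 KB → B_k α` valid? -/
def Holds (x : Instance) : Prop := Valid x.formula

/-- The function terms mentioned in an instance. -/
def funTerms (x : Instance) : Finset FunTerm := x.kb.funTerms ∪ x.query.funTerms

end Instance

/-! ### Encoding of instances as strings -/

/-- A finite alphabet for formulas. -/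
inductive Sym where
  | bit (b : Bool)
  | fn
  | arg
  | eq
  | neg
  | or
  | bel
  deriving DecidableEq, Fintype

/-- Numbers are written in binary. -/
def encodeNum (n : ℕ) : List Sym := (Computability.encodeNat n).map Sym.bit

/-- A function term: its symbol, followed by its arguments. -/
def FunTerm.encode (t : FunTerm) : List Sym :=
  Sym.fn :: encodeNum t.sym ++ t.args.flatMap (fun n => Sym.arg :: encodeNum n)

/-- Formulas are written in prefix notation. -/
def Formula.encode : Formula → List Sym
  | .eq t n => t.encode ++ Sym.eq :: encodeNum n
  | .neg a => Sym.neg :: a.encode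
  | .or a b => Sym.or :: (a.encode ++ b.encode)
  | .bel k a => Sym.bel :: (encodeNum k ++ a.encode)

/-- The length of a formula, as a string. -/
def Formula.length (a : Formula) : ℕ := a.encode.length

/-- An instance is written as the formula `B_0 KB → B_k α`, with `k` in binary. -/
def Instance.encode (x : Instance) : List Sym := x.formula.encode

/-! The encoding is faithful: an instance can be recovered from its string. -/

/-- The string does not start with a bit. -/
def NoBit (r : List Sym) : Prop := ∀ b r', r ≠ Sym.bit b :: r'

theorem map_bit_append_inj : ∀ (u v : List Bool) (r r' : List Sym), NoBit r → NoBit r' →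
    u.map Sym.bit ++ r = v.map Sym.bit ++ r' → u = v ∧ r = r'
  | [], [], r, r', _, _, h => ⟨rfl, by simpa using h⟩
  | [], b :: v, r, r', hr, _, h => absurd (by simpa using h) (hr b (v.map Sym.bit ++ r'))
  | b :: u, [], r, r', _, hr', h => absurd (by simpa using h.symm) (hr' b (u.map Sym.bit ++ r))
  | b :: u, c :: v, r, r', hr, hr', h => by
    simp only [List.map_cons, List.cons_append, List.cons.injEq, Sym.bit.injEq] at h
    obtain ⟨h1, h2⟩ := map_bit_append_inj u v r r' hr hr' h.2
    exact ⟨by rw [h.1, h1], h2⟩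

theorem encodeNum_append_inj {m n : ℕ} {r r' : List Sym} (hr : NoBit r) (hr' : NoBit r')
    (h : encodeNum m ++ r = encodeNum n ++ r') : m = n ∧ r = r' := by
  obtain ⟨h1, h2⟩ := map_bit_append_inj _ _ _ _ hr hr' h
  exact ⟨by simpa using congrArg Computability.decodeNat h1, h2⟩

theorem noBit_args (l : List Name) (r : List Sym) :
    NoBit (l.flatMap (fun n => Sym.arg :: encodeNum n) ++ Sym.eq :: r) := by
  intro b r'
  cases l <;> simp

theorem args_append_inj : ∀ (u v : List Name) (r r' : List Sym),
    u.flatMap (fun n => Sym.arg :: encodeNum n) ++ Sym.eq :: r =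
      v.flatMap (fun n => Sym.arg :: encodeNum n) ++ Sym.eq :: r' → u = v ∧ r = r'
  | [], [], r, r', h => ⟨rfl, by simpa using h⟩
  | [], b :: v, r, r', h => by simp at h
  | b :: u, [], r, r', h => by simp at h
  | b :: u, c :: v, r, r', h => by
    simp only [List.flatMap_cons, List.cons_append, List.append_assoc, List.cons.injEq,
      true_and] at h
    obtain ⟨h1, h2⟩ := encodeNum_append_inj (noBit_args u r) (noBit_args v r') h
    obtain ⟨h3, h4⟩ := args_append_inj u v r r' h2
    exact ⟨by rw [h1, h3], h4⟩

theorem noBit_encode (a : Formula) (r : List Sym) : NoBit (a.encode ++ r) := by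
  intro b r'
  cases a <;> simp [Formula.encode, FunTerm.encode]

theorem Formula.encode_append_inj : ∀ (a b : Formula) (r r' : List Sym), NoBit r → NoBit r' →
    a.encode ++ r = b.encode ++ r' → a = b ∧ r = r' := by
  intro a
  induction a with
  | eq t n =>
    intro b r r' hr hr' h
    cases b with
    | eq t' n' =>
      simp only [Formula.encode, FunTerm.encode, List.cons_append, List.append_assoc,
        List.cons.injEq, true_and] at h
      obtain ⟨h1, h2⟩ := encodeNum_append_inj (noBit_args _ _) (noBit_args _ _) h
      obtain ⟨h3, h4⟩ := args_append_inj _ _ _ _ h2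
      obtain ⟨h5, h6⟩ := encodeNum_append_inj hr hr' h4
      cases t; cases t'
      simp_all
    | _ => simp [Formula.encode, FunTerm.encode] at h
  | neg a ih =>
    intro b r r' hr hr' h
    cases b with
    | neg a' =>
      simp only [Formula.encode, List.cons_append, List.cons.injEq, true_and] at h
      obtain ⟨h1, h2⟩ := ih _ _ _ hr hr' h
      exact ⟨by rw [h1], h2⟩
    | _ => simp [Formula.encode, FunTerm.encode] at h
  | or a c iha ihc =>
    intro b r r' hr hr' h
    cases b with
    | or a' c' =>
      simp only [Formula.encode, List.cons_append, List.append_assoc, List.cons.injEq,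
        true_and] at h
      obtain ⟨h1, h2⟩ := iha _ _ _ (noBit_encode _ _) (noBit_encode _ _) h
      obtain ⟨h3, h4⟩ := ihc _ _ _ hr hr' h2
      exact ⟨by rw [h1, h3], h4⟩
    | _ => simp [Formula.encode, FunTerm.encode] at h
  | bel k a ih =>
    intro b r r' hr hr' h
    cases b with
    | bel k' a' =>
      simp only [Formula.encode, List.cons_append, List.append_assoc, List.cons.injEq,
        true_and] at h
      obtain ⟨h1, h2⟩ := encodeNum_append_inj (noBit_encode _ _) (noBit_encode _ _) h
      obtain ⟨h3, h4⟩ := ih _ _ _ hr hr' h2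
      exact ⟨by rw [h1, h3], h4⟩
    | _ => simp [Formula.encode, FunTerm.encode] at h

theorem Instance.encode_injective : Function.Injective Instance.encode := by
  intro x y h
  have h0 : NoBit [] := by intro b r' h; cases h
  have h1 := (Formula.encode_append_inj x.formula y.formula [] [] h0 h0
    (by simpa [Instance.encode] using h)).1
  cases x; cases y
  simp only [Instance.formula, Formula.imp, Formula.or.injEq, Formula.neg.injEq,
    Formula.bel.injEq] at h1
  simp only [Instance.mk.injEq]
  exact ⟨h1.1.2, h1.2.2, h1.2.1⟩

/-! ### Complexity -/

open Classical in
/-- The decision problem `P` on a type of instances, which are written as strings by means of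
`enc`, is in PTIME: some Turing machine decides it in time polynomial in the length of the input
string. -/
def InPTIME {α Γ : Type} (enc : α → List Γ) (P : α → Prop) : Prop :=
  Nonempty (Turing.TM2ComputableInPolyTime enc Computability.encodeBool (fun a => decide (P a)))

open Classical in
/-- On the instance `a`, written as a string by means of `enc`, the Turing machine `M` halts within
`T` steps and outputs whether `P a` holds. -/
def AnswersWithin {α Γ : Type} (M : Turing.TM2ComputableAux Γ Bool) (enc : α → List Γ)
    (P : α → Prop) (a : α) (T : ℕ) : Prop :=
  Nonempty (Turing.TM2OutputsInTime M.tm ((enc a).map M.inputAlphabet.invFun)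
    (some ((Computability.encodeBool (decide (P a))).map M.outputAlphabet.invFun)) T)

end LimitedBelief

/-!
The proof has a logical part and a computational part.

*Useless splits.* Truth of `B_k α` is monotone in the set of clauses, so that validity amounts to
`B_k α` being true in the set of clauses of the knowledge base (`Instance.holds_iff`). A split of a
term that is not mentioned, or of one that has been split before, gains nothing: the clauses of the
closure can be restricted to the mentioned terms (`UP.restrict`), and a split of an old term admits
the old name again. Hence truth of `B_k α` is a game in which each mentioned term is split at most
once (`game_of_sat`), and levels above the number of terms are as good as that number
(`Instance.holds_level_card`).

*A table in place of the closure.* To evaluate the query, it suffices to know which of its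
subformulas that are clauses, and which negations of atoms, follow. A `Table` records this for all
subformulas of the input. A `round` adds to a table the clauses for which the knowledge base has a
clause all of whose literals are refuted by units of the table or covered by the clause to be added;
`dual` tests this on the formula, without parsing it into clauses. A round is sound, and a table
that is stable under rounds contains everything that is derivable (`Table.Sound.closure`,
`full_of_stable`). Linearly many rounds, each of quadratic cost, are enough, as every round adds an
entry until the table is stable.

*Finitely many names.* The names that are not mentioned behave alike (`cov_fresh`), so that a split
of `t` has finitely many choices: the names mentioned with `t`, and one other. The search with these
choices decides the problem (`Instance.holds_iff_eval`). An atom takes more than one letter, so that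
for an input of length `L` all terms together have at most `L` choices. The search with `r` splits
hence has at most `L ^ r` leaves, each of cubic cost, and a factor of 2 for each split pays for the
time that is spent between the leaves (`searchTime_le`).

*The machine.* A small language of structured programs on stacks (`Prog`), whose semantics `Exec`
counts steps, is compiled to the machines of Mathlib (`Exec.reachesIn`, `Exec.answersWithin`). The
search becomes such a program (`exec_mainCode`), which gives the decision procedure with its time
bound (`answersWithin_holds`). For a constant level, or a constant number of terms, a program that
first compares the level, or the number of terms, with the constant runs in polynomial time
(`inPTIME_of_test`).
-/

namespace LimitedBelief

/-! ### Structured programs on stacks -/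

section Programs

open Function

variable {K A : Type}

/-- Structured programs that work on finitely many stacks, indexed by `K`, over the alphabet `A`.
`popCase k f` pops the stack `k` and continues with `f` of the popped symbol; `foreach k c f` pops
the stack `k` and runs `f` on the popped symbol, as long as the top symbol satisfies `c`. -/
inductive Prog (K A : Type) where
  | skip
  | push (k : K) (a : A)
  | seq (p q : Prog K A)
  | popCase (k : K) (f : Option A → Prog K A)
  | foreach (k : K) (c : A → Bool) (f : A → Prog K A)

/-- The labels of the compiled program. -/
def Prog.Lbl : Prog K A → Type
  | .skip => Unit
  | .push _ _ => Unit
  | .seq p q => p.Lbl ⊕ q.Lbl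
  | .popCase _ f => Option (Σ o, (f o).Lbl)
  | .foreach _ _ f => Option (Σ a, (f a).Lbl)

/-- The label at which the compiled program starts. -/
def Prog.entry : (p : Prog K A) → p.Lbl
  | .skip => ()
  | .push _ _ => ()
  | .seq p _ => .inl p.entry
  | .popCase _ _ => none
  | .foreach _ _ _ => none

theorem Prog.finite_lbl [Finite A] (p : Prog K A) : Finite p.Lbl := by
  induction p with
  | skip => exact inferInstanceAs (Finite Unit)
  | push => exact inferInstanceAs (Finite Unit)
  | seq p q hp hq => exact inferInstanceAs (Finite (p.Lbl ⊕ q.Lbl))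
  | popCase k f ih => exact inferInstanceAs (Finite (Option (Σ o, (f o).Lbl)))
  | foreach k c f ih => exact inferInstanceAs (Finite (Option (Σ o, (f o).Lbl)))

variable [DecidableEq K]

/-- `Exec p s s' n`: the program `p` leads from the stacks `s` to the stacks `s'` in at most `n`
steps. -/
inductive Exec : Prog K A → (K → List A) → (K → List A) → ℕ → Prop
  | skip (s) : Exec .skip s s 1
  | push (k a s) : Exec (.push k a) s (update s k (a :: s k)) 1
  | seq {p q s s₁ s₂ m n} (hp : Exec p s s₁ m) (hq : Exec q s₁ s₂ n) : Exec (.seq p q) s s₂ (m + n)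
  | popCase {k f s s₁ n} (h : Exec (f (s k).head?) (update s k (s k).tail) s₁ n) :
      Exec (.popCase k f) s s₁ (n + 1)
  | done {k c f s} (h : ∀ a ∈ (s k).head?, c a = false) : Exec (.foreach k c f) s s 1
  | step {k c f s s₁ s₂ a l m n} (hs : s k = a :: l) (hc : c a = true)
      (hf : Exec (f a) (update s k l) s₁ m) (h : Exec (.foreach k c f) s₁ s₂ n) :
      Exec (.foreach k c f) s s₂ (m + n + 1)
  | mono {p s s₁ m n} (h : Exec p s s₁ m) (hmn : m ≤ n) : Exec p s s₁ n

/-- An execution, with its final stacks rewritten and its bound relaxed. -/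
theorem Exec.to {p : Prog K A} {s s₁ s₂ : K → List A} {m n : ℕ} (h : Exec p s s₁ m)
    (hs : s₁ = s₂) (hmn : m ≤ n) : Exec p s s₂ n :=
  hs ▸ h.mono hmn

/-- Execution of `popCase` on a nonempty stack. -/
theorem Exec.popSome {k : K} {f : Option A → Prog K A} {s s₁ : K → List A} {a : A} {l : List A}
    {n : ℕ} (hs : s k = a :: l) (h : Exec (f (some a)) (update s k l) s₁ n) :
    Exec (.popCase k f) s s₁ (n + 1) :=
  .popCase (by simpa [hs] using h)

/-- Execution of `popCase` on an empty stack. -/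
theorem Exec.popNone {k : K} {f : Option A → Prog K A} {s s₁ : K → List A}
    {n : ℕ} (hs : s k = []) (h : Exec (f none) s s₁ n) :
    Exec (.popCase k f) s s₁ (n + 1) := by
  refine .popCase ?_
  have : update s k [] = s := by rw [← hs, update_eq_self]
  simpa [hs, this] using h

/-- `Iter k c f s s' n`: some number of iterations of the loop `foreach k c f` leads from `s` to
`s'`, in at most `n` steps. -/
inductive Iter (k : K) (c : A → Bool) (f : A → Prog K A) :
    (K → List A) → (K → List A) → ℕ → Prop
  | refl (s) : Iter k c f s s 0
  | step {s s₁ s₂ a l m n} (hs : s k = a :: l) (hc : c a = true)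
      (hf : Exec (f a) (update s k l) s₁ m) (h : Iter k c f s₁ s₂ n) :
      Iter k c f s s₂ (m + n + 1)
  | mono {s s₁ m n} (h : Iter k c f s s₁ m) (hmn : m ≤ n) : Iter k c f s s₁ n

section

variable {k : K} {c : A → Bool} {f : A → Prog K A} {s s₁ s₂ : K → List A} {m n : ℕ}

theorem Iter.trans (h : Iter k c f s s₁ m) (h' : Iter k c f s₁ s₂ n) :
    Iter k c f s s₂ (m + n) := by
  induction h with
  | refl => exact h'.mono (by omega)
  | step hs hc hf _ ih => exact (Iter.step hs hc hf (ih h')).mono (by omega)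
  | mono _ hmn ih => exact (ih h').mono (by omega)

theorem Iter.single {a : A} {l : List A} (hs : s k = a :: l) (hc : c a = true)
    (hf : Exec (f a) (update s k l) s₁ m) : Iter k c f s s₁ (m + 1) :=
  (Iter.step hs hc hf (.refl _)).mono (by omega)

theorem Iter.to (h : Iter k c f s s₁ m) (hs : s₁ = s₂) (hmn : m ≤ n) : Iter k c f s s₂ n :=
  hs ▸ h.mono hmn

theorem Iter.exec (h : Iter k c f s s₁ m) (h' : Exec (.foreach k c f) s₁ s₂ n) :
    Exec (.foreach k c f) s s₂ (m + n) := by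
  induction h with
  | refl => exact h'.mono (by omega)
  | step hs hc hf _ ih => exact (Exec.step hs hc hf (ih h')).mono (by omega)
  | mono _ hmn ih => exact (ih h').mono (by omega)

theorem Iter.finish (h : Iter k c f s s₁ m) (h' : ∀ a ∈ (s₁ k).head?, c a = false) :
    Exec (.foreach k c f) s s₁ (m + 1) :=
  h.exec (.done h')

end

/-- A program increases the total height of the stacks by at most one symbol per step. -/
theorem Exec.sum_length_le [Fintype K] {p : Prog K A} {s s₁ : K → List A} {n : ℕ}
    (h : Exec p s s₁ n) : ∑ k, (s₁ k).length ≤ ∑ k, (s k).length + n := by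
  have key : ∀ (s : K → List A) (k : K) (l : List A),
      ∑ j, (update s k l j).length + (s k).length = ∑ j, (s j).length + l.length := by
    intro s k l
    rw [← Finset.add_sum_erase _ _ (Finset.mem_univ k),
      ← Finset.add_sum_erase _ (fun j => (s j).length) (Finset.mem_univ k), update_self]
    have : ∑ j ∈ Finset.univ.erase k, (update s k l j).length =
        ∑ j ∈ Finset.univ.erase k, (s j).length :=
      Finset.sum_congr rfl fun j hj => by rw [update_of_ne (Finset.ne_of_mem_erase hj)]
    omega
  induction h with
  | skip => omega
  | push k a s => have := key s k (a :: s k); simp only [List.length_cons] at this; omega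
  | seq _ _ ih₁ ih₂ => omega
  | @popCase k f s _ _ _ ih =>
    have := key s k (s k).tail
    simp only [List.length_tail] at this
    omega
  | done => omega
  | @step k _ _ s _ _ a l _ _ hs _ _ _ ih₁ ih₂ =>
    have := key s k l
    rw [hs, List.length_cons] at this
    omega
  | mono _ _ ih => omega

/-! ### Compilation to Turing machines -/

/-- The stacks of the compiled machine: an input stack (`none`), an output stack (`some none`) and
the stacks of the program. -/
abbrev Stack (K : Type) := Option (Option K)

/-- The alphabets of the stacks of the compiled machine. -/
def Alph (K A I : Type) : Stack K → Type
  | none => I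
  | some none => Bool
  | some (some _) => A

/-- The contents of the stacks of the compiled machine. -/
def contents {I : Type} (i : List I) (o : List Bool) (s : K → List A) :
    (k : Stack K) → List (Alph K A I k)
  | none => i
  | some none => o
  | some (some k) => s k

theorem update_contents {I : Type} (i : List I) (o : List Bool) (s : K → List A) (k : K)
    (l : List A) :
    update (β := fun k => List (Alph K A I k)) (contents i o s) (some (some k)) l =
      contents i o (update s k l) := by
  funext j
  match j with
  | none => rfl
  | some none => rfl
  | some (some j) =>
    by_cases h : j = k
    · subst h
      refine (update_self (β := fun k => List (Alph K A I k)) _ _ _).trans ?_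
      exact (update_self j l s).symm
    · refine (update_of_ne (β := fun k => List (Alph K A I k)) (by simpa using h) _ _).trans ?_
      exact (update_of_ne h l s).symm

/-- The statements of the compiled program. Labels are embedded by `emb`, and the machine continues
at `exit` in the end. The internal state of the machine holds the symbol that has been read last. -/
def Prog.code {I Λ : Type} : (p : Prog K A) → (p.Lbl → Λ) → Λ → p.Lbl →
    Turing.TM2.Stmt (Alph K A I) Λ (Option A)
  | .skip, _, exit, _ => .goto fun _ => exit
  | .push k a, _, exit, _ => .push (some (some k)) (fun _ => a) (.goto fun _ => exit)
  | .seq p q, emb, exit, l =>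
    match l with
    | .inl l => p.code (emb ∘ .inl) (emb (.inr q.entry)) l
    | .inr l => q.code (emb ∘ .inr) exit l
  | .popCase k f, emb, exit, l =>
    match l with
    | none => .pop (some (some k)) (fun _ o => o) (.goto fun v => emb (some ⟨v, (f v).entry⟩))
    | some ⟨o, l⟩ => (f o).code (fun l => emb (some ⟨o, l⟩)) exit l
  | .foreach k c f, emb, exit, l =>
    match l with
    | none => .peek (some (some k)) (fun _ o => o) (.branch (fun v => v.any c)
        (.pop (some (some k)) (fun v _ => v) (.goto fun v =>
          match v with
          | some a => emb (some ⟨a, (f a).entry⟩)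
          | none => exit))
        (.goto fun _ => exit))
    | some ⟨a, l⟩ => (f a).code (fun l => emb (some ⟨a, l⟩)) (emb none) l

/-- The machine with the statements `M` leads from one configuration to another in at most `n`
steps. -/
def ReachesIn {L Λ σ : Type} [DecidableEq L] {Γ : L → Type} (M : Λ → Turing.TM2.Stmt Γ Λ σ)
    (a b : Turing.TM2.Cfg Γ Λ σ) (n : ℕ) : Prop :=
  ∃ m ≤ n, (flip bind (Turing.TM2.step M))^[m] (some a) = some b

section

variable {L Λ σ : Type} [DecidableEq L] {Γ : L → Type} {M : Λ → Turing.TM2.Stmt Γ Λ σ}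
  {a b c : Turing.TM2.Cfg Γ Λ σ} {m n : ℕ}

theorem ReachesIn.trans (h : ReachesIn M a b m) (h' : ReachesIn M b c n) :
    ReachesIn M a c (m + n) := by
  obtain ⟨i, hi, h⟩ := h
  obtain ⟨j, hj, h'⟩ := h'
  exact ⟨j + i, by omega, by rw [iterate_add_apply, h, h']⟩

theorem ReachesIn.single (h : Turing.TM2.step M a = some b) : ReachesIn M a b 1 :=
  ⟨1, le_rfl, h⟩

theorem ReachesIn.to (h : ReachesIn M a b m) (hb : b = c) (hmn : m ≤ n) : ReachesIn M a c n :=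
  let ⟨i, hi, h⟩ := h
  ⟨i, hi.trans hmn, hb ▸ h⟩

theorem ReachesIn.mono (h : ReachesIn M a b m) (hmn : m ≤ n) : ReachesIn M a b n :=
  let ⟨i, hi, h⟩ := h
  ⟨i, hi.trans hmn, h⟩

end

/-- The compiled program does what the program does, in the same number of steps. -/
theorem Exec.reachesIn {I Λ : Type} {M : Λ → Turing.TM2.Stmt (Alph K A I) Λ (Option A)}
    {p : Prog K A} {s s₁ : K → List A} {n : ℕ} (h : Exec p s s₁ n) :
    ∀ (emb : p.Lbl → Λ) (exit : Λ) (_ : ∀ l, M (emb l) = p.code emb exit l)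
      (i : List I) (o : List Bool) (v : Option A), ∃ v',
      ReachesIn M ⟨some (emb p.entry), v, contents i o s⟩ ⟨some exit, v', contents i o s₁⟩ n := by
  induction h with
  | skip s =>
    intro emb exit hM i o v
    exact ⟨v, .single (by simp [hM, Prog.code])⟩
  | push k a s =>
    intro emb exit hM i o v
    refine ⟨v, .single ?_⟩
    simp only [Turing.TM2.step, hM, Prog.code, Turing.TM2.stepAux]
    rw [← update_contents]
    rfl
  | @seq p q _ _ _ _ _ _ _ ih₁ ih₂ =>
    intro emb exit hM i o v
    obtain ⟨v₁, h₁⟩ := ih₁ (emb ∘ .inl) (emb (.inr q.entry)) (fun l => hM (.inl l)) i o v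
    obtain ⟨v₂, h₂⟩ := ih₂ (emb ∘ .inr) exit (fun l => hM (.inr l)) i o v₁
    exact ⟨v₂, h₁.trans h₂⟩
  | @popCase k f s _ n _ ih =>
    intro emb exit hM i o v
    obtain ⟨v₁, h₁⟩ := ih (fun l => emb (some ⟨_, l⟩)) exit (fun l => hM (some ⟨_, l⟩)) i o
      (s k).head?
    refine ⟨v₁, ((ReachesIn.single ?_).trans h₁).mono (by omega)⟩
    change some (Turing.TM2.stepAux (M (emb none)) _ _) = _
    rw [show M (emb none) = _ from hM none, ← update_contents]
    rfl
  | @done k c f s h =>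
    intro emb exit hM i o v
    refine ⟨(s k).head?, .single ?_⟩
    have h₁ : (s k).head?.any c = false := by
      cases hs : (s k).head? with
      | none => rfl
      | some a => exact h a (by simp [hs])
    change some (Turing.TM2.stepAux (M (emb none)) _ _) = _
    rw [show M (emb none) = _ from hM none]
    change some (cond ((s k).head?.any c) _ _) = _
    rw [h₁]
    rfl
  | @step k c f s s₁ s₂ a l m n hs hc _ _ ih₁ ih₂ =>
    intro emb exit hM i o v
    obtain ⟨v₁, h₁⟩ := ih₁ (fun l => emb (some ⟨_, l⟩)) (emb none) (fun l => hM (some ⟨_, l⟩)) i o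
      (some a)
    obtain ⟨v₂, h₂⟩ := ih₂ emb exit hM i o v₁
    refine ⟨v₂, ((ReachesIn.single ?_).trans (h₁.trans h₂)).mono (by omega)⟩
    change some (Turing.TM2.stepAux (M (emb none)) _ _) = _
    rw [show M (emb none) = _ from hM none]
    change some (cond ((s k).head?.any c) _ _) = _
    rw [← update_contents]
    have h₃ : (s k).head? = some a := by rw [hs]; rfl
    have h₄ : (contents i o s (some (some k)) : List A).head? = some a := h₃
    have h₅ : (contents i o s (some (some k)) : List A).tail = l := by
      change (s k).tail = l
      rw [hs]
      rfl
    rw [h₃, Option.any_some, hc, cond_true]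
    change some (Turing.TM2.stepAux _ (contents i o s (some (some k)) : List A).head? _) = _
    rw [h₄]
    exact congrArg (fun t : List A => some (⟨some (emb (some ⟨a, (f a).entry⟩)), some a,
      update (β := fun k => List (Alph K A I k)) (contents i o s) (some (some k)) t⟩ :
        Turing.TM2.Cfg (Alph K A I) Λ (Option A))) h₅
  | mono _ hmn ih =>
    intro emb exit hM i o v
    obtain ⟨v₁, h₁⟩ := ih emb exit hM i o v
    exact ⟨v₁, h₁.mono hmn⟩

/-- Clear all stacks in a list. -/
def clearAll : List K → Prog K A
  | [] => .skip
  | k :: l => .seq (.foreach k (fun _ => true) fun _ => .skip) (clearAll l)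

theorem exec_clear (k : K) (s : K → List A) :
    Exec (.foreach k (fun _ => true) fun _ => .skip) s (update s k []) (2 * (s k).length + 1) := by
  induction hl : s k generalizing s with
  | nil => exact (Exec.done (by simp [hl])).to (by rw [← hl, update_eq_self]) (by simp)
  | cons a l ih =>
    refine (Exec.step hl rfl (.skip _) (ih (update s k l) (by simp))).to (by simp) ?_
    simp only [List.length_cons]
    omega

theorem exec_clearAll (l : List K) (hl : l.Nodup) (s : K → List A) :
    Exec (clearAll l) s (fun k => if k ∈ l then [] else s k)
      (2 * (l.map fun k => (s k).length).sum + l.length + 1) := by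
  induction l generalizing s with
  | nil => exact (Exec.skip s).to (by simp) (by simp)
  | cons k l ih =>
    rw [List.nodup_cons] at hl
    refine ((exec_clear k s).seq (ih hl.2 _)).to ?_ ?_
    · funext j
      by_cases hj : j = k
      · subst hj; simp
      · simp [hj]
    · have : (l.map fun j => (update s k [] j).length) = l.map fun j => (s j).length :=
        List.map_congr_left fun j hj => by
          rw [update_of_ne]
          rintro rfl
          exact hl.1 hj
      simp only [this, List.map_cons, List.sum_cons, List.length_cons]
      omega

end Programs

section Machine

open Function

variable {K A I : Type} [DecidableEq K]

theorem update_contents_input (i i' : List I) (o : List Bool) (s : K → List A) :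
    update (β := fun k => List (Alph K A I k)) (contents i o s) none i' = contents i' o s := by
  funext j
  match j with
  | none => exact update_self (β := fun k => List (Alph K A I k)) _ _ _
  | some none => rfl
  | some (some j) => rfl

variable [Fintype K]

/-- The program `p`, followed by clearing all stacks other than `res`. -/
noncomputable def Prog.cleaned (p : Prog K A) (res : K) : Prog K A :=
  .seq p (clearAll (Finset.univ.erase res).toList)

/-- The machine that reads its input onto the stack `inp`, runs `p`, clears the stacks, and outputs
the truth value that the top symbol of the stack `res` stands for. Its labels are those of the
compiled program and two more, for reading the input (`none`) and for the output (`some none`). -/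
noncomputable def Prog.machine [Fintype A] [Inhabited A] [Fintype I] (p : Prog K A) (inp res : K)
    (sym : I → A) (dec : A → Bool) : Turing.TM2ComputableAux I Bool where
  tm :=
    { K := Stack K
      k₀ := none
      k₁ := some none
      Γ := Alph K A I
      Λ := Option (Option (p.cleaned res).Lbl)
      main := none
      ΛFin :=
        haveI := Prog.finite_lbl (p.cleaned res)
        Fintype.ofFinite _
      σ := Option A
      initialState := none
      Γk₀Fin := inferInstanceAs (Fintype I)
      m := fun l =>
        match l with
        | none => .pop none (fun _ (o : Option I) => o.map sym) (.branch Option.isSome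
            (.push (some (some inp)) (fun v => (v.getD default : A)) (.goto fun _ => none))
            (.goto fun _ => some (some (p.cleaned res).entry)))
        | some none => .pop (some (some res)) (fun _ o => o)
            (.push (some none) (fun v => (v.any dec : Bool)) (.load (fun _ => none) .halt))
        | some (some l) => (p.cleaned res).code (fun l => some (some l)) (some none) l }
  inputAlphabet := Equiv.refl I
  outputAlphabet := Equiv.refl Bool

open Classical in
/-- A program that leaves on the stack `res` the answer to `P` decides `P`. The input is on the
stack `inp` in reverse order, because it has been moved there symbol by symbol. The time for
clearing the stacks is paid by `Exec.sum_length_le`. -/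
theorem Exec.answersWithin {α : Type} [Fintype A] [Inhabited A] [Fintype I] {p : Prog K A}
    {inp res : K} {sym : I → A} {dec : A → Bool} {enc : α → List I} {P : α → Prop} {x : α}
    {s : K → List A} {a : A} {n : ℕ}
    (h : Exec p (update (fun _ => []) inp ((enc x).reverse.map sym)) s n)
    (hres : s res = [a]) (ha : dec a = true ↔ P x) :
    AnswersWithin (p.machine inp res sym dec) enc P x
      (3 * n + 3 * (enc x).length + Fintype.card K + 4) := by
  set M := (p.machine inp res sym dec).tm.m with hMdef
  have hread : ∀ (l : List I) (t : List A) (v : Option A),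
      ReachesIn M ⟨some none, v, contents l [] (update (fun _ => []) inp t)⟩
        ⟨some (some (some (p.cleaned res).entry)), none,
          contents [] [] (update (fun _ => []) inp (l.reverse.map sym ++ t))⟩ (l.length + 1) := by
    intro l
    induction l with
    | nil =>
      intro t v
      refine .single ?_
      exact congrArg (fun S => some (⟨_, none, S⟩ : Turing.TM2.Cfg (Alph K A I) _ (Option A)))
        (update_contents_input (A := A) [] [] [] (update (fun _ => []) inp t))
    | cons i l ih =>
      intro t v
      refine ((ReachesIn.single ?_).trans (ih (sym i :: t) (some (sym i)))).to ?_ ?_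
      · have h₁ := update_contents_input (A := A) (i :: l) l [] (update (fun _ => []) inp t)
        have h₂ := update_contents (A := A) l [] (update (fun _ => []) inp t) inp (sym i :: t)
        rw [update_idem] at h₂
        rw [← h₂, ← h₁]
        refine congrArg (fun u : List A => some (⟨some none, some (sym i),
          update (β := fun k => List (Alph K A I k)) _ (some (some inp)) (sym i :: u)⟩ :
          Turing.TM2.Cfg (Alph K A I) _ (Option A))) ?_
        exact update_self (β := fun _ => List A) inp t (fun _ => [])
      · simp
      · simp only [List.length_cons]
        omega
  have hclean := h.seq (exec_clearAll (Finset.univ.erase res).toList (Finset.nodup_toList _) s)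
  obtain ⟨v, hbody⟩ := hclean.reachesIn (M := M) (fun l => some (some l)) (some none)
    (fun _ => rfl) [] [] none
  have hhalt : ReachesIn M
      ⟨some (some none), v, contents [] []
        (fun k => if k ∈ (Finset.univ.erase res).toList then [] else s k)⟩
      ⟨none, none, contents [] [dec a] fun _ => []⟩ 1 := by
    refine .single ?_
    have h₁ : (fun k => if k ∈ (Finset.univ.erase res).toList then [] else s k) =
        update (fun _ => []) res [a] := by
      funext k
      by_cases hk : k = res
      · subst hk; simp [hres]
      · simp [hk]
    rw [h₁]
    have h₂ : (contents (I := I) [] [] (update (fun _ => []) res [a]) (some (some res)) : List A) =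
        [a] := update_self (β := fun _ => List A) res [a] (fun _ => [])
    have h₃ := update_contents (I := I) [] [] (update (fun _ => []) res [a]) res []
    rw [update_idem, update_eq_self] at h₃
    change some (⟨none, none, update (β := fun k => List (Alph K A I k))
      (update (β := fun k => List (Alph K A I k)) _ (some (some res))
        (contents (I := I) [] [] (update (fun _ => []) res [a]) (some (some res)) : List A).tail)
      (some none) [(contents (I := I) [] [] (update (fun _ => []) res [a])
        (some (some res)) : List A).head?.any dec]⟩ :
      Turing.TM2.Cfg (Alph K A I) _ (Option A)) = _
    rw [h₂]
    change some (⟨none, none, update (β := fun k => List (Alph K A I k))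
      (update (β := fun k => List (Alph K A I k)) _ (some (some res)) ([] : List A))
      (some none) [dec a]⟩ : Turing.TM2.Cfg (Alph K A I) _ (Option A)) = _
    rw [h₃]
    congr 2
    funext j
    match j with
    | none => rfl
    | some none => exact update_self (β := fun k => List (Alph K A I k)) _ _ _
    | some (some j) => rfl
  have hstart : Turing.initList (p.machine inp res sym dec).tm
      ((enc x).map (p.machine inp res sym dec).inputAlphabet.invFun) =
      ⟨some none, none, contents (enc x) [] (update (fun _ => []) inp [])⟩ := by
    refine congrArg (fun S => (⟨some none, none, S⟩ :
      Turing.TM2.Cfg (Alph K A I) _ (Option A))) ?_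
    funext j
    match j with
    | none => exact (List.map_id _)
    | some none => rfl
    | some (some j) =>
      exact (congrFun (update_eq_self (β := fun _ : K => List A) inp (fun _ => [])) j).symm
  have hend : Turing.haltList (p.machine inp res sym dec).tm
      ((Computability.encodeBool (decide (P x))).map
        (p.machine inp res sym dec).outputAlphabet.invFun) =
      ⟨none, none, contents [] [dec a] fun _ => []⟩ := by
    refine congrArg (fun S => (⟨none, none, S⟩ :
      Turing.TM2.Cfg (Alph K A I) _ (Option A))) ?_
    have hdec : dec a = decide (P x) := by
      rw [Bool.eq_iff_iff, ha, decide_eq_true_iff]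
    rw [hdec]
    funext j
    match j with
    | none => rfl
    | some none => rfl
    | some (some j) => rfl
  have hr := hread (enc x) [] none
  rw [List.append_nil] at hr
  obtain ⟨m, hm, hsteps⟩ := (hr.trans hbody).trans hhalt
  refine ⟨⟨⟨m, ?_⟩, hm.trans ?_⟩⟩
  · rw [hstart, Option.map_some, hend]
    exact hsteps
  · have hlen := h.sum_length_le
    have h₁ : ((Finset.univ.erase res).toList.map fun k => (s k).length).sum ≤
        ∑ k, (s k).length := by
      rw [Finset.sum_map_toList]
      exact Finset.sum_le_sum_of_subset (Finset.erase_subset _ _)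
    have h₂ : ∑ k, (update (fun _ => []) inp ((enc x).reverse.map sym) k).length =
        (enc x).length := by
      rw [Finset.sum_eq_single inp]
      · simp
      · intro k _ hk; simp [hk]
      · simp
    have h₃ : (Finset.univ.erase res).toList.length ≤ Fintype.card K := by
      rw [Finset.length_toList]
      exact (Finset.card_le_univ _)
    omega

end Machine

/-! ### Clauses, subsumption and unit propagation -/

/-- The function term of a literal. -/
def Literal.term : Literal → FunTerm
  | .eq t _ => t
  | .ne t _ => t

/-- The negation of a literal. -/
def Literal.not : Literal → Literal
  | .eq t n => .ne t n
  | .ne t n => .eq t n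

/-- The atom `t = n` of a literal, as a formula. -/
def Literal.atom : Literal → Formula
  | .eq t n => .eq t n
  | .ne t n => .eq t n

/-- A literal is covered by a clause `c` if it meets the condition that subsumption of `c` imposes
on the individual literals. -/
def Covers : Literal → Clause → Prop
  | .eq t n, c => .eq t n ∈ c ∨ ∃ n', n' ≠ n ∧ .ne t n' ∈ c
  | .ne t n, c => .ne t n ∈ c

theorem subsumes_iff {c d : Clause} : Subsumes c d ↔ ∀ l ∈ c, Covers l d := by
  refine ⟨fun h l hl => ?_, fun h => ⟨fun t n hl => h _ hl, fun t n hl => h _ hl⟩⟩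
  cases l with
  | eq t n => exact h.1 t n hl
  | ne t n => exact h.2 t n hl

theorem covers_of_mem {l : Literal} {c : Clause} (h : l ∈ c) : Covers l c := by
  cases l with
  | eq t n => exact .inl h
  | ne t n => exact h

theorem Covers.mono {l : Literal} {c d : Clause} (h : Covers l c) (hcd : ∀ l ∈ c, Covers l d) :
    Covers l d := by
  cases l with
  | eq t n =>
    rcases h with h | ⟨n', hn, h⟩
    · exact hcd _ h
    · exact .inr ⟨n', hn, hcd _ h⟩
  | ne t n => exact hcd _ h

theorem Covers.exists_term {l : Literal} {c : Clause} (h : Covers l c) :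
    ∃ l' ∈ c, l'.term = l.term := by
  cases l with
  | eq t n =>
    rcases h with h | ⟨n', hn, h⟩
    · exact ⟨_, h, rfl⟩
    · exact ⟨_, h, rfl⟩
  | ne t n => exact ⟨_, h, rfl⟩

/-- Unit propagation with `l` keeps a literal covered, unless `l` refutes that literal. -/
theorem Covers.propagate {l : Literal} {c : Clause} (h : Covers l c) (l' : Literal) :
    Covers l (propagate c l') ∨ Covers l' {l.not} := by
  have key : ∀ l₁, l₁ ∈ c → l₁ ∈ LimitedBelief.propagate c l' ∨ Complementary l₁ l' := by
    intro l₁ h₁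
    by_cases hc : Complementary l₁ l'
    · exact .inr hc
    · exact .inl (Finset.mem_filter.2 ⟨h₁, hc⟩)
  cases l with
  | eq t n =>
    rcases h with h | ⟨n', hn, h⟩
    · rcases key _ h with h | h
      · exact .inl (.inl h)
      · right
        cases l' with
        | eq t' n' =>
          obtain ⟨rfl, h⟩ := h
          exact .inr ⟨n, h, by simp [Literal.not]⟩
        | ne t' n' =>
          obtain ⟨rfl, rfl⟩ := h
          simp [Covers, Literal.not]
    · rcases key _ h with h | h
      · exact .inl (.inr ⟨n', hn, h⟩)
      · right
        cases l' with
        | eq t' n' =>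
          obtain ⟨rfl, rfl⟩ := h
          exact .inr ⟨n, hn.symm, by simp [Literal.not]⟩
        | ne t' n' => exact h.elim
  | ne t n =>
    rcases key _ h with h | h
    · exact .inl h
    · right
      cases l' with
      | eq t' n' =>
        obtain ⟨rfl, rfl⟩ := h
        exact .inl (by simp [Literal.not])
      | ne t' n' => exact h.elim

/-- If a literal is covered by `t = n` and covers `¬ t' = n'`, then `t = n` implies `¬ t' = n'`:
the terms agree, and the names differ. -/
theorem Covers.not_covers_not {t : FunTerm} {n : Name} {l : Literal} (h : Covers (.eq t n) {l})
    {t' : FunTerm} {n' : Name} (h' : Covers l {.ne t' n'}) : t = t' ∧ n ≠ n' := by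
  have := h.mono (d := {.ne t' n'}) (by simpa using h')
  rcases this with h | ⟨m, hm, h⟩
  · simp at h
  · simp only [Finset.mem_singleton, Literal.ne.injEq] at h
    exact ⟨h.1, h.2 ▸ hm.symm⟩

theorem UP.of_forall {s s' : Set Clause} (h : ∀ c ∈ s, UP s' c) {c : Clause} (hc : UP s c) :
    UP s' c := by
  induction hc with
  | base hc => exact h _ hc
  | prop _ _ ih₁ ih₂ => exact .prop ih₁ ih₂
  | sub _ hs ih => exact .sub ih hs

/-- Literals that are refuted by units of the closure can be dropped; they are propagated away one
at a time. -/
theorem UP.reduct {s : Set Clause} {c d : Clause} (hd : UP s d)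
    (h : ∀ l ∈ d, UP s {l.not} ∨ Covers l c) : UP s c := by
  induction hm : d.card using Nat.strong_induction_on generalizing d with
  | _ m ih =>
    by_cases hall : ∀ l ∈ d, Covers l c
    · exact .sub hd (subsumes_iff.2 hall)
    · push Not at hall
      obtain ⟨l, hl, hlc⟩ := hall
      have hn := (h l hl).resolve_right hlc
      have hlt : propagate d l.not ⊂ d := by
        refine Finset.filter_ssubset.2 ⟨l, hl, ?_⟩
        cases l <;> simp [Complementary, Literal.not]
      exact ih _ (hm ▸ Finset.card_lt_card hlt) (.prop hd hn)
        (fun l' hl' => h l' (hlt.subset hl')) rfl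

/-! ### Truth of formulas -/

theorem sat_of_toClause {a : Formula} {c : Clause} (h : a.toClause = some c) (s : Set Clause) :
    Sat s a ↔ UP s c := by
  match a with
  | .eq t n =>
    simp only [Formula.toClause, Option.some.injEq] at h
    rw [Sat, h]
  | .neg (.eq t n) =>
    simp only [Formula.toClause, Option.some.injEq] at h
    rw [Sat, h]
  | .or a b =>
    rw [Sat, h]
  | .neg (.neg a) => simp [Formula.toClause] at h
  | .neg (.or a b) => simp [Formula.toClause] at h
  | .neg (.bel k a) => simp [Formula.toClause] at h
  | .bel k a => simp [Formula.toClause] at h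

theorem sat_or {a b : Formula} (h : (Formula.or a b).toClause = none) (s : Set Clause) :
    Sat s (.or a b) ↔ Sat s a ∨ Sat s b := by
  rw [Sat, h]

theorem sat_neg_or (a b : Formula) (s : Set Clause) :
    Sat s (.neg (.or a b)) ↔ Sat s (.neg a) ∧ Sat s (.neg b) := by
  rw [Sat]

theorem sat_neg_neg (a : Formula) (s : Set Clause) : Sat s (.neg (.neg a)) ↔ Sat s a := by
  rw [Sat]

theorem sat_bel_zero (a : Formula) (s : Set Clause) : Sat s (.bel 0 a) ↔ Sat s a := by
  rw [Sat]

theorem sat_bel_succ (k : ℕ) (a : Formula) (s : Set Clause) :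
    Sat s (.bel (k + 1) a) ↔ ∃ t, ∀ n, Sat (s ∪ {{Literal.eq t n}}) (.bel k a) := by
  rw [Sat]

theorem sat_and (a b : Formula) (s : Set Clause) : Sat s (a.and b) ↔ Sat s a ∧ Sat s b := by
  rw [Formula.and, sat_neg_or, sat_neg_neg, sat_neg_neg]

theorem toClause_or {a b : Formula} {c : Clause} (h : (Formula.or a b).toClause = some c) :
    ∃ d e, a.toClause = some d ∧ b.toClause = some e ∧ c = d ∪ e := by
  rw [Formula.toClause] at h
  split at h
  · rename_i d e hd he
    exact ⟨d, e, hd, he, by simpa using h.symm⟩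
  · simp at h

theorem term_mem_of_toClause {a : Formula} {c : Clause} (h : a.toClause = some c) :
    ∀ l ∈ c, l.term ∈ a.funTerms := by
  induction a generalizing c with
  | eq t n =>
    simp only [Formula.toClause, Option.some.injEq] at h
    subst h
    simp [Literal.term, Formula.funTerms]
  | neg a ih =>
    cases a with
    | eq t n =>
      simp only [Formula.toClause, Option.some.injEq] at h
      subst h
      simp [Literal.term, Formula.funTerms]
    | _ => simp [Formula.toClause] at h
  | or a b iha ihb =>
    obtain ⟨d, e, hd, he, rfl⟩ := toClause_or h
    intro l hl
    rcases Finset.mem_union.1 hl with hl | hl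
    · exact Finset.mem_union_left _ (iha hd l hl)
    · exact Finset.mem_union_right _ (ihb he l hl)
  | bel k a => simp [Formula.toClause] at h

theorem objective_of_toClause {a : Formula} {c : Clause} (h : a.toClause = some c) :
    a.Objective := by
  induction a generalizing c with
  | eq t n => trivial
  | neg a ih =>
    cases a with
    | eq t n => trivial
    | _ => simp [Formula.toClause] at h
  | or a b iha ihb =>
    obtain ⟨d, e, hd, he, rfl⟩ := toClause_or h
    exact ⟨iha hd, ihb he⟩
  | bel k a => simp [Formula.toClause] at h

theorem Formula.IsCNF.objective {a : Formula} (h : a.IsCNF) : a.Objective := by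
  induction h with
  | clause h => exact objective_of_toClause h
  | and _ _ ha hb => exact ⟨ha, hb⟩

/-- The truth of an objective formula depends, monotonically, on the clauses in the closure that
only mention its function terms. -/
theorem sat_transfer {s s' : Set Clause} {a : Formula} (ha : a.Objective)
    (h : ∀ c : Clause, (∀ l ∈ c, l.term ∈ a.funTerms) → UP s c → UP s' c) :
    (Sat s a → Sat s' a) ∧ (Sat s (.neg a) → Sat s' (.neg a)) := by
  induction a with
  | eq t n =>
    constructor
    · intro hs
      rw [sat_of_toClause rfl] at hs ⊢
      exact h _ (by simp [Literal.term, Formula.funTerms]) hs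
    · intro hs
      rw [sat_of_toClause rfl] at hs ⊢
      exact h _ (by simp [Literal.term, Formula.funTerms]) hs
  | neg a ih =>
    have := ih ha h
    exact ⟨this.2, fun hs => (sat_neg_neg _ _).2 (this.1 ((sat_neg_neg _ _).1 hs))⟩
  | or a b iha ihb =>
    have h₁ := iha ha.1 fun c hc => h c fun l hl => Finset.mem_union_left _ (hc l hl)
    have h₂ := ihb ha.2 fun c hc => h c fun l hl => Finset.mem_union_right _ (hc l hl)
    constructor
    · intro hs
      cases hc : (Formula.or a b).toClause with
      | some c =>
        rw [sat_of_toClause hc] at hs ⊢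
        exact h c (term_mem_of_toClause hc) hs
      | none =>
        rw [sat_or hc] at hs ⊢
        exact hs.imp h₁.1 h₂.1
    · rw [sat_neg_or, sat_neg_or]
      exact And.imp h₁.2 h₂.2
  | bel k a => exact ha.elim

theorem sat_bel_mono {s s' : Set Clause} {a : Formula} (ha : a.Objective) (h : ∀ c ∈ s, UP s' c)
    (k : ℕ) (hs : Sat s (.bel k a)) : Sat s' (.bel k a) := by
  induction k generalizing s s' with
  | zero =>
    rw [sat_bel_zero] at hs ⊢
    exact (sat_transfer ha fun c _ hc => hc.of_forall h).1 hs
  | succ k ih =>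
    rw [sat_bel_succ] at hs ⊢
    obtain ⟨t, ht⟩ := hs
    refine ⟨t, fun n => ih ?_ (ht n)⟩
    rintro c (hc | hc)
    · exact (h c hc).of_forall fun d hd => .base (.inl hd)
    · exact .base (.inr hc)

/-- A split of an arbitrary term does no harm. -/
theorem sat_bel_succ_of_sat_bel {s : Set Clause} {a : Formula} (ha : a.Objective) (k : ℕ)
    (hs : Sat s (.bel k a)) : Sat s (.bel (k + 1) a) :=
  (sat_bel_succ _ _ _).2 ⟨⟨0, []⟩, fun _ => sat_bel_mono ha (fun _ hc => .base (.inl hc)) k hs⟩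

theorem sat_bel_of_le {s : Set Clause} {a : Formula} (ha : a.Objective) {k k' : ℕ} (h : k ≤ k')
    (hs : Sat s (.bel k a)) : Sat s (.bel k' a) := by
  induction h with
  | refl => exact hs
  | step _ ih => exact sat_bel_succ_of_sat_bel ha _ ih

/-- The subformulas, in the order in which their first symbols are met when the formula is read
backwards. -/
def Formula.nodes : Formula → List Formula
  | .eq t n => [.eq t n]
  | .neg a => a.nodes ++ [.neg a]
  | .or a b => b.nodes ++ (a.nodes ++ [.or a b])
  | .bel _ a => a.nodes

theorem mem_funTerms_iff {a : Formula} {t : FunTerm} :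
    t ∈ a.funTerms ↔ ∃ n, .eq t n ∈ a.nodes := by
  induction a with
  | eq t' n' => simp [Formula.funTerms, Formula.nodes]
  | neg a ih => simp [Formula.funTerms, Formula.nodes, ih]
  | or a b iha ihb =>
    simp only [Formula.funTerms, Formula.nodes, Finset.mem_union, iha, ihb, List.mem_append,
      List.mem_singleton, reduceCtorEq, or_false]
    rw [← exists_or]
    simp only [or_comm]
  | bel k a ih => simp [Formula.funTerms, Formula.nodes, ih]

/-- The values of a formula and of its negation if literals have the values `q`, conjunctions are
read as disjunctions and vice versa. -/
def dual (q : Literal → Bool) : Formula → Bool × Bool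
  | .eq t n => (q (.eq t n), q (.ne t n))
  | .neg a => ((dual q a).2, (dual q a).1)
  | .or a b => ((dual q a).1 && (dual q b).1, (dual q a).2 || (dual q b).2)
  | .bel _ _ => (false, false)

theorem dual_of_toClause {a : Formula} {c : Clause} (h : a.toClause = some c)
    (q : Literal → Bool) : (dual q a).1 = true ↔ ∀ l ∈ c, q l = true := by
  induction a generalizing c with
  | eq t n =>
    simp only [Formula.toClause, Option.some.injEq] at h
    subst h
    simp [dual]
  | neg a ih =>
    cases a with
    | eq t n =>
      simp only [Formula.toClause, Option.some.injEq] at h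
      subst h
      simp [dual]
    | _ => simp [Formula.toClause] at h
  | or a b iha ihb =>
    obtain ⟨d, e, hd, he, rfl⟩ := toClause_or h
    simp only [dual, Bool.and_eq_true, iha hd, ihb he, Finset.mem_union, or_imp, forall_and]
  | bel k a => simp [Formula.toClause] at h

theorem atom_mem_nodes {a : Formula} {c : Clause} (h : a.toClause = some c) :
    ∀ l ∈ c, l.atom ∈ a.nodes := by
  induction a generalizing c with
  | eq t n =>
    simp only [Formula.toClause, Option.some.injEq] at h
    subst h
    simp [Literal.atom, Formula.nodes]
  | neg a ih =>
    cases a with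
    | eq t n =>
      simp only [Formula.toClause, Option.some.injEq] at h
      subst h
      simp [Literal.atom, Formula.nodes]
    | _ => simp [Formula.toClause] at h
  | or a b iha ihb =>
    obtain ⟨d, e, hd, he, rfl⟩ := toClause_or h
    intro l hl
    rcases Finset.mem_union.1 hl with hl | hl
    · simp [Formula.nodes, iha hd l hl]
    · simp [Formula.nodes, ihb he l hl]
  | bel k a => simp [Formula.toClause] at h

/-- `Clauses a s₀`: the formula `a` stands for the set `s₀` of clauses. A test of literals that is
passed by all literals of some clause is evaluated by `dual`, without parsing `a` into clauses. -/
structure Clauses (a : Formula) (s₀ : Set Clause) : Prop where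
  sat_iff : ∀ s, Sat s a ↔ ∀ c ∈ s₀, UP s c
  dual_iff : ∀ q, (dual q a).1 = true ↔ ∃ c ∈ s₀, ∀ l ∈ c, q l = true
  atom_mem : ∀ c ∈ s₀, ∀ l ∈ c, l.atom ∈ a.nodes

theorem Formula.IsCNF.exists_clauses {a : Formula} (h : a.IsCNF) : ∃ s₀, Clauses a s₀ := by
  induction h with
  | @clause a c h =>
    refine ⟨{c}, fun s => ?_, fun q => ?_, ?_⟩
    · simp [sat_of_toClause h]
    · simp [dual_of_toClause h]
    · simpa using atom_mem_nodes h
  | @and a b _ _ iha ihb =>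
    obtain ⟨s₁, h₁⟩ := iha
    obtain ⟨s₂, h₂⟩ := ihb
    refine ⟨s₁ ∪ s₂, fun s => ?_, fun q => ?_, ?_⟩
    · simp only [sat_and, h₁.sat_iff, h₂.sat_iff, Set.mem_union, or_imp, forall_and]
    · simp only [Formula.and, dual, Bool.or_eq_true, h₁.dual_iff, h₂.dual_iff, Set.mem_union,
        or_and_right, exists_or]
    · rintro c (hc | hc) l hl
      · simp [Formula.and, Formula.nodes, h₁.atom_mem c hc l hl]
      · simp [Formula.and, Formula.nodes, h₂.atom_mem c hc l hl]

theorem toClause_formula (x : Instance) : x.formula.toClause = none := by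
  simp [Instance.formula, Formula.imp, Formula.toClause]

/-- As truth of `B_k α` is monotone in the set of clauses, it is enough to look at the clauses of
the knowledge base. -/
theorem Instance.holds_iff {x : Instance} {s₀ : Set Clause} (h : Clauses x.kb s₀) :
    x.Holds ↔ Sat s₀ (.bel x.level x.query) := by
  have key : ∀ s, Sat s x.formula ↔ (Sat s x.kb → Sat s (.bel x.level x.query)) := by
    intro s
    have hneg : Sat s (.neg (.bel 0 x.kb)) ↔ ¬ Sat s x.kb := by rw [Sat, sat_bel_zero]
    have := toClause_formula x
    rw [Instance.formula, Formula.imp] at this ⊢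
    rw [sat_or this, hneg, imp_iff_not_or]
  constructor
  · intro hv
    exact (key s₀).1 (hv s₀) ((h.sat_iff s₀).2 fun c hc => .base hc)
  · intro hs s
    rw [key]
    intro hkb
    exact sat_bel_mono x.query_objective ((h.sat_iff s).1 hkb) _ hs

/-! ### Splitting without repetition -/

/-- The unit clauses of a list of assignments of names to function terms. -/
def units (p : List (FunTerm × Name)) : Set Clause := {c | ∃ x ∈ p, c = {.eq x.1 x.2}}

theorem union_units_cons (s₀ : Set Clause) (t : FunTerm) (n : Name)
    (p : List (FunTerm × Name)) :
    s₀ ∪ units p ∪ {{Literal.eq t n}} = s₀ ∪ units ((t, n) :: p) := by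
  ext c
  simp only [units, Set.mem_union, Set.mem_ofPred_eq, Set.mem_singleton_iff, List.mem_cons,
    exists_eq_or_imp]
  rw [or_assoc]
  exact or_congr_right or_comm

/-- Belief by means of `r` splits of pairwise different function terms from `F`. -/
def Game (s₀ : Set Clause) (F : Finset FunTerm) (q : Formula) :
    ℕ → List (FunTerm × Name) → Prop
  | 0, p => Sat (s₀ ∪ units p) q
  | r + 1, p => ∃ t ∈ F, t ∉ p.map Prod.fst ∧ ∀ n, Game s₀ F q r ((t, n) :: p)

section

variable {s₀ : Set Clause} {F : Finset FunTerm} {q : Formula}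

/-- A split of a further term does no harm, as long as there is one. -/
theorem game_succ (hq : q.Objective) {r : ℕ} {p : List (FunTerm × Name)}
    (hr : r < F.card - p.length) (h : Game s₀ F q r p) : Game s₀ F q (r + 1) p := by
  induction r generalizing p with
  | zero =>
    have hlt : (p.map Prod.fst).toFinset.card < F.card :=
      (List.toFinset_card_le _).trans_lt (by rw [List.length_map]; omega)
    obtain ⟨t, ht, htp⟩ := Finset.exists_mem_notMem_of_card_lt_card hlt
    refine ⟨t, ht, by simpa using htp, fun n => ?_⟩
    refine (sat_transfer hq fun c _ hc => hc.of_forall fun d hd => .base ?_).1 h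
    rw [← union_units_cons]
    exact .inl hd
  | succ r ih =>
    obtain ⟨t, ht, htp, h⟩ := h
    exact ⟨t, ht, htp, fun n => ih (by rw [List.length_cons]; omega) (h n)⟩

theorem game_of_le (hq : q.Objective) {r r' : ℕ} {p : List (FunTerm × Name)} (hrr : r ≤ r')
    (hr : r' ≤ F.card - p.length) (h : Game s₀ F q r p) : Game s₀ F q r' p := by
  induction hrr with
  | refl => exact h
  | step hle ih => exact game_succ hq (by omega) (ih (by omega))

/-- Assignments to function terms outside `F` do not contribute to what is derivable
about the terms in `F`. -/
theorem UP.restrict (hs₀ : ∀ c ∈ s₀, ∀ l ∈ c, l.term ∈ F) {p : List (FunTerm × Name)}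
    (hp : (p.map Prod.fst).Nodup) {c : Clause} (h : UP (s₀ ∪ units p) c) :
    UP (s₀ ∪ units (p.filter fun x => x.1 ∈ F)) (c.filter fun l => l.term ∈ F) ∨
      ∃ x ∈ p, x.1 ∉ F ∧ Covers (.eq x.1 x.2) c := by
  have hfun : ∀ x ∈ p, ∀ y ∈ p, x.1 = y.1 → x.2 = y.2 := fun x hx y hy hxy => by
    rw [List.inj_on_of_nodup_map hp hx hy hxy]
  induction h with
  | @base c hc =>
    rcases hc with hc | ⟨x, hx, rfl⟩
    · left
      rw [Finset.filter_true_of_mem (hs₀ c hc)]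
      exact .base (.inl hc)
    · by_cases hxF : x.1 ∈ F
      · left
        rw [Finset.filter_true_of_mem (by simpa [Literal.term] using hxF)]
        exact .base (.inr ⟨x, by simp [hx, hxF], rfl⟩)
      · exact .inr ⟨x, hx, hxF, .inl (by simp)⟩
  | @sub c d _ hsub ih =>
    rw [subsumes_iff] at hsub
    rcases ih with ih | ⟨x, hx, hxF, hcov⟩
    · left
      refine .sub ih (subsumes_iff.2 fun l hl => ?_)
      obtain ⟨hl, hlF⟩ := Finset.mem_filter.1 hl
      have := hsub l hl
      cases l with
      | eq t n =>
        rcases this with h | ⟨n', hn, h⟩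
        · exact .inl (Finset.mem_filter.2 ⟨h, hlF⟩)
        · exact .inr ⟨n', hn, Finset.mem_filter.2 ⟨h, hlF⟩⟩
      | ne t n => exact Finset.mem_filter.2 ⟨this, hlF⟩
    · exact .inr ⟨x, hx, hxF, hcov.mono hsub⟩
  | @prop c l _ _ ihc ihl =>
    have hcomp : ∀ l', Complementary l' l → l'.term = l.term := by
      intro l' h
      cases l' <;> cases l <;> simp_all [Complementary, Literal.term]
    have hcov : ∀ x ∈ p, Covers (.eq x.1 x.2) c → ¬ Covers l {Literal.ne x.1 x.2} →
        Covers (.eq x.1 x.2) (propagate c l) := fun x _ hx hl =>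
      (hx.propagate l).resolve_right hl
    by_cases hlF : l.term ∈ F
    · rcases ihl with ihl | ⟨y, hy, hyF, hycov⟩
      · rw [Finset.filter_true_of_mem (by simpa using hlF)] at ihl
        rcases ihc with ihc | ⟨x, hx, hxF, hxcov⟩
        · left
          have := ihc.prop ihl
          rwa [propagate, Finset.filter_comm] at this
        · refine .inr ⟨x, hx, hxF, hcov x hx hxcov fun h => hxF ?_⟩
          obtain ⟨l', hl', hterm⟩ := h.exists_term
          rw [Finset.mem_singleton.1 hl'] at hterm
          rw [← hterm] at hlF
          exact hlF
      · obtain ⟨l', hl', hterm⟩ := hycov.exists_term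
        rw [Finset.mem_singleton.1 hl'] at hterm
        rw [hterm] at hlF
        exact (hyF hlF).elim
    · rcases ihl with ihl | ⟨y, hy, hyF, hycov⟩
      · left
        rw [Finset.filter_false_of_mem (by simpa using hlF)] at ihl
        exact .sub ihl (subsumes_iff.2 (by simp))
      · rcases ihc with ihc | ⟨x, hx, hxF, hxcov⟩
        · left
          have : (propagate c l).filter (fun l => l.term ∈ F) = c.filter fun l => l.term ∈ F := by
            rw [propagate, Finset.filter_filter]
            refine Finset.filter_congr fun l' _ => ⟨And.right, fun h => ⟨fun hc => hlF ?_, h⟩⟩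
            rw [← hcomp _ hc]
            exact h
          rwa [this]
        · refine .inr ⟨x, hx, hxF, hcov x hx hxcov fun h => ?_⟩
          obtain ⟨h₁, h₂⟩ := hycov.not_covers_not h
          exact h₂ (hfun y hy x hx h₁)

/-- Whatever is believed at level `k` is believed by splitting at most `k` pairwise
different function terms of `F`: other splits can be left out. -/
theorem game_of_sat (hs₀ : ∀ c ∈ s₀, ∀ l ∈ c, l.term ∈ F) (hq : q.Objective)
    (hqF : q.funTerms ⊆ F) (k : ℕ) {p : List (FunTerm × Name)} (hp : (p.map Prod.fst).Nodup)
    (h : Sat (s₀ ∪ units p) (.bel k q)) :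
    Game s₀ F q (min k (F.card - (p.filter fun x => x.1 ∈ F).length))
      (p.filter fun x => x.1 ∈ F) := by
  induction k generalizing p with
  | zero =>
    rw [sat_bel_zero] at h
    rw [Nat.zero_min]
    refine (sat_transfer hq fun c hc hup => ?_).1 h
    rcases hup.restrict hs₀ hp with hup | ⟨x, _, hxF, hcov⟩
    · rwa [Finset.filter_true_of_mem fun l hl => hqF (hc l hl)] at hup
    · obtain ⟨l, hl, hterm⟩ := hcov.exists_term
      exact (hxF (by have := hqF (hc l hl); rwa [hterm] at this)).elim
  | succ k ih =>
    rw [sat_bel_succ] at h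
    obtain ⟨t, ht⟩ := h
    simp only [union_units_cons] at ht
    by_cases htp : t ∈ p.map Prod.fst
    · obtain ⟨⟨t, n⟩, hx, rfl⟩ := List.mem_map.1 htp
      have heq : units ((t, n) :: p) = units p := by
        ext c
        simp only [units, List.mem_cons, exists_eq_or_imp, Set.mem_ofPred_eq, or_iff_right_iff_imp]
        exact fun h => ⟨_, hx, h⟩
      have := ht n
      rw [heq] at this
      exact game_of_le hq (by omega) (by omega) (ih hp this)
    · have hp' : ∀ n, (((t, n) :: p).map Prod.fst).Nodup := fun n => List.nodup_cons.2 ⟨htp, hp⟩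
      by_cases htF : t ∈ F
      · have hnot : t ∉ (p.filter fun x => x.1 ∈ F).map Prod.fst := fun h =>
          htp ((List.filter_sublist.map _).subset h)
        have hnodup : ((p.filter fun x => x.1 ∈ F).map Prod.fst).Nodup :=
          hp.sublist (List.filter_sublist.map _)
        have hlt : (p.filter fun x => x.1 ∈ F).length < F.card := by
          have hsub : insert t ((p.filter fun x => x.1 ∈ F).map Prod.fst).toFinset ⊆ F := by
            intro t' ht'
            rcases Finset.mem_insert.1 ht' with rfl | ht'
            · exact htF
            · obtain ⟨x, hx, rfl⟩ := List.mem_map.1 (List.mem_toFinset.1 ht')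
              simpa using (List.mem_filter.1 hx).2
          have hcard := Finset.card_le_card hsub
          rw [Finset.card_insert_of_notMem (by simpa using hnot),
            List.toFinset_card_of_nodup hnodup, List.length_map] at hcard
          omega
        have hmin : min (k + 1) (F.card - (p.filter fun x => x.1 ∈ F).length) =
            min k (F.card - ((p.filter fun x => x.1 ∈ F).length + 1)) + 1 := by omega
        rw [hmin]
        refine ⟨t, htF, hnot, fun n => ?_⟩
        have := ih (hp' n) (ht n)
        rwa [List.filter_cons_of_pos (by simpa using htF), List.length_cons] at this
      · have := ih (hp' 0) (ht 0)
        rw [List.filter_cons_of_neg (by simpa using htF)] at this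
        exact game_of_le hq (by omega) (by omega) this

end

/-! ### Tables of derived clauses -/

/-- The disjunction of pairs of truth values. -/
def por (a b : Bool × Bool) : Bool × Bool := (a.1 || b.1, a.2 || b.2)

/-- A column of the table that is kept by the decision procedure has two entries; `i = false`
refers to the clause that the formula `a` is, `i = true` to the clause `¬ t = n` if `a` is the
atom `t = n`. -/
def column : Formula → Bool → Option Clause
  | a, false => a.toClause
  | .eq t n, true => some {.ne t n}
  | _, true => none

/-- An entry of a pair of truth values. -/
def entry (b : Bool × Bool) : Bool → Bool
  | false => b.1
  | true => b.2

theorem entry_por (a b : Bool × Bool) (i : Bool) :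
    entry (por a b) i = (entry a i || entry b i) := by
  cases i <;> rfl

/-- How a column is related to a function term `t` and a name `n`: whether the column belongs to an
atom, and whether its two clauses cover the literals `t = n` (`e`), `¬ t = n` (`n`), and `t = n'`
for a name `n'` that is not mentioned (`f`). -/
structure Cell where
  lit : Bool
  e : Bool × Bool
  n : Bool × Bool
  f : Bool × Bool
  deriving DecidableEq, Fintype, Inhabited

/-- The cell of an atom, from the answers to whether the names agree and the terms agree. -/
def Cell.ofRel (name term : Bool) : Cell :=
  ⟨true, (term && name, term && !name), (false, term && name), (false, term)⟩

/-- The cell of the negation of a formula. -/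
def Cell.neg (c : Cell) : Cell :=
  ⟨false, c.e.swap, c.n.swap, c.f.swap⟩

/-- The cell of a disjunction. -/
def Cell.or (c d : Cell) : Cell :=
  ⟨false, (c.e.1 || d.e.1, false), (c.n.1 || d.n.1, false), (c.f.1 || d.f.1, false)⟩

/-- The cell of a column in the row of `t` and `n`. -/
def cov (t : FunTerm) (n : Name) : Formula → Cell
  | .eq t' n' => .ofRel (n = n') (t = t')
  | .neg a => (cov t n a).neg
  | .or a b => (cov t n a).or (cov t n b)
  | .bel _ _ => ⟨false, (false, false), (false, false), (false, false)⟩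

theorem cov_toClause {a : Formula} {c : Clause} (h : a.toClause = some c) (t : FunTerm)
    (n : Name) : ((cov t n a).e.1 = true ↔ Covers (.eq t n) c) ∧
      ((cov t n a).n.1 = true ↔ Covers (.ne t n) c) := by
  induction a generalizing c with
  | eq t' n' =>
    simp only [Formula.toClause, Option.some.injEq] at h
    subst h
    simp [cov, Cell.ofRel, Covers]
  | neg a ih =>
    cases a with
    | eq t' n' =>
      simp only [Formula.toClause, Option.some.injEq] at h
      subst h
      simp only [cov, Cell.neg, Cell.ofRel, Covers, Prod.swap, Finset.mem_singleton,
        Bool.and_eq_true, decide_eq_true_eq, Bool.not_eq_true', decide_eq_false_iff_not,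
        Literal.ne.injEq, reduceCtorEq, false_or, and_true]
      exact ⟨fun h => ⟨n', Ne.symm h.2, h.1, rfl⟩, fun ⟨m, h₁, h₂, h₃⟩ => ⟨h₂, h₃ ▸ h₁.symm⟩⟩
    | _ => simp [Formula.toClause] at h
  | or a b iha ihb =>
    obtain ⟨d, e, hd, he, rfl⟩ := toClause_or h
    simp only [cov, Cell.or, Bool.or_eq_true, iha hd, ihb he, Covers, Finset.mem_union,
      and_or_left, exists_or, and_true]
    exact or_or_or_comm
  | bel k a => simp [Formula.toClause] at h

theorem entry_cov {a : Formula} {i : Bool} {c : Clause} (h : column a i = some c) (t : FunTerm)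
    (n : Name) : (entry (cov t n a).e i = true ↔ Covers (.eq t n) c) ∧
      (entry (cov t n a).n i = true ↔ Covers (.ne t n) c) := by
  cases i with
  | false => exact cov_toClause h t n
  | true =>
    cases a with
    | eq t' n' =>
      have := cov_toClause (a := .neg (.eq t' n')) (c := c) (t := t) (n := n)
      exact this h
    | _ => simp [column] at h

/-- The components `lit` and `n` of a cell identify the column of the atom of the row. -/
theorem cov_lit {t : FunTerm} {n : Name} {a : Formula} :
    ((cov t n a).lit = true ∧ (cov t n a).n.2 = true) ↔ a = .eq t n := by
  cases a with
  | eq t' n' =>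
    simp only [cov, Cell.ofRel, Bool.and_eq_true, decide_eq_true_eq, true_and, Formula.eq.injEq]
    constructor <;> rintro ⟨rfl, rfl⟩ <;> exact ⟨rfl, rfl⟩
  | _ => simp [cov, Cell.neg, Cell.or]

/-- The components `lit` and `f` of a cell identify the atoms with the term of the row. -/
theorem cov_lit_term {t : FunTerm} {n : Name} {a : Formula} :
    ((cov t n a).lit = true ∧ (cov t n a).f.2 = true) ↔ ∃ n', a = .eq t n' := by
  cases a with
  | eq t' n' => simp [cov, Cell.ofRel, eq_comm]
  | _ => simp [cov, Cell.neg, Cell.or]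

/-- A name that is not mentioned with `t` behaves like a name that is not mentioned at all. -/
theorem cov_fresh {t : FunTerm} {n z : Name} {a : Formula}
    (h : .eq t z ∉ a.nodes) : (cov t n a).f = (cov t z a).e := by
  induction a with
  | eq t' n' =>
    by_cases ht : t = t'
    · have : z ≠ n' := by
        rintro rfl
        exact h (by simp [Formula.nodes, ht])
      simp [cov, Cell.ofRel, this]
    · simp [cov, Cell.ofRel, ht]
  | neg a ih =>
    have := ih fun ht' => h (by simp [Formula.nodes, ht'])
    simp [cov, Cell.neg, this]
  | or a b iha ihb =>
    have h₁ := iha fun ht' => h (by simp [Formula.nodes, ht'])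
    have h₂ := ihb fun ht' => h (by simp [Formula.nodes, ht'])
    simp [cov, Cell.or, h₁, h₂]
  | bel k a => rfl

/-- A table holds, for each column, which of its two clauses are known to be derivable. -/
abbrev Table := Formula → Bool × Bool

/-- Whether the literals `t = n` and `¬ t = n` are refuted by units in the table. -/
def dead (ns : List Formula) (u : Table) (t : FunTerm) (n : Name) : Bool × Bool :=
  (ns.any fun a => (cov t n a).lit && (cov t n a).n.2 && (u a).2,
    ns.any fun a => (cov t n a).lit && (cov t n a).n.2 && (u a).1)

theorem dead_fst {ns : List Formula} {u : Table} {t : FunTerm} {n : Name} :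
    (dead ns u t n).1 = true ↔ .eq t n ∈ ns ∧ (u (.eq t n)).2 = true := by
  simp only [dead, List.any_eq_true, Bool.and_eq_true, cov_lit]
  constructor
  · rintro ⟨a, h₁, rfl, h₂⟩
    exact ⟨h₁, h₂⟩
  · rintro ⟨h₁, h₂⟩
    exact ⟨_, h₁, rfl, h₂⟩

theorem dead_snd {ns : List Formula} {u : Table} {t : FunTerm} {n : Name} :
    (dead ns u t n).2 = true ↔ .eq t n ∈ ns ∧ (u (.eq t n)).1 = true := by
  simp only [dead, List.any_eq_true, Bool.and_eq_true, cov_lit]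
  constructor
  · rintro ⟨a, h₁, rfl, h₂⟩
    exact ⟨h₁, h₂⟩
  · rintro ⟨h₁, h₂⟩
    exact ⟨_, h₁, rfl, h₂⟩

/-- Whether a literal of the knowledge base is refuted, or covered by an entry of the column
`a`. -/
def litVal (ns : List Formula) (u : Table) (a : Formula) (i : Bool) : Literal → Bool
  | .eq t n => (dead ns u t n).1 || entry (cov t n a).e i
  | .ne t n => (dead ns u t n).2 || entry (cov t n a).n i

/-- The values of a subformula `b` of the knowledge base in the column `a`. Of the pairs `p` and
`n`, the first refers to `b` and the second to its negation. -/
structure Val where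
  p : Bool × Bool
  n : Bool × Bool
  deriving DecidableEq, Fintype, Inhabited

/-- The value of a negation. -/
def Val.neg (x : Val) : Val := ⟨x.n, x.p⟩

/-- The value of a disjunction. -/
def Val.or (x y : Val) : Val := ⟨(x.p.1 && y.p.1, x.p.2 && y.p.2), por x.n y.n⟩

/-- The value of an atom, given whether the literals are refuted. -/
def Val.ofCell (d : Bool × Bool) (c : Cell) : Val :=
  ⟨(d.1 || c.e.1, d.1 || c.e.2), (d.2 || c.n.1, d.2 || c.n.2)⟩

/-- The value of a formula `b` in the column `a`. -/
def val (ns : List Formula) (u : Table) (a : Formula) : Formula → Val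
  | .eq t n => .ofCell (dead ns u t n) (cov t n a)
  | .neg b => (val ns u a b).neg
  | .or b c => (val ns u a b).or (val ns u a c)
  | .bel _ _ => ⟨(false, false), (false, false)⟩

/-- In the column `a`, the knowledge base is evaluated by `dual`. -/
theorem entry_val (ns : List Formula) (u : Table) (a b : Formula) (i : Bool) :
    entry (val ns u a b).p i = (dual (litVal ns u a i) b).1 ∧
      entry (val ns u a b).n i = (dual (litVal ns u a i) b).2 := by
  induction b with
  | eq t n => cases i <;> exact ⟨rfl, rfl⟩
  | neg b ih => exact ⟨ih.2, ih.1⟩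
  | or b c ihb ihc =>
    simp only [dual, ← ihb.1, ← ihb.2, ← ihc.1, ← ihc.2]
    cases i <;> exact ⟨rfl, rfl⟩
  | bel k b => cases i <;> exact ⟨rfl, rfl⟩

/-- One round of unit propagation and subsumption. -/
def round (ns : List Formula) (kb : Formula) (u : Table) : Table :=
  fun a => por (u a) (val ns u a kb).p

/-- The table after all rounds. -/
def closure (ns : List Formula) (kb : Formula) (u : Table) : Table :=
  (round ns kb)^[2 * ns.length] u

/-- The entries of the table are derivable. -/
def Table.Sound (ns : List Formula) (s : Set Clause) (u : Table) : Prop :=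
  ∀ a ∈ ns, ∀ i c, column a i = some c → entry (u a) i = true → UP s c

theorem Table.Sound.round {s₀ s : Set Clause} {kb : Formula} (hkb : Clauses kb s₀)
    (hs : ∀ c ∈ s₀, UP s c) {ns : List Formula} {u : Table} (hu : u.Sound ns s) :
    (round ns kb u).Sound ns s := by
  intro a ha i c hc h
  rw [LimitedBelief.round, entry_por, Bool.or_eq_true] at h
  rcases h with h | h
  · exact hu a ha i c hc h
  · rw [(entry_val ns u a kb i).1, hkb.dual_iff] at h
    obtain ⟨d, hd, h⟩ := h
    refine (hs d hd).reduct fun l hl => ?_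
    have := h l hl
    cases l with
    | eq t n =>
      simp only [litVal, Bool.or_eq_true, dead_fst, (entry_cov hc t n).1] at this
      exact this.imp_left fun h => hu (.eq t n) h.1 true _ rfl h.2
    | ne t n =>
      simp only [litVal, Bool.or_eq_true, dead_snd, (entry_cov hc t n).2] at this
      exact this.imp_left fun h => hu (.eq t n) h.1 false _ rfl h.2

theorem Table.Sound.closure {s₀ s : Set Clause} {kb : Formula} (hkb : Clauses kb s₀)
    (hs : ∀ c ∈ s₀, UP s c) {ns : List Formula} {u : Table} (hu : u.Sound ns s) :
    (closure ns kb u).Sound ns s :=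
  Function.Iterate.rec (fun v : Table => v.Sound ns s) hu (fun _ h => h.round hkb hs) _

/-- The table does not change any more. -/
def Stable (ns : List Formula) (kb : Formula) (u : Table) : Prop :=
  ∀ a ∈ ns, round ns kb u a = u a

theorem val_congr {ns : List Formula} {u u' : Table} (h : ∀ a ∈ ns, u a = u' a) (a b : Formula) :
    val ns u a b = val ns u' a b := by
  have hd : ∀ t n, dead ns u t n = dead ns u' t n := by
    intro t n
    refine Prod.ext ?_ ?_ <;> rw [Bool.eq_iff_iff]
    · rw [dead_fst, dead_fst]
      exact and_congr_right fun h' => by rw [h _ h']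
    · rw [dead_snd, dead_snd]
      exact and_congr_right fun h' => by rw [h _ h']
  induction b with
  | eq t n => rw [val, val, hd]
  | neg b ih => rw [val, val, ih]
  | or b c ihb ihc => rw [val, val, ihb, ihc]
  | bel k b => rfl

theorem Stable.round {ns : List Formula} {kb : Formula} {u : Table} (h : Stable ns kb u) :
    Stable ns kb (round ns kb u) := by
  intro a ha
  change por (LimitedBelief.round ns kb u a) (val ns (LimitedBelief.round ns kb u) a kb).p = _
  rw [val_congr h, h a ha]
  exact h a ha

/-- The number of entries in the table. -/
def weight (ns : List Formula) (u : Table) : ℕ :=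
  (ns.map fun a => (u a).1.toNat + (u a).2.toNat).sum

theorem weight_le (ns : List Formula) (u : Table) : weight ns u ≤ 2 * ns.length := by
  unfold weight
  induction ns with
  | nil => simp
  | cons a ns ih =>
    have h₁ := Bool.toNat_le (u a).1
    have h₂ := Bool.toNat_le (u a).2
    simp only [List.map_cons, List.sum_cons, List.length_cons]
    omega

theorem weight_lt {ns : List Formula} {kb : Formula} {u : Table} (h : ¬ Stable ns kb u) :
    weight ns u < weight ns (round ns kb u) := by
  have hle : ∀ a, (u a).1.toNat + (u a).2.toNat ≤
      (round ns kb u a).1.toNat + (round ns kb u a).2.toNat := by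
    intro a
    simp only [round, por]
    generalize u a = x
    generalize (val ns u a kb).p = y
    obtain ⟨x₁, x₂⟩ := x
    obtain ⟨y₁, y₂⟩ := y
    revert x₁ x₂ y₁ y₂
    decide
  unfold Stable at h
  push Not at h
  obtain ⟨a, ha, hne⟩ := h
  refine List.sum_lt_sum _ _ (fun b _ => hle b) ⟨a, ha, ?_⟩
  revert hne
  simp only [round, por]
  generalize u a = x
  generalize (val ns u a kb).p = y
  obtain ⟨x₁, x₂⟩ := x
  obtain ⟨y₁, y₂⟩ := y
  revert x₁ x₂ y₁ y₂
  decide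

/-- As the table has `2 * ns.length` entries, that many rounds suffice. -/
theorem stable_closure (ns : List Formula) (kb : Formula) (u : Table) :
    Stable ns kb (closure ns kb u) := by
  have key : ∀ i, Stable ns kb ((round ns kb)^[i] u) ∨ i ≤ weight ns ((round ns kb)^[i] u) := by
    intro i
    induction i with
    | zero => exact .inr (Nat.zero_le _)
    | succ i ih =>
      rw [Function.iterate_succ_apply']
      by_cases h : Stable ns kb ((round ns kb)^[i] u)
      · exact .inl h.round
      · have := weight_lt h
        have := ih.resolve_left h
        exact .inr (by omega)
  by_contra h
  have h₁ := (key (2 * ns.length)).resolve_left h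
  have h₂ := weight_lt h
  have h₃ := weight_le ns (round ns kb (closure ns kb u))
  unfold closure at *
  omega

theorem entry_closure_of_entry (ns : List Formula) (kb : Formula) {u : Table} {a : Formula}
    {i : Bool} (h : entry (u a) i = true) : entry (closure ns kb u a) i = true := by
  refine Function.Iterate.rec (fun v : Table => entry (v a) i = true) h (fun v hv => ?_) _
  rw [round, entry_por, hv, Bool.true_or]

/-- The table contains all columns that are derivable. -/
def Table.Full (ns : List Formula) (s : Set Clause) (u : Table) : Prop :=
  ∀ a ∈ ns, ∀ i c, column a i = some c → UP s c → entry (u a) i = true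

/-- A stable table is complete: the clauses that are covered according to the table are closed
under unit propagation and subsumption. -/
theorem full_of_stable {s₀ : Set Clause} {kb : Formula} (hkb : Clauses kb s₀) {ns : List Formula}
    (hns : ∀ a ∈ kb.nodes, a ∈ ns) {u : Table} (hu : Stable ns kb u)
    {p : List (FunTerm × Name)} (hp : (p.map Prod.fst).Nodup)
    (hup : ∀ x ∈ p, ∀ a ∈ ns, ∀ i, entry (cov x.1 x.2 a).e i = true → entry (u a) i = true) :
    u.Full ns (s₀ ∪ units p) := by
  have hfun : ∀ x ∈ p, ∀ y ∈ p, x.1 = y.1 → x.2 = y.2 := fun x hx y hy hxy => by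
    rw [List.inj_on_of_nodup_map hp hx hy hxy]
  -- the literal `l` is refuted according to the table
  let D : Literal → Prop := fun l => match l with
    | .eq t n => (dead ns u t n).1 = true
    | .ne t n => (dead ns u t n).2 = true
  let X : Clause → Prop := fun c =>
    (∃ d ∈ s₀, ∀ l ∈ d, D l ∨ Covers l c) ∨ ∃ x ∈ p, Covers (.eq x.1 x.2) c
  have hentry : ∀ a ∈ ns, ∀ i c, column a i = some c → X c → entry (u a) i = true := by
    intro a ha i c hc hX
    rcases hX with ⟨d, hd, h⟩ | ⟨x, hx, h⟩
    · rw [← hu a ha, round, entry_por, (entry_val ns u a kb i).1, Bool.or_eq_true,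
        hkb.dual_iff]
      refine .inr ⟨d, hd, fun l hl => ?_⟩
      cases l with
      | eq t n =>
        simp only [litVal, Bool.or_eq_true, (entry_cov hc t n).1]
        exact h _ hl
      | ne t n =>
        simp only [litVal, Bool.or_eq_true, (entry_cov hc t n).2]
        exact h _ hl
    · exact hup x hx a ha i ((entry_cov hc _ _).1.2 h)
  have hmem : ∀ d ∈ s₀, ∀ l ∈ d, l.atom ∈ ns := fun d hd l hl => hns _ (hkb.atom_mem d hd l hl)
  have hdead : ∀ l : Literal, l.atom ∈ ns → X {l.not} → D l := by
    intro l hl hX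
    cases l with
    | eq t n => exact dead_fst.2 ⟨hl, hentry _ hl true _ rfl hX⟩
    | ne t n => exact dead_snd.2 ⟨hl, hentry _ hl false _ rfl hX⟩
  have hsub : ∀ c d, X c → (∀ l ∈ c, Covers l d) → X d := by
    rintro c d (⟨e, he, h⟩ | ⟨x, hx, h⟩) hcd
    · exact .inl ⟨e, he, fun l hl => (h l hl).imp_right fun h' => h'.mono hcd⟩
    · exact .inr ⟨x, hx, h.mono hcd⟩
  have hX : ∀ c, UP (s₀ ∪ units p) c → X c := by
    intro c hc
    induction hc with
    | @base c hc =>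
      rcases hc with hc | ⟨x, hx, rfl⟩
      · exact .inl ⟨c, hc, fun l hl => .inr (covers_of_mem hl)⟩
      · exact .inr ⟨x, hx, .inl (by simp)⟩
    | sub _ hs ih => exact hsub _ _ ih (subsumes_iff.1 hs)
    | @prop c l _ _ ihc ihl =>
      have hnot : ∀ l' : Literal, Covers l {l'.not} → X {l'.not} := fun l' h =>
        hsub _ _ ihl (by simpa using h)
      rcases ihc with ⟨d, hd, h⟩ | ⟨x, hx, h⟩
      · refine .inl ⟨d, hd, fun l' hl' => ?_⟩
        rcases h l' hl' with h' | h'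
        · exact .inl h'
        · rcases h'.propagate l with h' | h'
          · exact .inr h'
          · exact .inl (hdead l' (hmem d hd l' hl') (hnot l' h'))
      · rcases h.propagate l with h | h
        · exact .inr ⟨x, hx, h⟩
        · -- the assignment is refuted, hence some clause has no literal left
          rcases hnot (.eq x.1 x.2) h with ⟨d, hd, h⟩ | ⟨y, hy, h⟩
          · refine .inl ⟨d, hd, fun l' hl' => .inl ?_⟩
            rcases h l' hl' with h' | h'
            · exact h'
            · refine hdead l' (hmem d hd l' hl') (.inr ⟨x, hx, ?_⟩)
              cases l' with
              | eq t n =>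
                simp only [Covers, Literal.not, Finset.mem_singleton, reduceCtorEq, false_or,
                  Literal.ne.injEq] at h' ⊢
                obtain ⟨n', h₁, rfl, rfl⟩ := h'
                exact ⟨n, h₁.symm, rfl, rfl⟩
              | ne t n =>
                simp only [Covers, Literal.not, Finset.mem_singleton, Literal.ne.injEq] at h' ⊢
                rw [h'.1, h'.2]
                exact .inl rfl
          · obtain ⟨h₁, h₂⟩ := h.not_covers_not (t' := x.1) (n' := x.2)
              (by simp [Covers, Literal.not])
            exact (h₂ (hfun y hy x hx h₁)).elim
  exact fun a ha i c hc h => hentry a ha i c hc (hX c h)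

/-! ### The search for splits -/

/-- The value of a subformula of the query: the truth values of the formula and of its negation,
whether the formula is a clause, and whether it is an atom. -/
structure QVal where
  pos : Bool
  neg : Bool
  clause : Bool
  atom : Bool
  deriving DecidableEq, Fintype, Inhabited

/-- The value of an atom, from the entries of its column. -/
def QVal.ofEntry (b : Bool × Bool) : QVal := ⟨b.1, b.2, true, true⟩

/-- The value of a negation. -/
def QVal.not (x : QVal) : QVal := ⟨x.neg, x.pos, x.atom, false⟩

/-- The value of a disjunction, from those of the operands and the entries of its column. -/
def QVal.or (b : Bool × Bool) (x y : QVal) : QVal :=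
  ⟨bif x.clause && y.clause then b.1 else x.pos || y.pos, x.neg && y.neg, x.clause && y.clause,
    false⟩

/-- The value of a formula according to a table. -/
def qval (u : Table) : Formula → QVal
  | .eq t n => .ofEntry (u (.eq t n))
  | .neg a => (qval u a).not
  | .or a b => .or (u (.or a b)) (qval u a) (qval u b)
  | .bel _ _ => default

theorem qval_clause {a : Formula} (ha : a.Objective) (u : Table) :
    (qval u a).clause = a.toClause.isSome ∧
      ((qval u a).atom = true ↔ ∃ t n, a = .eq t n) := by
  induction a with
  | eq t n => simp [qval, QVal.ofEntry, Formula.toClause]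
  | neg a ih =>
    have := (ih ha).2
    cases a with
    | eq t n => simp [qval, QVal.ofEntry, QVal.not, Formula.toClause]
    | _ => simp [qval, QVal.not, Formula.toClause, QVal.or] at this ⊢ <;> exact this
  | or a b iha ihb =>
    simp only [qval, QVal.or, (iha ha.1).1, (ihb ha.2).1, Formula.toClause]
    cases a.toClause <;> cases b.toClause <;> simp
  | bel k a => exact ha.elim

/-- Soundness of the evaluation of the query. -/
theorem sat_of_qval {s : Set Clause} {ns : List Formula} {u : Table} (hu : u.Sound ns s)
    {a : Formula} (ha : a.Objective) (hns : ∀ b ∈ a.nodes, b ∈ ns) :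
    ((qval u a).pos = true → Sat s a) ∧ ((qval u a).neg = true → Sat s (.neg a)) := by
  induction a with
  | eq t n =>
    have hmem := hns (.eq t n) (by simp [Formula.nodes])
    refine ⟨fun h => ?_, fun h => ?_⟩
    · rw [sat_of_toClause rfl]
      exact hu _ hmem false _ rfl h
    · rw [sat_of_toClause rfl]
      exact hu _ hmem true _ rfl h
  | neg a ih =>
    have := ih ha fun b hb => hns b (by simp [Formula.nodes, hb])
    exact ⟨this.2, fun h => (sat_neg_neg _ _).2 (this.1 h)⟩
  | or a b iha ihb =>
    have h₁ := iha ha.1 fun c hc => hns c (by simp [Formula.nodes, hc])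
    have h₂ := ihb ha.2 fun c hc => hns c (by simp [Formula.nodes, hc])
    refine ⟨fun h => ?_, fun h => ?_⟩
    · have hc := (qval_clause (a := .or a b) ha u).1
      simp only [qval, QVal.or] at h hc
      cases ho : (Formula.or a b).toClause with
      | some c =>
        rw [sat_of_toClause ho]
        rw [hc, ho, Option.isSome_some, cond_true] at h
        exact hu (.or a b) (hns _ (by simp [Formula.nodes])) false c ho h
      | none =>
        rw [sat_or ho]
        rw [hc, ho, Option.isSome_none, cond_false, Bool.or_eq_true] at h
        exact h.imp h₁.1 h₂.1
    · rw [sat_neg_or]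
      simp only [qval, QVal.or, Bool.and_eq_true] at h
      exact ⟨h₁.2 h.1, h₂.2 h.2⟩
  | bel k a => exact ha.elim

/-- Completeness of the evaluation of the query. -/
theorem qval_of_sat {s : Set Clause} {ns : List Formula} {u : Table} (hu : u.Full ns s)
    {a : Formula} (ha : a.Objective) (hns : ∀ b ∈ a.nodes, b ∈ ns) :
    (Sat s a → (qval u a).pos = true) ∧ (Sat s (.neg a) → (qval u a).neg = true) := by
  induction a with
  | eq t n =>
    have hmem := hns (.eq t n) (by simp [Formula.nodes])
    refine ⟨fun h => ?_, fun h => ?_⟩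
    · rw [sat_of_toClause rfl] at h
      exact hu _ hmem false _ rfl h
    · rw [sat_of_toClause rfl] at h
      exact hu _ hmem true _ rfl h
  | neg a ih =>
    have := ih ha fun b hb => hns b (by simp [Formula.nodes, hb])
    exact ⟨this.2, fun h => this.1 ((sat_neg_neg _ _).1 h)⟩
  | or a b iha ihb =>
    have h₁ := iha ha.1 fun c hc => hns c (by simp [Formula.nodes, hc])
    have h₂ := ihb ha.2 fun c hc => hns c (by simp [Formula.nodes, hc])
    refine ⟨fun h => ?_, fun h => ?_⟩
    · have hc := (qval_clause (a := .or a b) ha u).1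
      simp only [qval, QVal.or] at hc ⊢
      cases ho : (Formula.or a b).toClause with
      | some c =>
        rw [sat_of_toClause ho] at h
        rw [hc, ho, Option.isSome_some, cond_true]
        exact hu (.or a b) (hns _ (by simp [Formula.nodes])) false c ho h
      | none =>
        rw [sat_or ho] at h
        rw [hc, ho, Option.isSome_none, cond_false, Bool.or_eq_true]
        exact h.imp h₁.1 h₂.1
    · rw [sat_neg_or] at h
      simp only [qval, QVal.or, Bool.and_eq_true]
      exact ⟨h₁.2 h.1, h₂.2 h.2⟩
  | bel k a => exact ha.elim

/-- The function terms of the atoms in `ns` that are not in `seen`, without repetition. -/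
def leaders : List FunTerm → List Formula → List FunTerm
  | _, [] => []
  | seen, .eq t _ :: ns => if t ∈ seen then leaders seen ns else t :: leaders (t :: seen) ns
  | seen, _ :: ns => leaders seen ns

theorem mem_leaders {ns : List Formula} {seen : List FunTerm} {t : FunTerm} :
    t ∈ leaders seen ns ↔ t ∉ seen ∧ ∃ n, .eq t n ∈ ns := by
  induction ns generalizing seen with
  | nil => simp [leaders]
  | cons a ns ih =>
    cases a with
    | eq t' n' =>
      simp only [leaders]
      split
      · rename_i h
        simp only [ih, List.mem_cons, Formula.eq.injEq]
        refine and_congr_right fun ht => ?_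
        have : t ≠ t' := by rintro rfl; exact ht h
        simp [this]
      · rename_i h
        simp only [List.mem_cons, ih, not_or, Formula.eq.injEq]
        by_cases ht : t = t'
        · subst ht
          simp only [true_or, true_and, true_iff]
          exact ⟨h, n', by simp⟩
        · simp [ht]
    | _ => simp [leaders, ih]

theorem nodup_leaders (ns : List Formula) (seen : List FunTerm) : (leaders seen ns).Nodup := by
  induction ns generalizing seen with
  | nil => simp [leaders]
  | cons a ns ih =>
    cases a with
    | eq t' n' =>
      simp only [leaders]
      split
      · exact ih _
      · exact List.nodup_cons.2 ⟨by simp [mem_leaders], ih _⟩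
    | _ => exact ih _

/-- The choices for the names that are mentioned with `t` in `l`. -/
def namedChoices (l : List Formula) (t : FunTerm) : List Table :=
  l.filterMap fun a => match a with
    | .eq t' n => if t = t' then some fun b => (cov t n b).e else none
    | _ => none

/-- The choice of a name for `t` that is not mentioned. The component `f` of a cell does not depend
on the name of the row, so that the name `0` is as good as any other. -/
def otherChoice (t : FunTerm) : Table := fun b => (cov t 0 b).f

/-- The choices for the name of `t`: the names that are mentioned with `t`, and one name that is
not mentioned. A choice is given by the entries that it adds to the table. -/
def group (ns : List Formula) (t : FunTerm) : List Table :=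
  namedChoices ns t ++ [otherChoice t]

theorem mem_group {ns : List Formula} {t : FunTerm} {g : Table} :
    g ∈ group ns t ↔ (∃ n, .eq t n ∈ ns ∧ g = fun b => (cov t n b).e) ∨
      g = fun b => (cov t 0 b).f := by
  simp only [group, namedChoices, List.mem_append, List.mem_filterMap,
    List.mem_singleton]
  refine or_congr_left ⟨?_, ?_⟩
  · rintro ⟨a, ha, h⟩
    cases a with
    | eq t' n =>
      simp only [Option.ite_none_right_eq_some, Option.some.injEq] at h
      obtain ⟨rfl, rfl⟩ := h
      exact ⟨n, ha, rfl⟩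
    | _ => simp at h
  · rintro ⟨n, ha, rfl⟩
    exact ⟨_, ha, by simp⟩

/-- The choices, grouped by function terms. -/
def groups (ns : List Formula) : List (List Table) := (leaders [] ns).map (group ns)

/-- The verdict on the query, given the assignments that are stored in the table. -/
def leaf (ns : List Formula) (kb q : Formula) (u : Table) : Bool :=
  (qval (closure ns kb u) q).pos

/-- The search for `r` splits. -/
def eval (ns : List Formula) (kb q : Formula) : ℕ → Table → Bool
  | 0, u => leaf ns kb q u
  | r + 1, u => (groups ns).any fun g => g.all fun ch => eval ns kb q r fun a => por (u a) (ch a)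

section

variable {ns : List Formula} {kb q : Formula} {s₀ : Set Clause}

/-- Soundness of the search. A name that is not mentioned with `t` is handled by the last choice. -/
theorem sat_of_eval (hkb : Clauses kb s₀) (hq : q.Objective)
    (hqns : ∀ a ∈ q.nodes, a ∈ ns) (hns : ∀ a ∈ ns, ∀ b ∈ a.nodes, b ∈ ns) {r : ℕ} {u : Table}
    {s : Set Clause} (hu : u.Sound ns s) (hs : ∀ c ∈ s₀, UP s c)
    (h : eval ns kb q r u = true) : Sat s (.bel r q) := by
  induction r generalizing u s with
  | zero =>
    rw [sat_bel_zero]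
    exact (sat_of_qval (hu.closure hkb hs) hq hqns).1 h
  | succ r ih =>
    rw [sat_bel_succ]
    simp only [eval, groups, List.any_map, List.any_eq_true, Function.comp, List.all_eq_true] at h
    obtain ⟨t, -, h⟩ := h
    refine ⟨t, fun n => ?_⟩
    have hs' : ∀ c ∈ s₀, UP (s ∪ {{Literal.eq t n}}) c := fun c hc =>
      (hs c hc).of_forall fun d hd => .base (.inl hd)
    have hsound : ∀ ch : Table, (∀ a ∈ ns, ch a = (cov t n a).e) →
        Table.Sound ns (s ∪ {{Literal.eq t n}}) fun a => por (u a) (ch a) := by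
      intro ch hch a ha i c hc he
      rw [entry_por, Bool.or_eq_true, hch a ha, (entry_cov hc t n).1] at he
      rcases he with he | he
      · exact (hu a ha i c hc he).of_forall fun d hd => .base (.inl hd)
      · exact .sub (.base (.inr rfl)) (subsumes_iff.2 (by simpa using he))
    by_cases hn : .eq t n ∈ ns
    · exact ih (hsound _ fun _ _ => rfl) hs' (h _ (mem_group.2 (.inl ⟨n, hn, rfl⟩)))
    · refine ih (hsound _ fun a ha => ?_) hs' (h _ (mem_group.2 (.inr rfl)))
      exact cov_fresh fun h => hn (hns a ha _ h)

/-- Completeness of the search. The last choice for a term is the assignment of a name `z` that is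
not mentioned at all. -/
theorem eval_of_game (hkb : Clauses kb s₀) (hq : q.Objective) (hqns : ∀ a ∈ q.nodes, a ∈ ns)
    (hkbns : ∀ a ∈ kb.nodes, a ∈ ns) (hns : ∀ a ∈ ns, ∀ b ∈ a.nodes, b ∈ ns)
    {F : Finset FunTerm} (hF : ∀ t ∈ F, ∃ n, .eq t n ∈ ns) {z : Name}
    (hz : ∀ t, .eq t z ∉ ns) {r : ℕ} {u : Table} {p : List (FunTerm × Name)}
    (hp : (p.map Prod.fst).Nodup)
    (hu : ∀ x ∈ p, ∀ a ∈ ns, ∀ i, entry (cov x.1 x.2 a).e i = true → entry (u a) i = true)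
    (h : Game s₀ F q r p) : eval ns kb q r u = true := by
  induction r generalizing u p with
  | zero =>
    refine (qval_of_sat (full_of_stable hkb hkbns (stable_closure ns kb u) hp ?_) hq hqns).1 h
    exact fun x hx a ha i he => entry_closure_of_entry ns kb (hu x hx a ha i he)
  | succ r ih =>
    obtain ⟨t, ht, htp, h⟩ := h
    simp only [eval, groups, List.any_map, List.any_eq_true, Function.comp, List.all_eq_true]
    refine ⟨t, mem_leaders.2 ⟨List.not_mem_nil, hF t ht⟩, fun g hg => ?_⟩
    have key : ∀ n, (∀ a ∈ ns, g a = (cov t n a).e) →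
        eval ns kb q r (fun a => por (u a) (g a)) = true := by
      intro n hgn
      refine ih (p := (t, n) :: p) (List.nodup_cons.2 ⟨htp, hp⟩) ?_ (h n)
      intro x hx a ha i he
      rw [entry_por, Bool.or_eq_true]
      rcases List.mem_cons.1 hx with rfl | hx
      · exact .inr (by rw [hgn a ha]; exact he)
      · exact .inl (hu x hx a ha i he)
    rcases mem_group.1 hg with ⟨n, -, rfl⟩ | rfl
    · exact key n fun _ _ => rfl
    · exact key z fun a ha => cov_fresh fun h => hz t (hns a ha _ h)

end

theorem mem_nodes_trans {a b c : Formula} (hb : b ∈ a.nodes) (hc : c ∈ b.nodes) :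
    c ∈ a.nodes := by
  induction a with
  | eq t n =>
    simp only [Formula.nodes, List.mem_singleton] at hb
    subst hb
    exact hc
  | neg a ih =>
    simp only [Formula.nodes, List.mem_append, List.mem_singleton] at hb ⊢
    rcases hb with hb | rfl
    · exact .inl (ih hb)
    · simpa [Formula.nodes] using hc
  | or a a' ih ih' =>
    simp only [Formula.nodes, List.mem_append, List.mem_singleton] at hb ⊢
    rcases hb with hb | hb | rfl
    · exact .inl (ih' hb)
    · exact .inr (.inl (ih hb))
    · simpa [Formula.nodes] using hc
  | bel k a ih => exact ih hb

namespace Instance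

/-- The columns of the table that is kept for an instance. -/
def nodes (x : Instance) : List Formula := x.query.nodes ++ x.kb.nodes

/-- The number of splits of the search: splits of more terms than are mentioned are useless. -/
def depth (x : Instance) : ℕ := min x.level (leaders [] x.nodes).length

theorem length_leaders (x : Instance) : (leaders [] x.nodes).length = x.funTerms.card := by
  rw [← List.toFinset_card_of_nodup (nodup_leaders _ _)]
  congr 1
  ext t
  simp only [List.mem_toFinset, mem_leaders, List.not_mem_nil, not_false_eq_true, true_and,
    nodes, List.mem_append, funTerms, Finset.mem_union, mem_funTerms_iff, ← exists_or]
  simp only [or_comm]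

/-- The search answers the question of Limited Belief Reasoning. -/
theorem holds_iff_eval (x : Instance) :
    x.Holds ↔ eval x.nodes x.kb x.query x.depth (fun _ => (false, false)) = true := by
  obtain ⟨s₀, hkb⟩ := x.kb_cnf.exists_clauses
  rw [holds_iff hkb]
  have hqns : ∀ a ∈ x.query.nodes, a ∈ x.nodes := fun a ha => List.mem_append_left _ ha
  have hkbns : ∀ a ∈ x.kb.nodes, a ∈ x.nodes := fun a ha => List.mem_append_right _ ha
  have hns : ∀ a ∈ x.nodes, ∀ b ∈ a.nodes, b ∈ x.nodes := by
    intro a ha b hb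
    rcases List.mem_append.1 ha with ha | ha
    · exact hqns b (mem_nodes_trans ha hb)
    · exact hkbns b (mem_nodes_trans ha hb)
  constructor
  · intro h
    obtain ⟨z, hz⟩ : ∃ z, ∀ t, Formula.eq t z ∉ x.nodes := by
      obtain ⟨z, hz⟩ := Infinite.exists_notMem_finset (x.nodes.filterMap fun a => match a with
        | .eq _ n => some n
        | _ => none).toFinset
      refine ⟨z, fun t ht => hz ?_⟩
      rw [List.mem_toFinset, List.mem_filterMap]
      exact ⟨_, ht, rfl⟩
    have hsat : Sat (s₀ ∪ units []) (.bel x.level x.query) := by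
      have : units [] = ∅ := by ext; simp [units]
      rwa [this, Set.union_empty]
    have hgame := game_of_sat (F := x.funTerms) (p := []) ?_ x.query_objective
      Finset.subset_union_right x.level List.nodup_nil hsat
    · rw [depth, length_leaders]
      refine eval_of_game hkb x.query_objective hqns hkbns hns (F := x.funTerms) (p := []) ?_ hz
        List.nodup_nil (by simp) hgame
      intro t ht
      rw [funTerms, Finset.mem_union, mem_funTerms_iff, mem_funTerms_iff] at ht
      rcases ht with ⟨n, hn⟩ | ⟨n, hn⟩
      · exact ⟨n, hkbns _ hn⟩
      · exact ⟨n, hqns _ hn⟩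
    · intro c hc l hl
      refine Finset.mem_union_left _ (mem_funTerms_iff.2 ?_)
      have := hkb.atom_mem c hc l hl
      cases l with
      | eq t n => exact ⟨n, this⟩
      | ne t n => exact ⟨n, this⟩
  · intro h
    refine sat_bel_of_le (k := x.depth) x.query_objective (min_le_left _ _) ?_
    refine sat_of_eval hkb x.query_objective hqns hns ?_ (fun c hc => .base hc) h
    intro a _ i c _ he
    cases i <;> simp [entry] at he

/-- Levels beyond the number of function terms do not add anything. -/
theorem holds_level_card (x : Instance) (F : Finset FunTerm) (hF : x.funTerms ⊆ F)
    (hle : F.card ≤ x.level) :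
    x.Holds ↔ ({ x with level := F.card } : Instance).Holds := by
  have hdepth : ({ x with level := F.card } : Instance).depth = x.depth := by
    have h₁ := x.length_leaders
    have h₂ := Finset.card_le_card hF
    change min F.card (leaders [] x.nodes).length = min x.level (leaders [] x.nodes).length
    omega
  rw [holds_iff_eval, holds_iff_eval, hdepth]
  rfl

end Instance

/-! ### The machine: registers and basic loops -/

/-- The kind of a formula, by its first symbol. -/
inductive Kind where
  | atom
  | neg
  | or
  deriving DecidableEq

instance : Fintype Kind := ⟨{.atom, .neg, .or}, fun k => by cases k <;> decide⟩

/-- The kind of a formula without belief operators. -/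
def Formula.kind : Formula → Kind
  | .eq _ _ => .atom
  | .neg _ => .neg
  | .or _ _ => .or
  | .bel _ _ => .neg

/-- The alphabet of the machine. -/
inductive Letter where
  | sym (x : Sym)
  | bit (b : Bool)
  | cell (c : Cell)
  | tok (k : Kind)
  | entry (k : Kind) (p : Bool × Bool)
  | val (v : Val)
  | pair (p : Bool × Bool)
  | sep
  | qval (v : QVal)
  | down
  | up (b : Bool)
  deriving DecidableEq, Fintype, Inhabited

namespace Letter

/-- The truth value in a letter. -/
def getBit : Letter → Bool
  | .bit b => b
  | _ => false

/-- The cell in a letter. -/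
def getCell : Letter → Cell
  | .cell c => c
  | _ => default

/-- The pair of truth values in a letter. -/
def getPair : Letter → Bool × Bool
  | .pair p => p
  | .entry _ p => p
  | _ => default

/-- The value of a subformula of the knowledge base in a letter. -/
def getVal : Letter → Val
  | .val v => v
  | _ => default

/-- The value of a subformula of the query in a letter. -/
def getQVal : Letter → QVal
  | .qval v => v
  | _ => default

/-- Add a pair of truth values to the entry in a letter. -/
def addPair (p : Bool × Bool) : Letter → Letter
  | .entry k q => .entry k (por q p)
  | x => x

def isCell : Letter → Bool
  | .cell _ => true
  | _ => false

def isVal : Letter → Bool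
  | .val _ => true
  | _ => false

def isPair : Letter → Bool
  | .pair _ => true
  | _ => false

/-- Bits and argument marks are the letters of which names, and function terms, consist. -/
def isSeg : Letter → Bool
  | .sym (.bit _) => true
  | .sym .arg => true
  | _ => false

end Letter

/-- The stacks of the machine: `inp` holds the input and `res` the answer, `w` and `w2` hold the
formulas, `b` the level, `m` and `m3` the rows of cells, `u` the table, `c` the list of choices, and
`g` one letter for each function term that is mentioned. In the search, `r` counts the splits that
are left, `us` and `d` hold the tables and the remaining choices of the splits that have been made,
and `ctl` the letter that says what is to be done next. The stacks `q`, `fl`, `v`, `mask` and `n`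
hold intermediate results of the several loops, and the others receive what is read, in order to
restore it. -/
inductive Reg where
  | inp | w | w2 | q | fl | v | m | mt | m3 | mask | c | g | b | r | n | u | ut | us | d | ctl
  | t1 | t2 | t3 | res
  deriving DecidableEq

instance : Fintype Reg :=
  ⟨{.inp, .w, .w2, .q, .fl, .v, .m, .mt, .m3, .mask, .c, .g, .b, .r, .n, .u, .ut, .us, .d, .ctl,
    .t1, .t2, .t3, .res}, fun k => by cases k <;> decide⟩

/-- Programs of the machine. -/
abbrev Code := Prog Reg Letter

/-- Contents of the stacks. -/
abbrev Regs := Reg → List Letter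

local infixr:65 " ⨟ " => Prog.seq

open Function

/-- Pop a symbol. -/
def pop (k : Reg) : Code := .popCase k fun _ => .skip

/-- Replace the top symbol. -/
def modify (k : Reg) (f : Letter → Letter) : Code :=
  .popCase k fun o => match o with
    | some a => .push k (f a)
    | none => .skip

/-- Move the symbols that satisfy `c` from one stack to another. -/
def move (x y : Reg) (c : Letter → Bool) (f : Letter → Letter) : Code :=
  .foreach x c fun a => .push y (f a)

/-- Move a whole stack. -/
def moveAll (x y : Reg) : Code := move x y (fun _ => true) id

/-- Clear a stack. -/
def clear (x : Reg) : Code := .foreach x (fun _ => true) fun _ => .skip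

section

variable {s : Regs}

theorem exec_pop {k : Reg} {a : Letter} {l : List Letter} (h : s k = a :: l) :
    Exec (pop k) s (update s k l) 2 :=
  .popSome h (.skip _)

theorem exec_modify {k : Reg} {f : Letter → Letter} {a : Letter} {l : List Letter}
    (h : s k = a :: l) : Exec (modify k f) s (update s k (f a :: l)) 2 :=
  (Exec.popSome h (.push _ _ _)).to (by simp) le_rfl

theorem exec_move {x y : Reg} (hxy : x ≠ y) {c : Letter → Bool} (f : Letter → Letter)
    {l rest : List Letter} (hs : s x = l ++ rest) (hl : ∀ a ∈ l, c a = true)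
    (hrest : ∀ a ∈ rest.head?, c a = false) :
    Exec (move x y c f) s (update (update s x rest) y ((l.map f).reverse ++ s y))
      (2 * l.length + 1) := by
  induction l generalizing s with
  | nil =>
    refine (Exec.done (by simpa [hs] using hrest)).to ?_ (by simp)
    have : update s x rest = s := by rw [← List.nil_append rest, ← hs, update_eq_self]
    simp [this]
  | cons a l ih =>
    refine (Exec.step hs (hl a (by simp)) (.push y (f a) _) (ih ?_ ?_)).to ?_ ?_
    · simp [hxy]
    · exact fun b hb => hl b (by simp [hb])
    · funext k
      by_cases hy : k = y
      · subst hy; simp [hxy.symm]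
      · by_cases hx : k = x
        · subst hx; simp [hy]
        · simp [hy, hx]
    · simp only [List.length_cons]; omega

theorem exec_moveAll {x y : Reg} (hxy : x ≠ y) {l : List Letter} (hs : s x = l) :
    Exec (moveAll x y) s (update (update s x []) y (l.reverse ++ s y)) (2 * l.length + 1) :=
  (exec_move hxy id (rest := []) (by simpa using hs) (by simp) (by simp)).to (by simp) le_rfl

theorem exec_clearReg {x : Reg} {l : List Letter} (hs : s x = l) :
    Exec (clear x) s (update s x []) (2 * l.length + 1) :=
  hs ▸ exec_clear x s

/-- Skip the symbols that satisfy `c`. -/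
theorem exec_drop {x : Reg} {c : Letter → Bool} {l rest : List Letter} (hs : s x = l ++ rest)
    (hl : ∀ a ∈ l, c a = true) (hrest : ∀ a ∈ rest.head?, c a = false) :
    Exec (.foreach x c fun _ => .skip) s (update s x rest) (2 * l.length + 1) := by
  induction l generalizing s with
  | nil =>
    refine (Exec.done (by simpa [hs] using hrest)).to ?_ (by simp)
    rw [← List.nil_append rest, ← hs, update_eq_self]
  | cons a l ih =>
    refine (Exec.step hs (hl a (by simp)) (.skip _) (ih (by simp) ?_)).to (by simp) ?_
    · exact fun b hb => hl b (by simp [hb])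
    · simp only [List.length_cons]; omega

end

/-! ### One round of propagation -/

variable {ns : List Formula}

/-- The table, as it is stored on a stack. -/
def vec (ns : List Formula) (u : Table) : List Letter := ns.map fun a => .entry a.kind (u a)

/-- The letters that stand for the first symbol of a subformula; for atoms, after their row. -/
def tokens (ns : List Formula) : Formula → List Letter
  | .eq t n => ns.map (fun a => .cell (cov t n a)) ++ [.tok .atom]
  | .neg _ => [.tok .neg]
  | .or _ _ => [.tok .or]
  | .bel _ _ => []

/-- The letters of the subformulas of `a`. -/
def stream (ns : List Formula) (l : List Formula) : List Letter := l.flatMap (tokens ns)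

/-- Add to the flags on the stack `fl` whether the column refutes the literals. -/
def addDead (o x fl : Letter) : Letter :=
  .pair (por fl.getPair
    (x.getCell.lit && x.getCell.n.2 && o.getPair.2, x.getCell.lit && x.getCell.n.2 && o.getPair.1))

/-- Look up whether the literals of the row on the stack `t2` are refuted. -/
def deadCode : Code :=
  .foreach .t2 (fun _ => true) fun x => .push .t1 x ⨟ .popCase .u fun o => match o with
    | some o => .push .ut o ⨟ modify .fl (addDead o x)
    | none => .skip

/-- Processing of an atom: its row has been moved to the stack `t1`. -/
def atomCode : Code :=
  moveAll .t1 .t2 ⨟ .push .fl (.pair (false, false)) ⨟ deadCode ⨟ moveAll .ut .u ⨟ .push .v .sep ⨟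
    .popCase .fl fun o => match o with
      | some o => move .t1 .v (fun _ => true) fun x => .val (.ofCell o.getPair x.getCell)
      | none => .skip

/-- Processing of a negation. -/
def negCode : Code :=
  move .v .t1 Letter.isVal id ⨟ move .t1 .v (fun _ => true) fun x => .val x.getVal.neg

/-- Processing of a disjunction. -/
def orCode : Code :=
  move .v .t1 Letter.isVal id ⨟ pop .v ⨟ move .v .t2 Letter.isVal id ⨟
    .foreach .t1 (fun _ => true) fun x => .popCase .t2 fun o => match o with
      | some y => .push .v (.val (x.getVal.or y.getVal))
      | none => .skip

/-- Processing of a letter of the stream. -/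
def passCode (x : Letter) : Code :=
  .push .mt x ⨟ match x with
    | .cell _ => .push .t1 x
    | .tok .atom => atomCode
    | .tok .neg => negCode
    | .tok .or => orCode
    | _ => .skip

/-- One round. -/
def roundCode : Code :=
  .foreach .m (fun _ => true) passCode ⨟ moveAll .mt .m ⨟
    (.foreach .v Letter.isVal fun x => .popCase .u fun o => match o with
      | some o => .push .ut (o.addPair x.getVal.p)
      | none => .skip) ⨟
    clear .v ⨟ moveAll .ut .u

/-- The outcome of `deadCode`; the row and the table are found again on `t1` and `ut`. -/
theorem exec_deadCode {s : Regs} {t : FunTerm} {n : Name} {u : Table} {l : List Formula}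
    {p : Bool × Bool} {f : List Letter}
    (ht2 : s .t2 = l.map fun a => .cell (cov t n a)) (hu : s .u = vec l u)
    (hfl : s .fl = .pair p :: f) :
    Exec deadCode s
      (update (update (update (update (update s .t2 []) .u [])
        .t1 ((l.map fun a => .cell (cov t n a)).reverse ++ s .t1))
        .ut ((vec l u).reverse ++ s .ut)) .fl (.pair (por p (dead l u t n)) :: f))
      (6 * l.length + 1) := by
  induction l generalizing s p with
  | nil =>
    refine (Exec.done (by simp [ht2])).to ?_ (by simp)
    funext k
    cases k <;> simp_all [vec, dead, por]
  | cons a l ih =>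
    refine (Exec.step ht2 rfl ((Exec.push _ _ _).seq (.popSome
      (a := .entry a.kind (u a)) (l := vec l u) (by simpa [vec] using hu)
      ((Exec.push _ _ _).seq (exec_modify (a := .pair p) (l := f) (by simpa using hfl)))))
      (ih (p := por p (dead [a] u t n)) ?_ ?_ ?_)).to ?_ ?_
    · simp
    · simp
    · simp [addDead, dead, Letter.getCell, Letter.getPair]
    · funext k
      cases k <;> simp [vec, dead, por, Bool.or_assoc]
    · simp only [List.length_cons]; omega

/-- The values of a subformula of the knowledge base in all columns. -/
def vals (ns : List Formula) (u : Table) (b : Formula) : List Letter :=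
  ns.map fun a => .val (val ns u a b)

theorem isVal_vals {ns : List Formula} {u : Table} {b : Formula} :
    ∀ x ∈ vals ns u b, x.isVal = true := by
  simp [vals, Letter.isVal]

theorem length_vals (ns : List Formula) (u : Table) (b : Formula) :
    (vals ns u b).length = ns.length := by
  simp [vals]

theorem length_vec (ns : List Formula) (u : Table) : (vec ns u).length = ns.length := by
  simp [vec]

theorem exec_atomCode {s : Regs} {t : FunTerm} {n : Name} {u : Table}
    (ht1 : s .t1 = (ns.map fun a => .cell (cov t n a)).reverse) (ht2 : s .t2 = [])
    (hu : s .u = vec ns u) (hut : s .ut = []) :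
    Exec atomCode s (update (update s .t1 []) .v (vals ns u (.eq t n) ++ .sep :: s .v))
      (12 * ns.length + 7) := by
  refine ((exec_moveAll (by decide) ht1).seq ((Exec.push _ _ _).seq
    ((exec_deadCode (t := t) (n := n) (u := u) (l := ns) (p := (false, false)) (f := s .fl)
      ?_ ?_ ?_).seq
    ((exec_moveAll (l := (vec ns u).reverse) (by decide) ?_).seq ((Exec.push _ _ _).seq
    (Exec.popSome (a := .pair (por (false, false) (dead ns u t n))) (l := s .fl) ?_
      (exec_move (l := (ns.map fun a => .cell (cov t n a)).reverse) (rest := []) (by decide) _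
        ?_ ?_ ?_))))))).to ?_ ?_
  · simp [ht2]
  · simp [hu]
  · simp
  · simp [hut]
  · simp
  · simp
  · simp
  · simp
  · funext k
    cases k <;> simp [ht2, hu, hut, vals, val, Letter.getPair, Letter.getCell, por]
  · simp [length_vec]; omega

theorem exec_negCode {s : Regs} {b : Formula} {u : Table} {rest : List Letter}
    (hv : s .v = vals ns u b ++ .sep :: rest) (ht1 : s .t1 = []) :
    Exec negCode s (update s .v (vals ns u (.neg b) ++ .sep :: rest)) (4 * ns.length + 2) := by
  refine ((exec_move (by decide) _ hv isVal_vals (by simp [Letter.isVal])).seq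
    (exec_move (l := (vals ns u b).reverse) (rest := []) (by decide) _ ?_ ?_ ?_)).to ?_ ?_
  · simp [ht1]
  · simp
  · simp
  · funext k
    cases k <;> simp [ht1, vals, val, Letter.getVal]
  · simp [length_vals]; omega

theorem exec_zipOr {s : Regs} {a b : Formula} {u : Table} {l : List Formula}
    (ht1 : s .t1 = l.map fun c => .val (val ns u c a))
    (ht2 : s .t2 = l.map fun c => .val (val ns u c b)) :
    Exec (.foreach .t1 (fun _ => true) fun x => .popCase .t2 fun o => match o with
      | some y => .push .v (.val (x.getVal.or y.getVal))
      | none => .skip) s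
      (update (update (update s .t1 []) .t2 []) .v
        ((l.map fun c => .val (val ns u c (.or a b))).reverse ++ s .v)) (3 * l.length + 1) := by
  induction l generalizing s with
  | nil =>
    refine (Exec.done (by simp [ht1])).to ?_ (by simp)
    funext k
    cases k <;> simp_all
  | cons c l ih =>
    refine (Exec.step ht1 rfl (.popSome (a := .val (val ns u c b))
      (l := l.map fun c => .val (val ns u c b)) (by simpa using ht2) (.push _ _ _))
      (ih ?_ ?_)).to ?_ ?_
    · simp
    · simp
    · funext k
      cases k <;> simp [val, Letter.getVal]
    · simp only [List.length_cons]; omega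

theorem exec_orCode {s : Regs} {a b : Formula} {u : Table} {rest : List Letter}
    (hv : s .v = vals ns u a ++ .sep :: (vals ns u b ++ .sep :: rest)) (ht1 : s .t1 = [])
    (ht2 : s .t2 = []) :
    Exec orCode s (update s .v (vals ns u (.or a b) ++ .sep :: rest)) (7 * ns.length + 5) := by
  refine ((exec_move (by decide) _ hv isVal_vals (by simp [Letter.isVal])).seq
    ((exec_pop (a := .sep) (l := vals ns u b ++ .sep :: rest) ?_).seq
    ((exec_move (l := vals ns u b) (rest := .sep :: rest) (by decide) _ ?_ isVal_vals ?_).seq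
    (exec_zipOr (ns := ns) (u := u) (a := a) (b := b) (l := ns.reverse) ?_ ?_)))).to ?_ ?_
  · simp
  · simp
  · simp [Letter.isVal]
  · simp [ht1, vals]
  · simp [ht2, vals]
  · funext k
    cases k <;> simp [ht1, ht2, vals]
  · simp [length_vals]; omega

theorem iter_cells {s : Regs} {l rest : List Letter} (hm : s .m = l ++ rest)
    (hl : ∀ x ∈ l, x.isCell = true) :
    Iter .m (fun _ => true) passCode s
      (update (update (update s .m rest) .mt (l.reverse ++ s .mt)) .t1 (l.reverse ++ s .t1))
      (3 * l.length) := by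
  induction l generalizing s with
  | nil =>
    refine (Iter.refl _).to ?_ (by simp)
    funext k
    cases k <;> simp_all
  | cons x l ih =>
    obtain ⟨c, rfl⟩ : ∃ c, x = .cell c := by
      have := hl x (by simp)
      cases x <;> simp_all [Letter.isCell]
    refine (Iter.step hm rfl ((Exec.push _ _ _).seq (.push _ _ _)) (ih ?_ ?_)).to ?_ ?_
    · simp
    · exact fun y hy => hl y (by simp [hy])
    · funext k
      cases k <;> simp
    · simp only [List.length_cons]; omega

/-- The rows and connectives of a formula are evaluated in all columns at the same time, in reverse
Polish notation; `v` is the stack of intermediate results. -/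
theorem iter_passCode {s : Regs} {b : Formula} (hb : b.Objective) {u : Table}
    {rest : List Letter} (hm : s .m = stream ns b.nodes ++ rest) (ht1 : s .t1 = [])
    (ht2 : s .t2 = []) (hu : s .u = vec ns u) (hut : s .ut = []) :
    Iter .m (fun _ => true) passCode s
      (update (update (update s .m rest) .mt ((stream ns b.nodes).reverse ++ s .mt)) .v
        (vals ns u b ++ .sep :: s .v)) (b.nodes.length * (15 * ns.length + 9)) := by
  induction b generalizing s rest with
  | eq t n =>
    refine ((iter_cells (l := ns.map fun a => .cell (cov t n a))
      (rest := .tok .atom :: rest) ?_ ?_).trans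
      (Iter.single (a := .tok .atom) (l := rest) ?_ rfl ((Exec.push _ _ _).seq
        (exec_atomCode (ns := ns) (t := t) (n := n) (u := u) ?_ ?_ ?_ ?_)))).to ?_ ?_
    · simp [hm, stream, Formula.nodes, tokens]
    · simp [Letter.isCell]
    · simp
    · simp [ht1]
    · simp [ht2]
    · simp [hu]
    · simp [hut]
    · funext k
      cases k <;> simp [ht1, stream, Formula.nodes, tokens]
    · simp [Formula.nodes]; omega
  | neg b ih =>
    refine ((ih hb (rest := .tok .neg :: rest) ?_ ht1 ht2 hu hut).trans
      (Iter.single (a := .tok .neg) (l := rest) ?_ rfl ((Exec.push _ _ _).seq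
        (exec_negCode (ns := ns) (b := b) (u := u) (rest := s .v) ?_ ?_)))).to ?_ ?_
    · simp [hm, stream, Formula.nodes, tokens]
    · simp
    · simp
    · simp [ht1]
    · funext k
      cases k <;> simp [stream, Formula.nodes, tokens]
    · simp only [Formula.nodes, List.length_append, List.length_singleton, add_mul]; omega
  | or a b iha ihb =>
    refine ((ihb hb.2 (rest := stream ns a.nodes ++ .tok .or :: rest) ?_ ht1 ht2 hu hut).trans
      ((iha hb.1 (rest := .tok .or :: rest) ?_ ?_ ?_ ?_ ?_).trans
      (Iter.single (a := .tok .or) (l := rest) ?_ rfl ((Exec.push _ _ _).seq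
        (exec_orCode (ns := ns) (a := a) (b := b) (u := u) (rest := s .v) ?_ ?_ ?_))))).to ?_ ?_
    · simp [hm, stream, Formula.nodes, tokens]
    · simp
    · simp [ht1]
    · simp [ht2]
    · simp [hu]
    · simp [hut]
    · simp
    · simp
    · simp [ht1]
    · simp [ht2]
    · funext k
      cases k <;> simp [stream, Formula.nodes, tokens]
    · simp only [Formula.nodes, List.length_append, List.length_singleton, add_mul]; omega
  | bel k b => exact hb.elim

theorem exec_merge {s : Regs} {kb : Formula} {u : Table} {l : List Formula} {rest : List Letter}
    (hv : s .v = (l.map fun a => .val (val ns u a kb)) ++ .sep :: rest) (hu : s .u = vec l u) :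
    Exec (.foreach .v Letter.isVal fun x => .popCase .u fun o => match o with
      | some o => .push .ut (o.addPair x.getVal.p)
      | none => .skip) s
      (update (update (update s .v (.sep :: rest)) .u []) .ut
        ((vec l (round ns kb u)).reverse ++ s .ut)) (3 * l.length + 1) := by
  induction l generalizing s with
  | nil =>
    refine (Exec.done (by simp [hv, Letter.isVal])).to ?_ (by simp)
    funext k
    cases k <;> simp_all [vec]
  | cons c l ih =>
    refine (Exec.step hv rfl (.popSome (a := .entry c.kind (u c))
      (l := vec l u) (by simpa [vec] using hu) (.push _ _ _)) (ih ?_ ?_)).to ?_ ?_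
    · simp
    · simp
    · funext k
      cases k <;> simp [vec, Letter.getVal, Letter.addPair, round]
    · simp only [List.length_cons]; omega

theorem length_tokens_le (ns : List Formula) (a : Formula) :
    (tokens ns a).length ≤ ns.length + 1 := by
  cases a <;> simp [tokens]

theorem length_stream_le (ns l : List Formula) :
    (stream ns l).length ≤ l.length * (ns.length + 1) := by
  induction l with
  | nil => simp [stream]
  | cons a l ih =>
    have := length_tokens_le ns a
    simp only [stream, List.flatMap_cons, List.length_append, List.length_cons, add_mul] at ih ⊢
    omega

/-- A round takes quadratic time, as each of the atoms has a row of linear length. -/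
theorem exec_roundCode {s : Regs} {kb q : Formula} (hkb : kb.Objective) (hq : q.Objective)
    (hns : ns = q.nodes ++ kb.nodes) {u : Table} (hm : s .m = stream ns ns) (hmt : s .mt = [])
    (hv : s .v = []) (ht1 : s .t1 = []) (ht2 : s .t2 = []) (hu : s .u = vec ns u)
    (hut : s .ut = []) :
    Exec roundCode s (update s .u (vec ns (round ns kb u))) (18 * (ns.length + 1) ^ 2) := by
  have hstream : stream ns ns = stream ns q.nodes ++ (stream ns kb.nodes ++ []) := by
    rw [List.append_nil, stream, stream, stream, ← List.flatMap_append, ← hns]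
  refine ((((iter_passCode (ns := ns) hq (u := u) (rest := stream ns kb.nodes ++ []) ?_ ht1 ht2 hu
    hut).trans (iter_passCode (ns := ns) hkb (u := u) (rest := []) ?_ ?_ ?_ ?_ ?_)).finish
      ?_).seq ((exec_moveAll (l := (stream ns ns).reverse) (by decide) ?_).seq
    ((exec_merge (ns := ns) (u := u) (kb := kb) (l := ns)
      (rest := vals ns u q ++ [.sep]) ?_ ?_).seq
    ((exec_clearReg (l := .sep :: (vals ns u q ++ [.sep])) ?_).seq
    (exec_moveAll (l := (vec ns (round ns kb u)).reverse) (by decide) ?_))))).to ?_ ?_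
  · rw [hm, hstream]
  · simp
  · simp [ht1]
  · simp [ht2]
  · simp [hu]
  · simp [hut]
  · simp
  · simp [hmt, hstream]
  · simp [hv, vals]
  · simp [hu]
  · simp
  · simp [hut]
  · funext k
    cases k <;> simp [hm, hmt, hv, hut]
  · have hlen : ns.length = q.nodes.length + kb.nodes.length := by
      rw [← List.length_append, ← hns]
    have h₁ := length_stream_le ns ns
    have h₂ : q.nodes.length * (15 * ns.length + 9) + kb.nodes.length * (15 * ns.length + 9) =
        ns.length * (15 * ns.length + 9) := by rw [← add_mul, ← hlen]
    simp only [List.length_reverse, List.length_append, List.length_cons, length_vals, length_vec,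
      List.length_nil]
    nlinarith

/-! ### The verdict on the query -/

/-- Processing of an entry of the table, for the evaluation of the query. -/
def queryCode : Letter → Code
  | .entry .atom p => .push .v (.qval (.ofEntry p))
  | .entry .neg _ => modify .v fun x => .qval x.getQVal.not
  | .entry .or p => .popCase .v fun o => match o with
    | some x => modify .v fun y => .qval (.or p x.getQVal y.getQVal)
    | none => .skip
  | _ => .skip

/-- The verdict at a leaf of the search. There are two rounds for each letter of the table. The
values of the query and the knowledge base are both computed, and the latter is discarded. -/
def leafCode : Code :=
  (.foreach .u (fun _ => true) fun x => .push .ut x ⨟ .push .n .sep ⨟ .push .n .sep) ⨟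
    moveAll .ut .u ⨟ .foreach .n (fun _ => true) (fun _ => roundCode) ⨟
    .foreach .u (fun _ => true) queryCode ⨟ pop .v ⨟
    .popCase .v fun o => match o with
      | some x => .push .ctl (.up x.getQVal.pos)
      | none => .skip

/-- The table is read in the order of a reverse Polish notation of the query; `v` is the stack of
intermediate results. -/
theorem iter_queryCode {s : Regs} {b : Formula} (hb : b.Objective) {u : Table}
    {rest : List Letter} (hu : s .u = vec b.nodes u ++ rest) :
    Iter .u (fun _ => true) queryCode s
      (update (update s .u rest) .v (.qval (qval u b) :: s .v)) (4 * b.nodes.length) := by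
  induction b generalizing s rest with
  | eq t n =>
    have h := Exec.push Reg.v (Letter.qval (.ofEntry (u (.eq t n)))) (update s .u rest)
    refine (Iter.single (f := queryCode) (a := .entry .atom (u (.eq t n))) (l := rest) ?_ rfl
      h).to ?_ ?_
    · simp [hu, vec, Formula.nodes, Formula.kind]
    · funext k
      cases k <;> simp [qval]
    · simp [Formula.nodes]
  | neg b ih =>
    refine ((ih hb (rest := .entry .neg (u (.neg b)) :: rest) ?_).trans
      (Iter.single (a := .entry .neg (u (.neg b))) (l := rest) ?_ rfl
        (exec_modify (a := .qval (qval u b)) (l := s .v) ?_))).to ?_ ?_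
    · simp [hu, vec, Formula.nodes, Formula.kind]
    · simp
    · simp
    · funext k
      cases k <;> simp [qval, Letter.getQVal]
    · simp only [Formula.nodes, List.length_append, List.length_singleton]; omega
  | or a b iha ihb =>
    refine ((ihb hb.2 (rest := vec a.nodes u ++ .entry .or (u (.or a b)) :: rest) ?_).trans
      ((iha hb.1 (rest := .entry .or (u (.or a b)) :: rest) ?_).trans
      (Iter.single (a := .entry .or (u (.or a b))) (l := rest) ?_ rfl
        (Exec.popSome (a := .qval (qval u a)) (l := .qval (qval u b) :: s .v) ?_
          (exec_modify (a := .qval (qval u b)) (l := s .v) ?_))))).to ?_ ?_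
    · simp [hu, vec, Formula.nodes, Formula.kind]
    · simp
    · simp
    · simp
    · simp
    · funext k
      cases k <;> simp [qval, Letter.getQVal]
    · simp only [Formula.nodes, List.length_append, List.length_singleton]; omega
  | bel k b => exact hb.elim

theorem exec_rounds {s : Regs} {kb q : Formula} (hkb : kb.Objective) (hq : q.Objective)
    (hns : ns = q.nodes ++ kb.nodes) {u : Table} {i : ℕ} (hn : s .n = List.replicate i .sep)
    (hm : s .m = stream ns ns) (hmt : s .mt = [])
    (hv : s .v = []) (ht1 : s .t1 = []) (ht2 : s .t2 = []) (hu : s .u = vec ns u)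
    (hut : s .ut = []) :
    Exec (.foreach .n (fun _ => true) fun _ => roundCode) s
      (update (update s .n []) .u (vec ns ((round ns kb)^[i] u)))
      (i * (18 * (ns.length + 1) ^ 2 + 1) + 1) := by
  induction i generalizing s u with
  | zero =>
    refine (Exec.done (by simp [hn])).to ?_ (by simp)
    funext k
    cases k <;> simp_all
  | succ i ih =>
    refine (Exec.step (a := .sep) (l := List.replicate i .sep) hn rfl
      (exec_roundCode hkb hq hns (u := u) ?_ ?_ ?_ ?_ ?_ ?_ ?_)
      (ih (u := round ns kb u) ?_ ?_ ?_ ?_ ?_ ?_ ?_ ?_)).to ?_ ?_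
    · simp [hm]
    · simp [hmt]
    · simp [hv]
    · simp [ht1]
    · simp [ht2]
    · simp [hu]
    · simp [hut]
    · simp
    · simp [hm]
    · simp [hmt]
    · simp [hv]
    · simp [ht1]
    · simp [ht2]
    · simp
    · simp [hut]
    · funext k
      cases k <;> simp
    · ring_nf; omega

theorem exec_fill {s : Regs} {l : List Letter} (hu : s .u = l) :
    Exec (.foreach .u (fun _ => true) fun x => .push .ut x ⨟ .push .n .sep ⨟ .push .n .sep) s
      (update (update (update s .u []) .ut (l.reverse ++ s .ut)) .n
        (List.replicate (2 * l.length) .sep ++ s .n)) (4 * l.length + 1) := by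
  induction l generalizing s with
  | nil =>
    refine (Exec.done (by simp [hu])).to ?_ (by simp)
    funext k
    cases k <;> simp_all
  | cons x l ih =>
    refine (Exec.step hu rfl ((Exec.push _ _ _).seq ((Exec.push _ _ _).seq (.push _ _ _)))
      (ih ?_)).to ?_ ?_
    · simp
    · funext k
      cases k
      case n =>
        simp only [update_self, ne_eq, reduceCtorEq, not_false_eq_true, update_of_ne,
          List.length_cons, mul_add, List.replicate_add, List.append_assoc]
        rfl
      all_goals simp
    · simp only [List.length_cons]; omega

/-- A leaf takes cubic time: a linear number of rounds, each in quadratic time. -/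
theorem exec_leafCode {s : Regs} {kb q : Formula} (hkb : kb.Objective) (hq : q.Objective)
    (hns : ns = q.nodes ++ kb.nodes) {u : Table} (hn : s .n = [])
    (hm : s .m = stream ns ns) (hmt : s .mt = [])
    (hv : s .v = []) (ht1 : s .t1 = []) (ht2 : s .t2 = []) (hu : s .u = vec ns u)
    (hut : s .ut = []) :
    Exec leafCode s (update (update s .u []) .ctl (.up (leaf ns kb q u) :: s .ctl))
      (50 * (ns.length + 1) ^ 3) := by
  have hvec : ∀ u', vec ns u' = vec q.nodes u' ++ (vec kb.nodes u' ++ []) := by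
    intro u'
    rw [List.append_nil, vec, vec, vec, ← List.map_append, ← hns]
  refine ((exec_fill hu).seq ((exec_moveAll (l := (vec ns u).reverse) (by decide) ?_).seq
    ((exec_rounds hkb hq hns (u := u) (i := 2 * (vec ns u).length) ?_ ?_ ?_ ?_ ?_ ?_ ?_ ?_).seq
    ((((iter_queryCode hq (u := closure ns kb u)
      (rest := vec kb.nodes (closure ns kb u) ++ []) ?_).trans
      (iter_queryCode hkb (u := closure ns kb u) (rest := []) ?_)).finish ?_).seq
    ((exec_pop (a := .qval (qval (closure ns kb u) kb))
      (l := [.qval (qval (closure ns kb u) q)]) ?_).seq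
    (Exec.popSome (a := .qval (qval (closure ns kb u) q)) (l := []) ?_ (.push _ _ _))))))).to ?_ ?_
  · simp [hut]
  · simp [hn]
  · simp [hm]
  · simp [hmt]
  · simp [hv]
  · simp [ht1]
  · simp [ht2]
  · simp
  · simp
  · rw [← hvec]
    simp [closure, length_vec]
  · simp
  · simp
  · simp [hv]
  · simp
  · funext k
    cases k <;> simp [hn, hv, hut, leaf, Letter.getQVal]
  · have hlen : ns.length = q.nodes.length + kb.nodes.length := by
      rw [← List.length_append, ← hns]
    simp only [List.length_reverse, length_vec]
    have : 4 * q.nodes.length + 4 * kb.nodes.length = 4 * ns.length := by omega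
    nlinarith [sq_nonneg ns.length]

/-! ### The table of coverings -/

/-- A formula as it is read from right to left. -/
def Formula.letters (a : Formula) : List Letter := (a.encode.map Letter.sym).reverse

/-- A name as it is read from right to left. -/
def nameLetters (n : Name) : List Letter := ((encodeNum n).map Letter.sym).reverse

/-- A function term as it is read from right to left, without the leading `fn`. -/
def FunTerm.letters (t : FunTerm) : List Letter := (t.encode.tail.map Letter.sym).reverse

theorem noBit_nil : NoBit [] := by
  intro b r h
  cases h

theorem nameLetters_inj {m n : Name} : nameLetters m = nameLetters n ↔ m = n := by
  refine ⟨fun h => ?_, fun h => h ▸ rfl⟩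
  have h₁ : encodeNum m = encodeNum n :=
    List.map_injective_iff.2 (fun _ _ h => Letter.sym.inj h) (List.reverse_injective h)
  exact (encodeNum_append_inj (r := []) (r' := []) noBit_nil noBit_nil (by simpa using h₁)).1

theorem FunTerm.letters_inj {t t' : FunTerm} : t.letters = t'.letters ↔ t = t' := by
  refine ⟨fun h => ?_, fun h => h ▸ rfl⟩
  have h₁ : t.encode.tail = t'.encode.tail :=
    List.map_injective_iff.2 (fun _ _ h => Letter.sym.inj h) (List.reverse_injective h)
  have h : ∀ t : FunTerm, (Formula.eq t 0).encode =
      Sym.fn :: (t.encode.tail ++ Sym.eq :: encodeNum 0) := by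
    simp [Formula.encode, FunTerm.encode]
  have h₂ : (Formula.eq t 0).encode ++ [] = (Formula.eq t' 0).encode ++ [] := by
    rw [h, h, h₁]
  have h₃ := (Formula.encode_append_inj _ _ _ _ noBit_nil noBit_nil h₂).1
  exact (Formula.eq.inj h₃).1

theorem letters_eq (t : FunTerm) (n : Name) :
    (Formula.eq t n).letters = nameLetters n ++ .sym .eq :: (t.letters ++ [.sym .fn]) := by
  simp [Formula.letters, Formula.encode, nameLetters, FunTerm.letters, FunTerm.encode]

theorem letters_neg (a : Formula) : (Formula.neg a).letters = a.letters ++ [.sym .neg] := by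
  simp [Formula.letters, Formula.encode]

theorem letters_or (a b : Formula) :
    (Formula.or a b).letters = b.letters ++ (a.letters ++ [.sym .or]) := by
  simp [Formula.letters, Formula.encode]

theorem isSeg_nameLetters {n : Name} : ∀ x ∈ nameLetters n, x.isSeg = true := by
  simp only [nameLetters, encodeNum, List.mem_reverse, List.mem_map]
  rintro _ ⟨_, ⟨b, -, rfl⟩, rfl⟩
  rfl

theorem isSeg_letters {t : FunTerm} : ∀ x ∈ t.letters, x.isSeg = true := by
  simp only [FunTerm.letters, FunTerm.encode, encodeNum, List.cons_append, List.tail_cons,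
    List.mem_reverse, List.mem_map, List.mem_append, List.mem_flatMap, List.mem_cons]
  rintro _ ⟨_, ⟨b, -, rfl⟩ | ⟨n, -, rfl | ⟨b, -, rfl⟩⟩, rfl⟩ <;> rfl

/-- Output a cell. -/
def emit (c : Cell) : Code := .push .v (.cell c) ⨟ .push .mt (.cell c)

/-- Comparison of a letter of a name or a term with the letter on the stack `q`. -/
def compareCode (x : Letter) : Code :=
  .push .t1 x ⨟ .popCase .q fun o => match o with
    | some y => if y.isSeg = true
        then .push .t2 y ⨟ (if y = x then .skip else modify .fl fun _ => .bit false)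
        else .push .q y ⨟ modify .fl fun _ => .bit false
    | none => modify .fl fun _ => .bit false

/-- The rest of a name or a term on the stack `q` makes a comparison fail. -/
def drainCode : Code :=
  .foreach .q Letter.isSeg fun y => .push .t2 y ⨟ modify .fl fun _ => .bit false

/-- Processing of a letter, while the cells of the row of the atom on the stack `q` are computed. -/
def scanCode : Letter → Code
  | .sym .eq => .push .t1 (.sym .eq) ⨟ drainCode ⨟ (.popCase .q fun _ => .push .t2 (.sym .eq)) ⨟
      .push .fl (.bit true)
  | .sym .fn => .push .t1 (.sym .fn) ⨟ drainCode ⨟ moveAll .t2 .q ⨟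
      (.popCase .fl fun o => match o with
        | some y => .popCase .fl fun o => match o with
          | some x => emit (.ofRel x.getBit y.getBit)
          | none => .skip
        | none => .skip) ⨟ .push .fl (.bit true)
  | .sym .neg => .push .t1 (.sym .neg) ⨟ .popCase .v fun o => match o with
      | some x => emit x.getCell.neg
      | none => .skip
  | .sym .or => .push .t1 (.sym .or) ⨟ .popCase .v fun o => match o with
      | some x => .popCase .v fun o => match o with
        | some y => emit (x.getCell.or y.getCell)
        | none => .skip
      | none => .skip
  | x => compareCode x

theorem scanCode_of_isSeg {x : Letter} (hx : x.isSeg = true) : scanCode x = compareCode x := by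
  unfold Letter.isSeg at hx
  split at hx <;> first | rfl | simp at hx

/-- One letter `x` has been compared with the first letter of the name or term `d`, which is moved
to the stack `t2`; nothing is moved if `d` is empty. -/
theorem exec_compareCode {s : Regs} {x : Letter} {d e f : List Letter} {b : Bool}
    (hq : s .q = d ++ e) (hd : ∀ y ∈ d, y.isSeg = true)
    (he : ∀ y ∈ e.head?, y.isSeg = false) (hfl : s .fl = .bit b :: f) :
    Exec (compareCode x) s
      (update (update (update (update s .t1 (x :: s .t1)) .q (d.drop 1 ++ e))
        .t2 ((d.take 1).reverse ++ s .t2)) .fl (.bit (b && decide (d.take 1 = [x])) :: f)) 5 := by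
  cases d with
  | nil =>
    cases e with
    | nil =>
      refine ((Exec.push _ _ _).seq (Exec.popNone ?_ (exec_modify (a := .bit b) (l := f) ?_))).to
        ?_ ?_
      · simpa using hq
      · simpa using hfl
      · funext k
        cases k <;> simp_all
      · omega
    | cons y e =>
      have hy : y.isSeg = false := he y (by simp)
      refine ((Exec.push _ _ _).seq (Exec.popSome (a := y) (l := e) ?_
        (s₁ := update (update (update s .t1 (x :: s .t1)) .q (y :: e)) .fl (.bit false :: f))
        (n := 3) ?_)).to ?_ ?_
      · simpa using hq
      · simp only [hy, Bool.false_eq_true, if_false]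
        refine ((Exec.push _ _ _).seq (exec_modify (a := .bit b) (l := f) ?_)).to ?_ ?_
        · simpa using hfl
        · funext k
          cases k <;> simp
        · omega
      · funext k
        cases k <;> simp
      · omega
  | cons y d =>
    have hy : y.isSeg = true := hd y (by simp)
    refine ((Exec.push _ _ _).seq (Exec.popSome (a := y) (l := d ++ e) ?_
        (s₁ := update (update (update (update s .t1 (x :: s .t1)) .q (d ++ e))
          .t2 (y :: s .t2)) .fl (.bit (b && decide (y = x)) :: f))
        (n := 3) ?_)).to ?_ ?_
    · simpa using hq
    · simp only [hy, if_true]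
      by_cases hyx : y = x
      · simp only [hyx, if_true]
        refine ((Exec.push _ _ _).seq (Exec.skip _)).to ?_ ?_
        · funext k
          cases k <;> simp [hfl]
        · omega
      · simp only [hyx, if_false]
        refine ((Exec.push _ _ _).seq (exec_modify (a := .bit b) (l := f) ?_)).to ?_ ?_
        · simpa using hfl
        · funext k
          cases k <;> simp
        · omega
    · funext k
      cases k <;> simp
    · omega

theorem iter_compareCode {s : Regs} {l rest d e f : List Letter} {b : Bool}
    (hw : s .w = l ++ rest) (hl : ∀ y ∈ l, y.isSeg = true) (hq : s .q = d ++ e)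
    (hd : ∀ y ∈ d, y.isSeg = true)
    (he : ∀ y ∈ e.head?, y.isSeg = false) (hfl : s .fl = .bit b :: f) :
    Iter .w (fun _ => true) scanCode s
      (update (update (update (update (update s .w rest) .t1 (l.reverse ++ s .t1))
        .q (d.drop l.length ++ e)) .t2 ((d.take l.length).reverse ++ s .t2))
        .fl (.bit (b && decide (d.take l.length = l)) :: f)) (6 * l.length) := by
  induction l generalizing s d b with
  | nil =>
    refine (Iter.refl _).to ?_ (by simp)
    funext k
    cases k <;> simp_all
  | cons x l ih =>
    have h := exec_compareCode (s := update s .w (l ++ rest)) (x := x) (d := d) (e := e) (b := b)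
      (f := f) (by simpa using hq) hd he (by simpa using hfl)
    rw [← scanCode_of_isSeg (hl x (by simp))] at h
    refine ((Iter.single (a := x) (l := l ++ rest) hw rfl h).trans
      (ih (d := d.drop 1) (b := b && decide (d.take 1 = [x])) ?_ ?_ ?_ ?_ ?_)).to ?_ ?_
    · simp
    · exact fun y hy => hl y (by simp [hy])
    · simp
    · exact fun y hy => hd y (List.mem_of_mem_drop hy)
    · simp
    · funext k
      cases d with
      | nil => cases k <;> simp
      | cons y d => cases k <;> simp [Bool.and_assoc]
    · simp only [List.length_cons]; omega

theorem exec_drainCode {s : Regs} {d e f : List Letter} {b : Bool} (hq : s .q = d ++ e)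
    (hd : ∀ y ∈ d, y.isSeg = true) (he : ∀ y ∈ e.head?, y.isSeg = false)
    (hfl : s .fl = .bit b :: f) :
    Exec drainCode s (update (update (update s .q e) .t2 (d.reverse ++ s .t2))
      .fl (.bit (b && decide (d = [])) :: f)) (4 * d.length + 1) := by
  induction d generalizing s b with
  | nil =>
    refine (Exec.done (by simpa [hq] using he)).to ?_ (by simp)
    funext k
    cases k <;> simp_all
  | cons y d ih =>
    refine (Exec.step hq (hd y (by simp)) ((Exec.push _ _ _).seq
      (exec_modify (a := .bit b) (l := f) ?_)) (ih (b := false) ?_ ?_ ?_)).to ?_ ?_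
    · simpa using hfl
    · simp
    · exact fun z hz => hd z (by simp [hz])
    · simp
    · funext k
      cases k <;> simp
    · simp only [List.length_cons]; omega

/-- Comparing `l` with as many letters of `d`, and testing that no letters of `d` remain, decides
whether `d = l`. -/
theorem compare_eq {d l : List Letter} (b : Bool) :
    ((b && decide (d.take l.length = l)) && decide (d.drop l.length = [])) =
      (b && decide (d = l)) := by
  rw [Bool.and_assoc, ← Bool.decide_and]
  congr 2
  refine propext ⟨fun h => ?_, ?_⟩
  · rw [← List.take_append_drop l.length d, h.1, h.2, List.append_nil]
  · rintro rfl
    simp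

/-- One column of the row of an atom, for a column that is an atom. -/
theorem iter_scanCode_atom {s : Regs} {l₁ l₂ d₁ d₂ rest f : List Letter}
    (hw : s .w = l₁ ++ .sym .eq :: (l₂ ++ .sym .fn :: rest))
    (hl₁ : ∀ y ∈ l₁, y.isSeg = true) (hl₂ : ∀ y ∈ l₂, y.isSeg = true)
    (hq : s .q = d₁ ++ .sym .eq :: d₂) (hd₁ : ∀ y ∈ d₁, y.isSeg = true)
    (hd₂ : ∀ y ∈ d₂, y.isSeg = true) (ht2 : s .t2 = []) (hfl : s .fl = .bit true :: f) :
    Iter .w (fun _ => true) scanCode s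
      (update (update (update (update s .w rest)
        .t1 (.sym .fn :: (l₂.reverse ++ .sym .eq :: (l₁.reverse ++ s .t1))))
        .v (.cell (.ofRel (decide (d₁ = l₁)) (decide (d₂ = l₂))) :: s .v))
        .mt (.cell (.ofRel (decide (d₁ = l₁)) (decide (d₂ = l₂))) :: s .mt))
      (6 * (l₁.length + l₂.length) + 6 * (d₁.length + d₂.length) + 20) := by
  have h₁ : ∀ s' : Regs, s' .q = d₁.drop l₁.length ++ .sym .eq :: d₂ →
      s' .fl = .bit (decide (d₁.take l₁.length = l₁)) :: f →
      Exec (scanCode (.sym .eq)) s'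
        (update (update (update (update s' .t1 (.sym .eq :: s' .t1)) .q d₂)
          .t2 (.sym .eq :: ((d₁.drop l₁.length).reverse ++ s' .t2)))
          .fl (.bit true :: .bit (decide (d₁ = l₁)) :: f)) (4 * d₁.length + 6) := by
    intro s' hq' hfl'
    refine ((Exec.push _ _ _).seq ((exec_drainCode (d := d₁.drop l₁.length)
      (e := .sym .eq :: d₂) (b := decide (d₁.take l₁.length = l₁)) (f := f) ?_ ?_ ?_ ?_).seq
      ((Exec.popSome (a := .sym .eq) (l := d₂) ?_ (.push _ _ _)).seq (.push _ _ _)))).to ?_ ?_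
    · simpa using hq'
    · exact fun y hy => hd₁ y (List.mem_of_mem_drop hy)
    · simp [Letter.isSeg]
    · simpa using hfl'
    · simp
    · have h := compare_eq (d := d₁) (l := l₁) true
      simp only [Bool.true_and] at h
      funext k
      cases k <;> simp [h, -List.drop_eq_nil_iff]
    · rw [List.length_drop]; omega
  have h₂ : ∀ s' : Regs, s' .q = d₂.drop l₂.length ++ [] →
      s' .t2 = (d₂.take l₂.length).reverse ++ .sym .eq :: d₁.reverse →
      s' .fl = .bit (decide (d₂.take l₂.length = l₂)) :: .bit (decide (d₁ = l₁)) :: f →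
      Exec (scanCode (.sym .fn)) s'
        (update (update (update (update (update (update s' .t1 (.sym .fn :: s' .t1))
          .q (d₁ ++ .sym .eq :: d₂)) .t2 []) .fl (.bit true :: f))
          .v (.cell (.ofRel (decide (d₁ = l₁)) (decide (d₂ = l₂))) :: s' .v))
          .mt (.cell (.ofRel (decide (d₁ = l₁)) (decide (d₂ = l₂))) :: s' .mt))
        (2 * d₁.length + 6 * d₂.length + 12) := by
    intro s' hq' ht2' hfl'
    refine ((Exec.push _ _ _).seq ((exec_drainCode (d := d₂.drop l₂.length)
      (e := []) (b := decide (d₂.take l₂.length = l₂)) (f := .bit (decide (d₁ = l₁)) :: f)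
        ?_ ?_ ?_ ?_).seq
      ((exec_moveAll (l := (d₁ ++ .sym .eq :: d₂).reverse) (by decide) ?_).seq
      ((Exec.popSome (a := .bit (decide (d₂ = l₂))) (l := .bit (decide (d₁ = l₁)) :: f) ?_
        (Exec.popSome (a := .bit (decide (d₁ = l₁))) (l := f) ?_
          ((Exec.push _ _ _).seq (.push _ _ _)))).seq (.push _ _ _))))).to ?_ ?_
    · simpa using hq'
    · exact fun y hy => hd₂ y (List.mem_of_mem_drop hy)
    · simp
    · simpa using hfl'
    · simp only [ne_eq, reduceCtorEq, not_false_eq_true, update_of_ne, update_self, ht2']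
      rw [← List.append_assoc, ← List.reverse_append, List.take_append_drop]
      simp
    · have h := compare_eq (d := d₂) (l := l₂) true
      simp only [Bool.true_and] at h
      simp [h, -List.drop_eq_nil_iff]
    · simp
    · funext k
      cases k <;> simp [Letter.getBit]
    · simp only [List.length_reverse, List.length_append, List.length_cons, List.length_drop]
      omega
  refine ((iter_compareCode (d := d₁) (e := .sym .eq :: d₂) (b := true) (f := f) hw hl₁ hq hd₁ ?_
    hfl).trans ((Iter.single (a := .sym .eq) (l := l₂ ++ .sym .fn :: rest) ?_ rfl
      (h₁ _ ?_ ?_)).trans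
    ((iter_compareCode (l := l₂) (d := d₂) (e := []) (b := true) (rest := .sym .fn :: rest)
      (f := .bit (decide (d₁ = l₁)) :: f) ?_ hl₂ ?_ hd₂ ?_ ?_).trans
    (Iter.single (a := .sym .fn) (l := rest) ?_ rfl (h₂ _ ?_ ?_ ?_))))).to ?_ ?_
  · simp [Letter.isSeg]
  · simp
  · simp
  · simp
  · simp
  · simp
  · simp
  · simp
  · simp
  · simp
  · simp only [ne_eq, reduceCtorEq, not_false_eq_true, update_of_ne, update_self, ht2,
      List.append_nil]
    rw [← List.reverse_append, List.take_append_drop]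
  · simp
  · funext k
    cases k <;> simp [hq, ht2, hfl]
  · omega

/-- The row of an atom, for the columns of a formula. -/
theorem iter_scanCode {s : Regs} {t : FunTerm} {n : Name} {a : Formula} (ha : a.Objective)
    {rest f : List Letter} (hw : s .w = a.letters ++ rest)
    (hq : s .q = nameLetters n ++ .sym .eq :: t.letters) (ht2 : s .t2 = [])
    (hfl : s .fl = .bit true :: f) :
    Iter .w (fun _ => true) scanCode s
      (update (update (update (update s .w rest) .t1 (a.letters.reverse ++ s .t1))
        .v (.cell (cov t n a) :: s .v))
        .mt ((a.nodes.map fun b => .cell (cov t n b)).reverse ++ s .mt))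
      (a.letters.length * (6 * ((nameLetters n).length + t.letters.length) + 20)) := by
  induction a generalizing s rest with
  | eq t' n' =>
    refine (iter_scanCode_atom (l₁ := nameLetters n') (l₂ := t'.letters) (rest := rest) (f := f)
      ?_ isSeg_nameLetters isSeg_letters hq isSeg_nameLetters isSeg_letters ht2 hfl).to ?_ ?_
    · simp [hw, letters_eq]
    · funext k
      cases k <;> simp [cov, Formula.nodes, nameLetters_inj, FunTerm.letters_inj, letters_eq]
    · simp only [letters_eq, List.length_append, List.length_cons, List.length_nil]
      nlinarith
  | neg b ih =>
    refine ((ih ha (rest := .sym .neg :: rest) ?_ ?_ ?_ ?_).trans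
      (Iter.single (a := .sym .neg) (l := rest) ?_ rfl ((Exec.push _ _ _).seq
        (Exec.popSome (a := .cell (cov t n b)) (l := s .v) ?_
          ((Exec.push _ _ _).seq (.push _ _ _)))))).to ?_ ?_
    · simp [hw, letters_neg]
    · simp [hq]
    · simp [ht2]
    · simp [hfl]
    · simp
    · simp
    · funext k
      cases k <;> simp [cov, Formula.nodes, Letter.getCell, letters_neg]
    · simp only [letters_neg, List.length_append, List.length_cons, List.length_nil]
      nlinarith
  | or b c ihb ihc =>
    refine (((ihc ha.2 (rest := b.letters ++ .sym .or :: rest) ?_ ?_ ?_ ?_).trans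
      (ihb ha.1 (rest := .sym .or :: rest) ?_ ?_ ?_ ?_)).trans
      (Iter.single (a := .sym .or) (l := rest) ?_ rfl ((Exec.push _ _ _).seq
        (Exec.popSome (a := .cell (cov t n b)) (l := .cell (cov t n c) :: s .v) ?_
          (Exec.popSome (a := .cell (cov t n c)) (l := s .v) ?_
          ((Exec.push _ _ _).seq (.push _ _ _))))))).to ?_ ?_
    · simp [hw, letters_or]
    · simp [hq]
    · simp [ht2]
    · simp [hfl]
    · simp
    · simp [hq]
    · simp [ht2]
    · simp [hfl]
    · simp
    · simp
    · simp
    · funext k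
      cases k <;> simp [cov, Formula.nodes, Letter.getCell, letters_or]
    · simp only [letters_or, List.length_append, List.length_cons, List.length_nil]
      nlinarith
  | bel k b => exact ha.elim

/-- Processing of a letter of the formulas on the stack `w2`, while all rows are computed. -/
def rowsCode : Letter → Code
  | .sym .fn => moveAll .t2 .q ⨟ .push .fl (.bit true) ⨟
      .foreach .w (fun _ => true) scanCode ⨟ moveAll .t1 .w ⨟ clear .v ⨟ clear .q ⨟ pop .fl ⨟
      .push .mt (.tok .atom) ⨟ .push .ut (.entry .atom (false, false))
  | .sym .neg => .push .mt (.tok .neg) ⨟ .push .ut (.entry .neg (false, false))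
  | .sym .or => .push .mt (.tok .or) ⨟ .push .ut (.entry .or (false, false))
  | x => .push .t2 x

theorem rowsCode_of_isSeg {x : Letter} (hx : x.isSeg = true) : rowsCode x = .push .t2 x := by
  unfold Letter.isSeg at hx
  split at hx <;> first | rfl | simp at hx

theorem iter_rowsCode_seg {s : Regs} {l rest : List Letter} (hl : ∀ x ∈ l, x.isSeg = true)
    (hw : s .w2 = l ++ rest) :
    Iter .w2 (fun _ => true) rowsCode s
      (update (update s .w2 rest) .t2 (l.reverse ++ s .t2)) (2 * l.length) := by
  induction l generalizing s with
  | nil =>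
    refine (Iter.refl _).to ?_ (by simp)
    funext k
    cases k <;> simp_all
  | cons x l ih =>
    have h := Exec.push .t2 x (update s .w2 (l ++ rest))
    rw [← rowsCode_of_isSeg (hl x (by simp))] at h
    refine ((Iter.single (a := x) (l := l ++ rest) hw rfl h).trans (ih ?_ ?_)).to ?_ ?_
    · exact fun y hy => hl y (by simp [hy])
    · simp
    · funext k
      cases k <;> simp
    · simp only [List.length_cons]; omega

/-- The row of an atom, for the columns of the query and the knowledge base. -/
theorem iter_scanCode_all {s : Regs} {t : FunTerm} {n : Name} {kb q : Formula}
    (hkb : kb.Objective) (hqo : q.Objective) {f : List Letter}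
    (hw : s .w = q.letters ++ kb.letters)
    (hq : s .q = nameLetters n ++ .sym .eq :: t.letters) (ht2 : s .t2 = [])
    (hfl : s .fl = .bit true :: f) :
    Exec (.foreach .w (fun _ => true) scanCode) s
      (update (update (update (update s .w []) .t1 ((q.letters ++ kb.letters).reverse ++ s .t1))
        .v (.cell (cov t n kb) :: .cell (cov t n q) :: s .v))
        .mt (((q.nodes ++ kb.nodes).map fun b => .cell (cov t n b)).reverse ++ s .mt))
      ((q.letters.length + kb.letters.length) *
        (6 * ((nameLetters n).length + t.letters.length) + 20) + 1) := by
  refine (((iter_scanCode hqo (t := t) (n := n) (rest := kb.letters) (f := f) hw hq ht2 hfl).trans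
    (iter_scanCode hkb (t := t) (n := n) (rest := []) (f := f) ?_ ?_ ?_ ?_)).finish ?_).to ?_ ?_
  · simp
  · simp [hq]
  · simp [ht2]
  · simp [hfl]
  · simp
  · funext k
    cases k <;> simp
  · rw [add_mul]

/-- The time for a row is the product of the lengths of its atom and of the formulas, hence that for
all rows is quadratic. -/
theorem iter_rowsCode {s : Regs} {kb q a : Formula} (hkb : kb.Objective) (hqo : q.Objective)
    (ha : a.Objective) (hns : ns = q.nodes ++ kb.nodes) {rest : List Letter}
    (hw : s .w = q.letters ++ kb.letters) (hw2 : s .w2 = a.letters ++ rest)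
    (hq : s .q = []) (ht1 : s .t1 = []) (ht2 : s .t2 = []) (hv : s .v = []) :
    Iter .w2 (fun _ => true) rowsCode s
      (update (update (update s .w2 rest) .mt ((stream ns a.nodes).reverse ++ s .mt))
        .ut ((vec a.nodes fun _ => (false, false)).reverse ++ s .ut))
      (a.letters.length * (24 * (q.letters.length + kb.letters.length + 1))) := by
  induction a generalizing s rest with
  | eq t n =>
    have heq : ∀ s' : Regs, Exec (rowsCode (.sym .eq)) s' (update s' .t2 (.sym .eq :: s' .t2)) 1 :=
      fun s' => .push _ _ s'
    refine ((iter_rowsCode_seg (l := nameLetters n) (rest := .sym .eq :: (t.letters ++ .sym .fn ::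
        rest)) isSeg_nameLetters ?_).trans
      ((Iter.single (a := .sym .eq) (l := t.letters ++ .sym .fn :: rest) ?_ rfl (heq _)).trans
      ((iter_rowsCode_seg (l := t.letters) (rest := .sym .fn :: rest) isSeg_letters ?_).trans
      (Iter.single (a := .sym .fn) (l := rest) ?_ rfl
        ((exec_moveAll (l := (nameLetters n ++ .sym .eq :: t.letters).reverse) (by decide) ?_).seq
        ((Exec.push _ _ _).seq
        ((iter_scanCode_all hkb hqo (t := t) (n := n) (f := s .fl) ?_ ?_ ?_ ?_).seq
        ((exec_moveAll (l := (q.letters ++ kb.letters).reverse) (by decide) ?_).seq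
        ((exec_clearReg (l := [.cell (cov t n kb), .cell (cov t n q)]) ?_).seq
        ((exec_clearReg (l := nameLetters n ++ .sym .eq :: t.letters) ?_).seq
        ((exec_pop (a := .bit true) (l := s .fl) ?_).seq
        ((Exec.push _ _ _).seq (.push _ _ _)))))))))))) ).to ?_ ?_
    · simp [hw2, letters_eq]
    · simp
    · simp
    · simp
    · simp [ht2]
    · simp [hw]
    · simp [hq]
    · simp
    · simp
    · simp [ht1]
    · simp [hv]
    · simp [hq]
    · simp
    · funext k
      cases k <;> simp [Formula.nodes, stream, tokens, vec, Formula.kind, ht1, ht2, hv, hq, hw, hns]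
    · simp only [letters_eq, List.length_append, List.length_cons, List.length_nil,
        List.length_reverse]
      nlinarith
  | neg b ih =>
    refine ((ih ha (rest := .sym .neg :: rest) ?_ ?_ ?_ ?_ ?_ ?_).trans
      (Iter.single (a := .sym .neg) (l := rest) ?_ rfl ((Exec.push _ _ _).seq
        (.push _ _ _)))).to ?_ ?_
    · simp [hw]
    · simp [hw2, letters_neg]
    · simp [hq]
    · simp [ht1]
    · simp [ht2]
    · simp [hv]
    · simp
    · funext k
      cases k <;> simp [Formula.nodes, stream, tokens, vec, Formula.kind]
    · simp only [letters_neg, List.length_append, List.length_cons, List.length_nil]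
      nlinarith
  | or b c ihb ihc =>
    refine (((ihc ha.2 (rest := b.letters ++ .sym .or :: rest) ?_ ?_ ?_ ?_ ?_ ?_).trans
      (ihb ha.1 (rest := .sym .or :: rest) ?_ ?_ ?_ ?_ ?_ ?_)).trans
      (Iter.single (a := .sym .or) (l := rest) ?_ rfl ((Exec.push _ _ _).seq
        (.push _ _ _)))).to ?_ ?_
    · simp [hw]
    · simp [hw2, letters_or]
    · simp [hq]
    · simp [ht1]
    · simp [ht2]
    · simp [hv]
    · simp [hw]
    · simp
    · simp [hq]
    · simp [ht1]
    · simp [ht2]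
    · simp [hv]
    · simp
    · funext k
      cases k <;> simp [Formula.nodes, stream, tokens, vec, Formula.kind]
    · simp only [letters_or, List.length_append, List.length_cons, List.length_nil]
      nlinarith
  | bel k b => exact ha.elim

/-! ### Reading the input -/

/-- Whether the letter is not the mark of a belief operator. -/
def Letter.isNotBel : Letter → Bool
  | .sym .bel => false
  | _ => true

/-- Whether the letter is a bit of the input. -/
def Letter.isDigit : Letter → Bool
  | .sym (.bit _) => true
  | _ => false

/-- Write a symbol of a formula on the stacks `w` and `w2`. -/
def copyCode (x : Letter) : Code := .push .w x ⨟ .push .w2 x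

/-- Read the input: the formulas are written on the stacks `w` and `w2`, in reverse, and the level
on the stack `b`. -/
def loadCode : Code :=
  moveAll .inp .t1 ⨟ pop .t1 ⨟ pop .t1 ⨟ pop .t1 ⨟ .foreach .t1 Letter.isNotBel copyCode ⨟ pop .t1 ⨟
    move .t1 .t2 Letter.isDigit id ⨟ moveAll .t2 .b ⨟ .foreach .t1 (fun _ => true) copyCode

theorem exec_copyCode {s : Regs} {c : Letter → Bool} {l rest : List Letter}
    (hs : s .t1 = l ++ rest) (hl : ∀ a ∈ l, c a = true) (hrest : ∀ a ∈ rest.head?, c a = false) :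
    Exec (.foreach .t1 c copyCode) s
      (update (update (update s .t1 rest) .w (l.reverse ++ s .w)) .w2 (l.reverse ++ s .w2))
      (3 * l.length + 1) := by
  induction l generalizing s with
  | nil =>
    refine (Exec.done (by simpa [hs] using hrest)).to ?_ (by simp)
    funext k
    cases k <;> simp_all
  | cons x l ih =>
    refine (Exec.step hs (hl x (by simp)) ((Exec.push _ _ _).seq (.push _ _ _)) (ih ?_ ?_)).to ?_ ?_
    · simp
    · exact fun b hb => hl b (by simp [hb])
    · funext k
      cases k <;> simp
    · simp only [List.length_cons]; omega

theorem isNotBel_of_mem_encode {a : Formula} (ha : a.Objective) :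
    ∀ x ∈ a.encode.map Letter.sym, x.isNotBel = true := by
  induction a with
  | eq t n =>
    simp only [List.mem_map, Formula.encode, FunTerm.encode, encodeNum, List.mem_append,
      List.mem_cons, List.mem_flatMap]
    rintro _ ⟨_, ((rfl | ⟨_, -, rfl⟩) | ⟨_, -, rfl | ⟨_, -, rfl⟩⟩) | rfl | ⟨_, -, rfl⟩, rfl⟩ <;> rfl
  | neg a ih =>
    simp only [Formula.encode, List.map_cons, List.mem_cons]
    rintro x (rfl | hx)
    · rfl
    · exact ih ha x hx
  | or a b iha ihb =>
    simp only [Formula.encode, List.map_cons, List.map_append, List.mem_cons, List.mem_append]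
    rintro x (rfl | hx | hx)
    · rfl
    · exact iha ha.1 x hx
    · exact ihb ha.2 x hx
  | bel k a => exact ha.elim

theorem isDigit_head?_encode (a : Formula) :
    ∀ x ∈ (a.encode.map Letter.sym).head?, x.isDigit = false := by
  cases a <;> simp [Formula.encode, FunTerm.encode, Letter.isDigit]

theorem length_letters (a : Formula) : a.letters.length = a.length := by
  simp [Formula.letters, Formula.length]

theorem encode_eq (x : Instance) : x.encode =
    .or :: .neg :: .bel :: (x.kb.encode ++ .bel :: (encodeNum x.level ++ x.query.encode)) := by
  have : encodeNum 0 = [] := rfl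
  simp [Instance.encode, Instance.formula, Formula.imp, Formula.encode, this]

theorem length_encode (x : Instance) :
    x.encode.length = x.kb.length + x.query.length + (encodeNum x.level).length + 4 := by
  simp only [encode_eq, List.length_cons, List.length_append, Formula.length]
  omega

theorem exec_loadCode {s : Regs} {x : Instance} (hkb : x.kb.Objective)
    (hinp : s .inp = x.encode.reverse.map Letter.sym) (ht1 : s .t1 = []) (ht2 : s .t2 = [])
    (hb : s .b = []) (hw : s .w = []) (hw2 : s .w2 = []) :
    Exec loadCode s
      (update (update (update (update s .inp []) .w (x.query.letters ++ x.kb.letters))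
        .w2 (x.query.letters ++ x.kb.letters)) .b ((encodeNum x.level).map Letter.sym))
      (10 * x.encode.length + 12) := by
  refine ((exec_moveAll (by decide) hinp).seq
    ((exec_pop (a := .sym .or) (l := .sym .neg :: .sym .bel :: (x.kb.encode.map Letter.sym ++
      .sym .bel :: ((encodeNum x.level).map Letter.sym ++ x.query.encode.map Letter.sym))) ?_).seq
    ((exec_pop (a := .sym .neg) (l := .sym .bel :: (x.kb.encode.map Letter.sym ++
      .sym .bel :: ((encodeNum x.level).map Letter.sym ++ x.query.encode.map Letter.sym))) ?_).seq
    ((exec_pop (a := .sym .bel) (l := x.kb.encode.map Letter.sym ++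
      .sym .bel :: ((encodeNum x.level).map Letter.sym ++ x.query.encode.map Letter.sym)) ?_).seq
    ((exec_copyCode (l := x.kb.encode.map Letter.sym) (rest := .sym .bel ::
      ((encodeNum x.level).map Letter.sym ++ x.query.encode.map Letter.sym)) ?_
      (isNotBel_of_mem_encode hkb) ?_).seq
    ((exec_pop (a := .sym .bel) (l := (encodeNum x.level).map Letter.sym ++
      x.query.encode.map Letter.sym) ?_).seq
    ((exec_move (l := (encodeNum x.level).map Letter.sym) (rest := x.query.encode.map Letter.sym)
      (by decide) _ ?_ ?_ (isDigit_head?_encode _)).seq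
    ((exec_moveAll (l := ((encodeNum x.level).map Letter.sym).reverse) (by decide) ?_).seq
    (exec_copyCode (l := x.query.encode.map Letter.sym) (rest := []) ?_ ?_ ?_))))))))).to ?_ ?_
  · simp [ht1, encode_eq]
  · simp
  · simp
  · simp
  · simp [Letter.isNotBel]
  · simp
  · simp
  · simp only [encodeNum, List.mem_map]
    rintro _ ⟨_, ⟨b, -, rfl⟩, rfl⟩
    rfl
  · simp [ht2]
  · simp
  · simp
  · simp
  · funext k
    cases k <;> simp [ht1, ht2, hb, hw, hw2, Formula.letters]
  · simp only [encode_eq, List.length_reverse, List.length_map, List.length_cons,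
      List.length_append]
    omega

/-- Compute the table of coverings. -/
def tableCode : Code :=
  .foreach .w2 (fun _ => true) rowsCode ⨟
    (.foreach .mt (fun _ => true) fun x => .push .m x ⨟ .push .m3 x) ⨟
    (.foreach .ut (fun _ => true) fun x => .push .u x ⨟ .push .mask (.bit false))

theorem exec_copyStream {s : Regs} {l : List Letter} (hs : s .mt = l) :
    Exec (.foreach .mt (fun _ => true) fun x => .push .m x ⨟ .push .m3 x) s
      (update (update (update s .mt []) .m (l.reverse ++ s .m)) .m3 (l.reverse ++ s .m3))
      (3 * l.length + 1) := by
  induction l generalizing s with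
  | nil =>
    refine (Exec.done (by simp [hs])).to ?_ (by simp)
    funext k
    cases k <;> simp_all
  | cons x l ih =>
    refine (Exec.step hs rfl ((Exec.push _ _ _).seq (.push _ _ _)) (ih ?_)).to ?_ ?_
    · simp
    · funext k
      cases k <;> simp
    · simp only [List.length_cons]; omega

theorem exec_copyTable {s : Regs} {l : List Letter} (hs : s .ut = l) :
    Exec (.foreach .ut (fun _ => true) fun x => .push .u x ⨟ .push .mask (.bit false)) s
      (update (update (update s .ut []) .u (l.reverse ++ s .u))
        .mask (List.replicate l.length (.bit false) ++ s .mask))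
      (3 * l.length + 1) := by
  induction l generalizing s with
  | nil =>
    refine (Exec.done (by simp [hs])).to ?_ (by simp)
    funext k
    cases k <;> simp_all
  | cons x l ih =>
    refine (Exec.step hs rfl ((Exec.push _ _ _).seq (.push _ _ _)) (ih ?_)).to ?_ ?_
    · simp
    · funext k
      cases k
      case mask =>
        simp only [update_self, ne_eq, reduceCtorEq, not_false_eq_true, update_of_ne,
          List.length_cons, List.replicate_succ', List.append_assoc, List.cons_append,
          List.nil_append]
      all_goals simp
    · simp only [List.length_cons]; omega

theorem length_nodes_le {a : Formula} (ha : a.Objective) : a.nodes.length ≤ a.length := by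
  induction a with
  | eq t n => simp [Formula.nodes, Formula.length, Formula.encode, FunTerm.encode]
  | neg a ih =>
    have := ih ha
    simp only [Formula.nodes, Formula.length, Formula.encode, List.length_append,
      List.length_cons, List.length_nil] at this ⊢
    omega
  | or a b iha ihb =>
    have := iha ha.1
    have := ihb ha.2
    simp only [Formula.nodes, Formula.length, Formula.encode, List.length_append,
      List.length_cons, List.length_nil] at *
    omega
  | bel k a => exact ha.elim

theorem exec_tableCode {s : Regs} {kb q : Formula} (hkb : kb.Objective) (hqo : q.Objective)
    (hns : ns = q.nodes ++ kb.nodes)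
    (hw : s .w = q.letters ++ kb.letters) (hw2 : s .w2 = q.letters ++ kb.letters)
    (hq : s .q = []) (ht1 : s .t1 = []) (ht2 : s .t2 = []) (hv : s .v = []) (hmt : s .mt = [])
    (hut : s .ut = []) (hm : s .m = []) (hm3 : s .m3 = []) (hu : s .u = [])
    (hmask : s .mask = []) :
    Exec tableCode s
      (update (update (update (update (update s .w2 []) .m (stream ns ns)) .m3 (stream ns ns))
        .u (vec ns fun _ => (false, false))) .mask (ns.map fun _ => .bit false))
      (40 * (q.length + kb.length + 1) ^ 2) := by
  refine ((((iter_rowsCode hkb hqo hqo hns (rest := kb.letters) hw hw2 hq ht1 ht2 hv).trans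
    (iter_rowsCode hkb hqo hkb hns (rest := []) ?_ ?_ ?_ ?_ ?_ ?_)).finish ?_).seq
    ((exec_copyStream (l := (stream ns ns).reverse) ?_).seq
    (exec_copyTable (l := (vec ns fun _ => (false, false)).reverse) ?_))).to ?_ ?_
  · simp [hw]
  · simp
  · simp [hq]
  · simp [ht1]
  · simp [ht2]
  · simp [hv]
  · simp
  · rw [show stream ns ns = stream ns q.nodes ++ stream ns kb.nodes by
      simp only [stream, ← List.flatMap_append, ← hns]]
    simp [hmt]
  · rw [show (vec ns fun _ => (false, false)) = (vec q.nodes fun _ => (false, false)) ++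
      (vec kb.nodes fun _ => (false, false)) by simp only [vec, ← List.map_append, ← hns]]
    simp [hut]
  · funext k
    cases k <;> simp [hmt, hut, hm, hm3, hu, hmask, length_vec, List.map_const']
  · have h₁ := length_stream_le ns ns
    have h₂ := length_nodes_le hkb
    have h₃ := length_nodes_le hqo
    have h₄ : ns.length = q.nodes.length + kb.nodes.length := by
      rw [hns, List.length_append]
    simp only [List.length_reverse, length_vec, length_letters]
    have h₅ : ns.length ≤ q.length + kb.length := by omega
    generalize hL : q.length + kb.length = L at *
    have h₆ : q.length * (24 * (L + 1)) + kb.length * (24 * (L + 1)) = L * (24 * (L + 1)) := by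
      rw [← add_mul, hL]
    nlinarith

/-! ### The list of choices -/

/-- A choice, as it is stored on a stack, with a mark for the last choice for a term. -/
def choiceLetters (ns : List Formula) (last : Bool) (ch : Table) : List Letter :=
  ns.map (fun a => .pair (ch a)) ++ [.bit last]

/-- The choices for the terms in `l`, as they are stored on a stack. -/
def choicesLetters (ns : List Formula) (l : List FunTerm) : List Letter :=
  l.flatMap fun t =>
    (namedChoices ns t).flatMap (choiceLetters ns false) ++ choiceLetters ns true (otherChoice t)

/-- Whether the column is an atom with the same term as the row. -/
def Letter.same (x : Letter) : Bool := x.getCell.lit && x.getCell.f.2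

/-- Whether the formula is an atom with a term in `seen`. -/
def termIn (seen : List FunTerm) : Formula → Bool
  | .eq t _ => decide (t ∈ seen)
  | _ => false

theorem same_cov {t : FunTerm} {n : Name} {a : Formula} :
    (Letter.cell (cov t n a)).same = true ↔ ∃ n', a = .eq t n' := by
  rw [← cov_lit_term (t := t) (n := n)]
  simp [Letter.same, Letter.getCell]

theorem termIn_cons (seen : List FunTerm) (t : FunTerm) (n : Name) (a : Formula) :
    (termIn seen a || (Letter.cell (cov t n a)).same) = termIn (t :: seen) a := by
  cases a with
  | eq t' n' =>
    simp only [termIn, Letter.same, Letter.getCell, cov, Cell.ofRel, Bool.true_and,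
      List.mem_cons, Bool.decide_or]
    rw [Bool.or_comm]
    congr 1
    simp [eq_comm]
  | _ => simp [termIn, Letter.same, Letter.getCell, cov, Cell.neg, Cell.or]

/-- The row of `t` and `n` reaches the column of its own atom, so that looking through the columns
is enough to decide whether `t` has been seen. -/
theorem any_termIn {seen : List FunTerm} {t : FunTerm} {n : Name} (h : .eq t n ∈ ns) :
    (ns.any fun a => termIn seen a && (Letter.cell (cov t n a)).same) = decide (t ∈ seen) := by
  rw [Bool.eq_iff_iff, List.any_eq_true, decide_eq_true_iff]
  constructor
  · rintro ⟨a, -, ha⟩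
    rw [Bool.and_eq_true] at ha
    obtain ⟨n', rfl⟩ := same_cov.1 ha.2
    simpa [termIn] using ha.1
  · intro ht
    refine ⟨_, h, ?_⟩
    rw [Bool.and_eq_true]
    exact ⟨by simpa [termIn] using ht, same_cov.2 ⟨n, rfl⟩⟩

/-- Look up on the stack `mask` whether the term of the row on the stack `t1` has occurred before,
and record its occurrence. -/
def seenCode : Code :=
  moveAll .t1 .t2 ⨟ .push .fl (.bit false) ⨟
    (.foreach .t2 (fun _ => true) fun x => .push .t1 x ⨟ .popCase .mask fun o => match o with
      | some o => .push .t3 (.bit (o.getBit || x.same)) ⨟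
          modify .fl fun y => .bit (y.getBit || (o.getBit && x.same))
      | none => .skip) ⨟
    moveAll .t3 .mask

theorem exec_seenLoop {s : Regs} {t : FunTerm} {n : Name} {seen : List FunTerm}
    {l : List Formula} {f : List Letter} {b : Bool}
    (ht2 : s .t2 = l.map fun a => .cell (cov t n a))
    (hmask : s .mask = l.map fun a => .bit (termIn seen a)) (hfl : s .fl = .bit b :: f) :
    Exec (.foreach .t2 (fun _ => true) fun x => .push .t1 x ⨟ .popCase .mask fun o => match o with
      | some o => .push .t3 (.bit (o.getBit || x.same)) ⨟
          modify .fl fun y => .bit (y.getBit || (o.getBit && x.same))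
      | none => .skip) s
      (update (update (update (update (update s .t2 []) .mask [])
        .t1 ((l.map fun a => .cell (cov t n a)).reverse ++ s .t1))
        .t3 ((l.map fun a => .bit (termIn (t :: seen) a)).reverse ++ s .t3))
        .fl (.bit (b || l.any fun a => termIn seen a && (Letter.cell (cov t n a)).same) :: f))
      (6 * l.length + 1) := by
  induction l generalizing s b with
  | nil =>
    refine (Exec.done (by simp [ht2])).to ?_ (by simp)
    funext k
    cases k <;> simp_all
  | cons a l ih =>
    refine (Exec.step ht2 rfl ((Exec.push _ _ _).seq (.popSome
      (a := .bit (termIn seen a)) (l := l.map fun a => .bit (termIn seen a))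
      (by simpa using hmask)
      ((Exec.push _ _ _).seq (exec_modify (a := .bit b) (l := f) (by simpa using hfl)))))
      (ih (b := b || (termIn seen a && (Letter.cell (cov t n a)).same)) ?_ ?_ ?_)).to ?_ ?_
    · simp
    · simp
    · simp [Letter.getBit]
    · funext k
      have h := termIn_cons seen t n a
      cases k <;> simp [Letter.getBit, Bool.or_assoc, h]
    · simp only [List.length_cons]; omega

theorem exec_seenCode {s : Regs} {t : FunTerm} {n : Name} {seen : List FunTerm}
    (hmem : .eq t n ∈ ns)
    (ht1 : s .t1 = (ns.map fun a => .cell (cov t n a)).reverse)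
    (ht2 : s .t2 = []) (ht3 : s .t3 = [])
    (hmask : s .mask = ns.map fun a => .bit (termIn seen a)) :
    Exec seenCode s
      (update (update s .mask (ns.map fun a => .bit (termIn (t :: seen) a)))
        .fl (.bit (decide (t ∈ seen)) :: s .fl)) (10 * ns.length + 4) := by
  refine ((exec_moveAll (by decide) ht1).seq ((Exec.push _ _ _).seq
    ((exec_seenLoop (t := t) (n := n) (seen := seen) (l := ns) (b := false) (f := s .fl)
      ?_ ?_ ?_).seq
    (exec_moveAll (l := (ns.map fun a => .bit (termIn (t :: seen) a)).reverse)
      (by decide) ?_)))).to ?_ ?_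
  · simp [ht2]
  · simp [hmask]
  · simp
  · simp [ht3]
  · have h := any_termIn (seen := seen) hmem
    funext k
    cases k <;> simp [ht1, ht2, ht3, h]
  · simp only [List.length_reverse, List.length_map]; omega

/-- Pass the first symbol of a column on the stack `m`. -/
def passToken : Code := .popCase .m fun o => match o with
  | some y => .push .mt y
  | none => .skip

/-- Processing of a column of the row of a term: if it is an atom with this term, then its row
yields a choice. -/
def columnCode (x : Letter) : Code :=
  .push .t1 x ⨟ if x.same = true
    then (.foreach .m Letter.isCell fun y => .push .mt y ⨟ .push .c (.pair y.getCell.e)) ⨟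
      passToken ⨟ .push .c (.bit false)
    else move .m .mt Letter.isCell id ⨟ passToken

/-- Write the choices for the term of the row on the stack `t1`. -/
def groupCode : Code :=
  moveAll .t1 .t2 ⨟ .push .g .sep ⨟ .foreach .t2 (fun _ => true) columnCode ⨟ moveAll .mt .m ⨟
    move .t1 .t2 (fun _ => true) id ⨟
    move .t2 .c (fun _ => true) (fun x => .pair x.getCell.f) ⨟ .push .c (.bit true)

theorem exec_copyRow {s : Regs} {l : List Cell} {rest : List Letter}
    (hm : s .m = l.map Letter.cell ++ rest) (hrest : ∀ x ∈ rest.head?, x.isCell = false) :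
    Exec (.foreach .m Letter.isCell fun y => .push .mt y ⨟ .push .c (.pair y.getCell.e)) s
      (update (update (update s .m rest) .mt ((l.map Letter.cell).reverse ++ s .mt))
        .c ((l.map fun c => .pair c.e).reverse ++ s .c)) (3 * l.length + 1) := by
  induction l generalizing s with
  | nil =>
    refine (Exec.done (by simpa [hm] using hrest)).to ?_ (by simp)
    funext k
    cases k <;> simp_all
  | cons x l ih =>
    refine (Exec.step hm rfl ((Exec.push _ _ _).seq (.push _ _ _)) (ih ?_)).to ?_ ?_
    · simp
    · funext k
      cases k <;> simp [Letter.getCell]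
    · simp only [List.length_cons]; omega

theorem exec_columnCode {s : Regs} {t : FunTerm} {n : Name} {a : Formula} (ha : a.Objective)
    {rest : List Letter} (hm : s .m = tokens ns a ++ rest) :
    Exec (columnCode (.cell (cov t n a))) s
      (update (update (update (update s .t1 (.cell (cov t n a) :: s .t1)) .m rest)
        .mt ((tokens ns a).reverse ++ s .mt))
        .c (((namedChoices [a] t).flatMap (choiceLetters ns false)).reverse ++ s .c))
      (3 * ns.length + 5) := by
  obtain ⟨cs, tok, htok, hcs, hlen⟩ : ∃ (cs : List Cell) (tok : Kind),
      tokens ns a = cs.map Letter.cell ++ [.tok tok] ∧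
      (∀ n', a = .eq t n' → cs = ns.map (cov t n')) ∧ cs.length ≤ ns.length := by
    cases a with
    | eq t' n' =>
      refine ⟨ns.map (cov t' n'), .atom, by simp [tokens], ?_, by simp⟩
      intro n'' h
      cases h
      rfl
    | neg b => exact ⟨[], .neg, by simp [tokens], by simp, by simp⟩
    | or b c => exact ⟨[], .or, by simp [tokens], by simp, by simp⟩
    | bel k b => exact ha.elim
  rw [htok, List.append_assoc] at hm
  by_cases hsame : (Letter.cell (cov t n a)).same = true
  · obtain ⟨n', rfl⟩ := same_cov.1 hsame
    have h := hcs n' rfl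
    simp only [columnCode, hsame, if_true]
    refine ((Exec.push _ _ _).seq ((exec_copyRow (l := cs) (rest := [.tok tok] ++ rest) ?_ ?_).seq
      ((Exec.popSome (a := .tok tok) (l := rest) ?_ (.push _ _ _)).seq (.push _ _ _)))).to ?_ ?_
    · simpa using hm
    · simp [Letter.isCell]
    · simp
    · rw [htok]
      funext k
      cases k <;> simp [namedChoices, choiceLetters, h]
    · omega
  · have h : namedChoices [a] t = [] := by
      cases a with
      | eq t' n' =>
        have : t ≠ t' := by
          rintro rfl
          exact hsame (same_cov.2 ⟨n', rfl⟩)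
        simp [namedChoices, this]
      | _ => rfl
    simp only [columnCode, hsame]
    refine ((Exec.push _ _ _).seq ((exec_move (l := cs.map Letter.cell)
      (rest := [.tok tok] ++ rest) (by decide) id ?_ ?_ ?_).seq
      (Exec.popSome (a := .tok tok) (l := rest) ?_ (.push _ _ _)))).to ?_ ?_
    · simpa using hm
    · simp [Letter.isCell]
    · simp [Letter.isCell]
    · simp
    · rw [htok]
      funext k
      cases k <;> simp [h]
    · simp only [List.length_map]; omega

theorem exec_columnLoop {s : Regs} {t : FunTerm} {n : Name} {l : List Formula}
    (hl : ∀ a ∈ l, a.Objective)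
    (ht2 : s .t2 = l.map fun a => .cell (cov t n a)) (hm : s .m = stream ns l) :
    Exec (.foreach .t2 (fun _ => true) columnCode) s
      (update (update (update (update (update s .t2 []) .m [])
        .t1 ((l.map fun a => .cell (cov t n a)).reverse ++ s .t1))
        .mt ((stream ns l).reverse ++ s .mt))
        .c (((namedChoices l t).flatMap (choiceLetters ns false)).reverse ++ s .c))
      (l.length * (3 * ns.length + 6) + 1) := by
  induction l generalizing s with
  | nil =>
    refine (Exec.done (by simp [ht2])).to ?_ (by simp)
    funext k
    cases k <;> simp_all [stream, namedChoices]
  | cons a l ih =>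
    have hcons : namedChoices (a :: l) t = namedChoices [a] t ++ namedChoices l t := by
      simp only [namedChoices, ← List.filterMap_append, List.singleton_append]
    refine (Exec.step ht2 rfl (exec_columnCode (ns := ns) (rest := stream ns l) (hl a (by simp)) ?_)
      (ih ?_ ?_ ?_)).to ?_ ?_
    · simpa [stream] using hm
    · exact fun b hb => hl b (by simp [hb])
    · simp
    · simp
    · funext k
      cases k <;> simp [hcons, stream]
    · simp only [List.length_cons]; nlinarith

theorem cov_f_eq (t : FunTerm) (n m : Name) (a : Formula) : (cov t n a).f = (cov t m a).f := by
  induction a with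
  | eq t' n' => simp [cov, Cell.ofRel]
  | neg a ih => simp [cov, Cell.neg, ih]
  | or a b iha ihb => simp [cov, Cell.or, iha, ihb]
  | bel k a => rfl

theorem exec_groupCode {s : Regs} {t : FunTerm} {n : Name} (hobj : ∀ a ∈ ns, a.Objective)
    (ht1 : s .t1 = (ns.map fun a => .cell (cov t n a)).reverse) (ht2 : s .t2 = [])
    (hm : s .m = stream ns ns) (hmt : s .mt = []) :
    Exec groupCode s
      (update (update (update s .t1 []) .g (.sep :: s .g))
        .c ((choicesLetters ns [t]).reverse ++ s .c)) (20 * (ns.length + 1) ^ 2) := by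
  refine ((exec_moveAll (by decide) ht1).seq ((Exec.push _ _ _).seq
    ((exec_columnLoop (ns := ns) (t := t) (n := n) (l := ns) hobj ?_ ?_).seq
    ((exec_moveAll (l := (stream ns ns).reverse) (by decide) ?_).seq
    ((exec_moveAll (l := (ns.map fun a => .cell (cov t n a)).reverse) (by decide) ?_).seq
    ((exec_move (l := ns.map fun a => .cell (cov t n a)) (rest := []) (by decide) _ ?_ ?_ ?_).seq
    (.push _ _ _))))))).to ?_ ?_
  · simp [ht2]
  · simp [hm]
  · simp [hmt]
  · simp
  · simp
  · simp
  · simp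
  · have h : ∀ a, (cov t n a).f = (cov t 0 a).f := cov_f_eq t n 0
    funext k
    cases k <;> simp [ht2, hm, hmt, choicesLetters, choiceLetters, otherChoice, Letter.getCell, h]
  · have h₁ := length_stream_le ns ns
    simp only [List.length_reverse, List.length_map]
    nlinarith

/-- Processing of a letter of the stream, for the list of choices. -/
def choiceCode : Letter → Code
  | .cell c => .push .t1 (.cell c)
  | .tok .atom => seenCode ⨟ .popCase .fl fun o => match o with
      | some (.bit false) => groupCode
      | _ => clear .t1
  | _ => .skip

theorem iter_choiceCode_cells {s : Regs} {l : List Cell} {rest : List Letter}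
    (hs : s .m3 = l.map Letter.cell ++ rest) :
    Iter .m3 (fun _ => true) choiceCode s
      (update (update s .m3 rest) .t1 ((l.map Letter.cell).reverse ++ s .t1)) (2 * l.length) := by
  induction l generalizing s with
  | nil =>
    refine (Iter.refl _).to ?_ (by simp)
    funext k
    cases k <;> simp_all
  | cons x l ih =>
    have h := Exec.push Reg.t1 (Letter.cell x) (update s .m3 (l.map Letter.cell ++ rest))
    refine ((Iter.single (f := choiceCode) (a := .cell x) (l := l.map Letter.cell ++ rest) hs rfl
      h).trans (ih ?_)).to ?_ ?_
    · simp
    · funext k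
      cases k <;> simp
    · simp only [List.length_cons]; omega

/-- Each term contributes its choices when it occurs for the first time. -/
theorem iter_choiceCode {s : Regs} {l : List Formula} {seen : List FunTerm}
    (hobj : ∀ a ∈ ns, a.Objective) (hl : ∀ a ∈ l, a ∈ ns)
    (hm3 : s .m3 = stream ns l) (hm : s .m = stream ns ns) (hmt : s .mt = []) (ht1 : s .t1 = [])
    (ht2 : s .t2 = []) (ht3 : s .t3 = [])
    (hmask : s .mask = ns.map fun a => .bit (termIn seen a)) :
    ∃ mask, Iter .m3 (fun _ => true) choiceCode s
      (update (update (update (update s .m3 []) .mask mask)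
        .g (List.replicate (leaders seen l).length .sep ++ s .g))
        .c ((choicesLetters ns (leaders seen l)).reverse ++ s .c))
      (l.length * (40 * (ns.length + 1) ^ 2)) := by
  induction l generalizing s seen with
  | nil =>
    refine ⟨s .mask, (Iter.refl _).to ?_ (by simp)⟩
    funext k
    cases k <;> simp_all [stream, leaders, choicesLetters]
  | cons a l ih =>
    have hl' : ∀ b ∈ l, b ∈ ns := fun b hb => hl b (by simp [hb])
    have hskip : ∀ x : Kind, tokens ns a = [.tok x] →
        (∀ s' : Regs, Exec (choiceCode (.tok x)) s' s' 1) →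
        leaders seen (a :: l) = leaders seen l → ∃ mask, Iter .m3 (fun _ => true) choiceCode s
          (update (update (update (update s .m3 []) .mask mask)
            .g (List.replicate (leaders seen (a :: l)).length .sep ++ s .g))
            .c ((choicesLetters ns (leaders seen (a :: l))).reverse ++ s .c))
          ((a :: l).length * (40 * (ns.length + 1) ^ 2)) := by
      intro x hx hcode hlead
      obtain ⟨mask, h⟩ := ih (seen := seen) (s := update s .m3 (stream ns l)) hl'
        (by simp) (by simp [hm]) (by simp [hmt]) (by simp [ht1]) (by simp [ht2]) (by simp [ht3])
        (by simp [hmask])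
      refine ⟨mask, ((Iter.single (a := .tok x) (l := stream ns l) ?_ rfl
        (hcode _)).trans h).to ?_ ?_⟩
      · simp [hm3, stream, hx]
      · rw [hlead]
        funext k
        cases k <;> simp
      · have h₁ : 1 ≤ (ns.length + 1) ^ 2 := Nat.one_le_pow _ _ (by omega)
        simp only [List.length_cons, add_mul]
        omega
    cases a with
    | eq t n =>
      have hmem : Formula.eq t n ∈ ns := hl _ (by simp)
      have hcells := iter_choiceCode_cells (s := s) (l := ns.map (cov t n))
        (rest := .tok .atom :: stream ns l) (by rw [hm3]; simp [stream, tokens])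
      by_cases hseen : t ∈ seen
      · obtain ⟨mask, h⟩ := ih (seen := seen) (s := update s .m3 (stream ns l)) hl'
          (by simp) (by simp [hm]) (by simp [hmt]) (by simp [ht1]) (by simp [ht2]) (by simp [ht3])
          (by simp [hmask])
        have htermIn : ∀ a, termIn (t :: seen) a = termIn seen a := by
          intro a
          cases a with
          | eq t' n' =>
            simp only [termIn, List.mem_cons, decide_eq_decide, or_iff_right_iff_imp]
            rintro rfl
            exact hseen
          | _ => rfl
        refine ⟨mask, (hcells.trans ((Iter.single (a := .tok .atom) (l := stream ns l)
          (s₁ := update s .m3 (stream ns l)) (m := 20 * (ns.length + 1)) ?_ rfl ?_).trans h)).to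
          ?_ ?_⟩
        · simp
        · refine ((exec_seenCode (ns := ns) (t := t) (n := n) (seen := seen) hmem ?_ ?_ ?_ ?_).seq
            (Exec.popSome (a := .bit true) (l := s .fl) ?_
              (exec_clearReg (l := (ns.map fun a => .cell (cov t n a)).reverse) ?_))).to ?_ ?_
          · simp [ht1]
          · simp [ht2]
          · simp [ht3]
          · simp [hmask]
          · simp [hseen]
          · simp [ht1]
          · funext k
            cases k <;> simp [ht1, hmask, htermIn]
          · simp only [List.length_reverse, List.length_map]; omega
        · funext k
          cases k <;> simp [leaders, hseen]
        · simp only [List.length_cons, List.length_map]; nlinarith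
      · obtain ⟨mask, h⟩ := ih (seen := t :: seen)
          (s := update (update (update (update s .m3 (stream ns l)) .g (.sep :: s .g))
            .c ((choicesLetters ns [t]).reverse ++ s .c))
            .mask (ns.map fun a => .bit (termIn (t :: seen) a))) hl'
          (by simp) (by simp [hm]) (by simp [hmt]) (by simp [ht1]) (by simp [ht2]) (by simp [ht3])
          (by simp)
        refine ⟨mask, (hcells.trans ((Iter.single (a := .tok .atom) (l := stream ns l)
          (s₁ := _) (m := 20 * (ns.length + 1) ^ 2 + 10 * ns.length + 5) ?_ rfl ?_).trans h)).to
          ?_ ?_⟩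
        · simp
        · refine ((exec_seenCode (ns := ns) (t := t) (n := n) (seen := seen) hmem ?_ ?_ ?_ ?_).seq
            (Exec.popSome (a := .bit false) (l := s .fl) ?_
              (exec_groupCode (t := t) (n := n) hobj ?_ ?_ ?_ ?_))).to ?_ ?_
          · simp [ht1]
          · simp [ht2]
          · simp [ht3]
          · simp [hmask]
          · simp [hseen]
          · simp [ht1]
          · simp [ht2]
          · simp [hm]
          · simp [hmt]
          · funext k
            cases k <;> simp [ht1]
          · omega
        · funext k
          cases k
          case c => simp [leaders, hseen, choicesLetters]
          case g =>
            simp only [update_self, ne_eq, reduceCtorEq, not_false_eq_true, update_of_ne, leaders,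
              hseen, if_false, List.length_cons, List.replicate_succ', List.append_assoc,
              List.cons_append, List.nil_append]
          all_goals simp
        · simp only [List.length_cons, List.length_map]; nlinarith
    | neg b => exact hskip .neg rfl (fun s' => .skip s') rfl
    | or b c => exact hskip .or rfl (fun s' => .skip s') rfl
    | bel k b =>
      have h : (Formula.bel k b).Objective := hobj _ (hl _ (by simp))
      exact h.elim

/-! ### The search -/

/-- Whether the letter is not a separator. -/
def Letter.notSep (x : Letter) : Bool := !decide (x = .sep)

/-- Whether the letter is not the mark of the last choice for a term. -/
def Letter.notLast (x : Letter) : Bool := !decide (x = .bit true)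

/-- Return the verdict `b` on the table on the stack `us`. -/
def retCode (b : Bool) : Code :=
  .foreach .us Letter.notSep (fun _ => .skip) ⨟ pop .us ⨟ .push .r .sep ⨟ .push .ctl (.up b)

/-- Add the choice on the stack `d` to the table on the stack `us`. -/
def addCode : Code :=
  .foreach .d Letter.isPair fun x => .popCase .us fun o => match o with
    | some o => .push .t1 o ⨟ .push .ut (o.addPair x.getPair)
    | none => .skip

/-- Search on with the choice on the stack `d`. -/
def tryCode : Code := addCode ⨟ moveAll .t1 .us ⨟ moveAll .ut .u ⨟ .push .ctl .down

/-- Search on with the first choice for the next term. -/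
def nextCode : Code := .popCase .d fun o => match o with
  | some .sep => retCode false
  | some y => .push .d y ⨟ tryCode
  | none => .skip

/-- Save the table on the stack `us`, and write the choices on the stack `d`. -/
def saveCode : Code :=
  .push .us .sep ⨟ moveAll .u .ut ⨟ moveAll .ut .us ⨟ .push .d .sep ⨟
    (.foreach .c (fun _ => true) fun x => .push .d x ⨟ .push .t1 x) ⨟ moveAll .t1 .c

/-- One step of the search: `down` asks for the verdict on the table on the stack `u`, and `up`
returns a verdict. The letters on the stack `r` count the splits that are left. -/
def searchCode : Letter → Code
  | .down => .popCase .r fun o => match o with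
    | none => leafCode
    | some _ => saveCode ⨟ nextCode
  | .up true => .popCase .d fun o => match o with
    | none => .push .res (.bit true)
    | some (.bit true) => .foreach .d Letter.notSep (fun _ => .skip) ⨟ pop .d ⨟ retCode true
    | some _ => tryCode
  | .up false => .popCase .d fun o => match o with
    | none => .push .res (.bit false)
    | some (.bit true) => nextCode
    | some _ => .foreach .d Letter.notLast (fun _ => .skip) ⨟ pop .d ⨟ nextCode
  | _ => .skip

/-- `Run p s s' n`: the program `p`, followed by some steps of the search, leads from `s` to `s'` in
at most `n` steps. -/
def Run (p : Code) (s s' : Regs) (n : ℕ) : Prop :=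
  ∃ s₁ a b, Exec p s s₁ a ∧ Iter .ctl (fun _ => true) searchCode s₁ s' b ∧ a + b ≤ n

section

variable {p q : Code} {s s₁ s' : Regs} {m n : ℕ}

theorem Exec.run (h : Exec p s s' n) : Run p s s' n := ⟨s', n, 0, h, .refl _, by omega⟩

theorem Run.seq (h : Exec p s s₁ m) (h' : Run q s₁ s' n) : Run (p ⨟ q) s s' (m + n) := by
  obtain ⟨s₂, a, b, ha, hb, hab⟩ := h'
  exact ⟨s₂, m + a, b, h.seq ha, hb, by omega⟩

theorem Run.popSome {k : Reg} {f : Option Letter → Code} {a : Letter} {l : List Letter}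
    (hs : s k = a :: l) (h : Run (f (some a)) (update s k l) s' n) :
    Run (.popCase k f) s s' (n + 1) := by
  obtain ⟨s₂, a, b, ha, hb, hab⟩ := h
  exact ⟨s₂, a + 1, b, .popSome hs ha, hb, by omega⟩

theorem Run.trans (h : Run p s s₁ m) (h' : Iter .ctl (fun _ => true) searchCode s₁ s' n) :
    Run p s s' (m + n) := by
  obtain ⟨s₂, a, b, ha, hb, hab⟩ := h
  exact ⟨s₂, a, b + n, ha, hb.trans h', by omega⟩

theorem Run.iter {x : Letter} {l : List Letter} (hs : s .ctl = x :: l)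
    (h : Run (searchCode x) (update s .ctl l) s' n) :
    Iter .ctl (fun _ => true) searchCode s s' (n + 1) := by
  obtain ⟨s₂, a, b, ha, hb, hab⟩ := h
  exact (Iter.step hs rfl ha hb).mono (by omega)

theorem Run.mono (h : Run p s s' m) (hmn : m ≤ n) : Run p s s' n := by
  obtain ⟨s₂, a, b, ha, hb, hab⟩ := h
  exact ⟨s₂, a, b, ha, hb, hab.trans hmn⟩

end

/-- The stacks during the search. -/
def searchRegs (s : Regs) (u us d : List Letter) (r : ℕ) (ctl : List Letter) : Regs :=
  update (update (update (update (update s .u u) .us us) .d d) .r (List.replicate r .sep)) .ctl ctl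

theorem notSep_vec {u : Table} : ∀ x ∈ vec ns u, x.notSep = true := by
  simp [vec, Letter.notSep]

variable {s : Regs} {us d ct : List Letter} {r : ℕ} {u : Table}

theorem exec_retCode (b : Bool) :
    Exec (retCode b) (searchRegs s [] (vec ns u ++ .sep :: us) d r ct)
      (searchRegs s [] us d (r + 1) (.up b :: ct)) (2 * ns.length + 5) := by
  refine ((exec_drop (l := vec ns u) (rest := .sep :: us) ?_ notSep_vec ?_).seq
    ((exec_pop (a := .sep) (l := us) ?_).seq ((Exec.push _ _ _).seq (.push _ _ _)))).to ?_ ?_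
  · simp [searchRegs]
  · simp [Letter.notSep]
  · simp
  · funext k
    cases k <;> simp [searchRegs, List.replicate_succ]
  · simp [length_vec]

theorem exec_addCode {s : Regs} {ch : Table} {l : List Formula} {rest us : List Letter}
    (hd : s .d = l.map (fun a => .pair (ch a)) ++ rest)
    (hrest : ∀ x ∈ rest.head?, x.isPair = false) (hus : s .us = vec l u ++ us) :
    Exec addCode s (update (update (update (update s .d rest) .us us)
      .t1 ((vec l u).reverse ++ s .t1))
      .ut ((vec l fun a => por (u a) (ch a)).reverse ++ s .ut)) (4 * l.length + 1) := by
  induction l generalizing s with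
  | nil =>
    refine (Exec.done (by simpa [hd] using hrest)).to ?_ (by simp)
    funext k
    cases k <;> simp_all [vec]
  | cons a l ih =>
    refine (Exec.step hd rfl (Exec.popSome (a := .entry a.kind (u a)) (l := vec l u ++ us) ?_
      ((Exec.push _ _ _).seq (.push _ _ _))) (ih ?_ ?_)).to ?_ ?_
    · simpa [vec] using hus
    · simp
    · simp
    · funext k
      cases k <;> simp [vec, Letter.addPair, Letter.getPair]
    · simp only [List.length_cons]; omega

theorem exec_tryCode {ch : Table} {rest : List Letter}
    (hrest : ∀ x ∈ rest.head?, x.isPair = false) (ht1 : s .t1 = []) (hut : s .ut = []) :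
    Exec tryCode
      (searchRegs s [] (vec ns u ++ .sep :: us) (ns.map (fun a => .pair (ch a)) ++ rest) r ct)
      (searchRegs s (vec ns fun a => por (u a) (ch a)) (vec ns u ++ .sep :: us) rest r
        (.down :: ct)) (8 * ns.length + 4) := by
  refine ((exec_addCode (u := u) (ch := ch) (l := ns) (rest := rest) (us := .sep :: us) ?_ hrest
    ?_).seq ((exec_moveAll (l := (vec ns u).reverse) (by decide) ?_).seq
    ((exec_moveAll (l := (vec ns fun a => por (u a) (ch a)).reverse) (by decide) ?_).seq
    (.push _ _ _)))).to ?_ ?_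
  · simp [searchRegs]
  · simp [searchRegs]
  · simp [searchRegs, ht1]
  · simp [searchRegs, hut]
  · funext k
    cases k <;> simp [searchRegs, ht1, hut]
  · simp only [List.length_reverse, length_vec]; omega

/-- The number of choices for the terms in `l`. -/
def numChoices (ns : List Formula) (l : List FunTerm) : ℕ :=
  (l.map fun t => (namedChoices ns t).length + 1).sum

theorem length_choiceLetters (b : Bool) (ch : Table) :
    (choiceLetters ns b ch).length = ns.length + 1 := by
  simp [choiceLetters]

theorem length_flatMap_choiceLetters (b : Bool) (g : List Table) :
    (g.flatMap (choiceLetters ns b)).length = g.length * (ns.length + 1) := by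
  simp [List.length_flatMap, length_choiceLetters]

theorem length_choicesLetters (l : List FunTerm) :
    (choicesLetters ns l).length = numChoices ns l * (ns.length + 1) := by
  induction l with
  | nil => simp [choicesLetters, numChoices]
  | cons t l ih =>
    simp only [choicesLetters, List.flatMap_cons, List.length_append, numChoices, List.map_cons,
      List.sum_cons] at ih ⊢
    rw [ih, length_flatMap_choiceLetters, length_choiceLetters]
    ring

theorem notSep_choicesLetters {l : List FunTerm} :
    ∀ x ∈ choicesLetters ns l, x.notSep = true := by
  simp only [choicesLetters, choiceLetters, List.mem_flatMap, List.mem_append, List.mem_map,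
    List.mem_singleton]
  rintro x ⟨t, -, ⟨ch, -, ⟨a, -, rfl⟩ | rfl⟩ | ⟨a, -, rfl⟩ | rfl⟩ <;> rfl

/-- Whether all choices for one of the terms in `l` lead to success. -/
def evalTerms (ns : List Formula) (kb q : Formula) (r : ℕ) (u : Table) (l : List FunTerm) : Bool :=
  l.any fun t => (group ns t).all fun ch => eval ns kb q r fun a => por (u a) (ch a)

theorem eval_succ {kb q : Formula} :
    eval ns kb q (r + 1) u = evalTerms ns kb q r u (leaders [] ns) := by
  simp only [eval, evalTerms, groups, List.any_map]
  rfl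

/-- The choices `g` and `last` are those for a term that are left, and `l` are the terms that are
left. If a choice fails, the search goes on with the terms in `l`, where it finds `b`. Skipping
the choices that need not be tried takes two steps per letter; it is paid for by the budgets `15 +
10 * ns.length` of these choices, or by `n`. -/
theorem run_tryCode {kb q : Formula} {T : ℕ} (ht1 : s .t1 = []) (hut : s .ut = [])
    (ih : ∀ u us d ct, Iter .ctl (fun _ => true) searchCode
      (searchRegs s (vec ns u) us d r (.down :: ct))
      (searchRegs s [] us d r (.up (eval ns kb q r u) :: ct)) T)
    (l : List FunTerm) {n : ℕ} {b : Bool}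
    (hn : 2 * (choicesLetters ns l).length + 2 * ns.length + 8 ≤ n)
    (hnext : Run nextCode
      (searchRegs s [] (vec ns u ++ .sep :: us) (choicesLetters ns l ++ .sep :: d) r ct)
      (searchRegs s [] us d (r + 1) (.up b :: ct)) n)
    (g : List Table) (last : Table) :
    Run tryCode
      (searchRegs s [] (vec ns u ++ .sep :: us)
        (g.flatMap (choiceLetters ns false) ++ (choiceLetters ns true last ++
          (choicesLetters ns l ++ .sep :: d))) r ct)
      (searchRegs s [] us d (r + 1)
        (.up (((g ++ [last]).all fun ch => eval ns kb q r fun a => por (u a) (ch a)) || b) :: ct))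
      ((g.length + 1) * (T + 10 * ns.length + 15) + n) := by
  induction g with
  | nil =>
    have htry := exec_tryCode (ns := ns) (s := s) (u := u) (us := us) (r := r) (ct := ct)
      (ch := last) (rest := .bit true :: (choicesLetters ns l ++ .sep :: d))
      (by simp [Letter.isPair]) ht1 hut
    have hst : choiceLetters ns true last ++ (choicesLetters ns l ++ .sep :: d) =
        ns.map (fun a => .pair (last a)) ++ .bit true :: (choicesLetters ns l ++ .sep :: d) := by
      simp [choiceLetters]
    rw [List.flatMap_nil, List.nil_append, List.nil_append, hst]
    have h := htry.run.trans (ih _ _ _ _)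
    have hall : ([last].all fun ch => eval ns kb q r fun a => por (u a) (ch a)) =
        eval ns kb q r fun a => por (u a) (last a) := by simp
    rw [hall]
    cases he : eval ns kb q r fun a => por (u a) (last a) with
    | true =>
      rw [he] at h
      rw [Bool.true_or]
      refine (h.trans (Run.iter (x := .up true) (l := ct) ?_ (Run.popSome (a := .bit true)
        (l := choicesLetters ns l ++ .sep :: d) ?_ (Run.seq (exec_drop (l := choicesLetters ns l)
        (rest := .sep :: d) ?_ notSep_choicesLetters ?_) (Run.seq
        (exec_pop (a := .sep) (l := d) ?_) (n := 2 * ns.length + 5) ?_))))).mono ?_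
      · simp [searchRegs]
      · simp [searchRegs]
      · simp
      · simp [Letter.notSep]
      · simp
      · convert (exec_retCode (ns := ns) (s := s) (us := us) (d := d) (r := r) (ct := ct)
          (u := u) true).run using 1
        funext k
        cases k <;> simp [searchRegs]
      · simp only [List.length_nil]
        omega
    | false =>
      rw [he] at h
      rw [Bool.false_or]
      refine (h.trans (Run.iter (x := .up false) (l := ct) ?_ (Run.popSome (a := .bit true)
        (l := choicesLetters ns l ++ .sep :: d) ?_ (n := n) ?_))).mono ?_
      · simp [searchRegs]
      · simp [searchRegs]
      · convert hnext using 1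
        funext k
        cases k <;> simp [searchRegs]
      · simp only [List.length_nil]
        omega
  | cons ch g ihg =>
    have hnot : ∀ x ∈ g.flatMap (choiceLetters ns false) ++
        ns.map (fun a => Letter.pair (last a)), x.notLast = true := by
      simp only [choiceLetters, List.mem_flatMap, List.mem_append, List.mem_map,
        List.mem_singleton]
      rintro x (⟨ch, -, ⟨a, -, rfl⟩ | rfl⟩ | ⟨a, -, rfl⟩) <;> rfl
    generalize hrest : g.flatMap (choiceLetters ns false) ++ (choiceLetters ns true last ++
      (choicesLetters ns l ++ .sep :: d)) = rest at ihg
    have htry := exec_tryCode (ns := ns) (s := s) (u := u) (us := us) (r := r) (ct := ct)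
      (ch := ch) (rest := .bit false :: rest) (by simp [Letter.isPair]) ht1 hut
    have hst : (ch :: g).flatMap (choiceLetters ns false) ++ (choiceLetters ns true last ++
        (choicesLetters ns l ++ .sep :: d)) =
        ns.map (fun a => .pair (ch a)) ++ .bit false :: rest := by
      rw [List.flatMap_cons, List.append_assoc, hrest]
      simp [choiceLetters]
    rw [hst]
    have h := htry.run.trans (ih _ _ _ _)
    have hall : ((ch :: g ++ [last]).all fun ch => eval ns kb q r fun a => por (u a) (ch a)) =
        ((eval ns kb q r fun a => por (u a) (ch a)) &&
          (g ++ [last]).all fun ch => eval ns kb q r fun a => por (u a) (ch a)) := by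
      simp
    rw [hall]
    cases he : eval ns kb q r fun a => por (u a) (ch a) with
    | true =>
      rw [he] at h
      rw [Bool.true_and]
      refine (h.trans (Run.iter (x := .up true) (l := ct) ?_ (Run.popSome (a := .bit false)
        (l := rest) ?_ (n := (g.length + 1) * (T + 10 * ns.length + 15) + n) ?_))).mono ?_
      · simp [searchRegs]
      · simp [searchRegs]
      · convert ihg using 1
        funext k
        cases k <;> simp [searchRegs]
      · simp only [List.length_cons]
        nlinarith
    | false =>
      rw [he] at h
      rw [Bool.false_and, Bool.false_or]
      refine (h.trans (Run.iter (x := .up false) (l := ct) ?_ (Run.popSome (a := .bit false)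
        (l := rest) ?_ (Run.seq (exec_drop (l := g.flatMap (choiceLetters ns false) ++
        ns.map (fun a => Letter.pair (last a)))
        (rest := .bit true :: (choicesLetters ns l ++ .sep :: d)) ?_ hnot ?_) (Run.seq
        (exec_pop (a := .bit true) (l := choicesLetters ns l ++ .sep :: d) ?_) (n := n) ?_))))).mono
        ?_
      · simp [searchRegs]
      · simp [searchRegs]
      · simp [← hrest, choiceLetters]
      · simp [Letter.notLast]
      · simp
      · convert hnext using 1
        funext k
        cases k <;> simp [searchRegs]
      · simp only [List.length_cons, List.length_append, length_flatMap_choiceLetters,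
          List.length_map]
        nlinarith

/-- The search tries the terms in `l` one after the other, if it returns verdicts on tables with one
split less. -/
theorem run_nextCode {kb q : Formula} {T : ℕ} (ht1 : s .t1 = []) (hut : s .ut = [])
    (hpos : 0 < ns.length)
    (ih : ∀ u us d ct, Iter .ctl (fun _ => true) searchCode
      (searchRegs s (vec ns u) us d r (.down :: ct))
      (searchRegs s [] us d r (.up (eval ns kb q r u) :: ct)) T)
    (l : List FunTerm) :
    Run nextCode
      (searchRegs s [] (vec ns u ++ .sep :: us) (choicesLetters ns l ++ .sep :: d) r ct)
      (searchRegs s [] us d (r + 1) (.up (evalTerms ns kb q r u l) :: ct))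
      (numChoices ns l * (T + 10 * ns.length + 17) + (2 * ns.length + 8)) := by
  induction l with
  | nil =>
    have hnil : evalTerms ns kb q r u [] = false := rfl
    rw [hnil]
    refine (Run.popSome (a := .sep) (l := d) ?_ (n := 2 * ns.length + 5) ?_).mono ?_
    · simp [searchRegs, choicesLetters]
    · convert (exec_retCode (ns := ns) (s := s) (us := us) (d := d) (r := r) (ct := ct)
        (u := u) false).run using 1
      funext k
      cases k <;> simp [searchRegs]
    · simp [numChoices]
  | cons t l ihl =>
    have hall : evalTerms ns kb q r u (t :: l) =
        (((namedChoices ns t ++ [otherChoice t]).all fun ch =>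
          eval ns kb q r fun a => por (u a) (ch a)) || evalTerms ns kb q r u l) := by
      simp only [evalTerms, List.any_cons, group]
    have htry := run_tryCode ht1 hut ih l (by rw [length_choicesLetters]; nlinarith) ihl
      (namedChoices ns t) (otherChoice t)
    have hst : choicesLetters ns (t :: l) ++ .sep :: d =
        (namedChoices ns t).flatMap (choiceLetters ns false) ++
          (choiceLetters ns true (otherChoice t) ++ (choicesLetters ns l ++ .sep :: d)) := by
      simp [choicesLetters]
    rw [hall, hst]
    obtain ⟨p, tl, hp⟩ : ∃ p tl, (namedChoices ns t).flatMap (choiceLetters ns false) ++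
          (choiceLetters ns true (otherChoice t) ++ (choicesLetters ns l ++ .sep :: d)) =
          .pair p :: tl := by
      obtain ⟨a, ns', rfl⟩ := List.exists_cons_of_length_pos hpos
      cases namedChoices (a :: ns') t with
      | nil => exact ⟨_, _, rfl⟩
      | cons ch g => exact ⟨_, _, rfl⟩
    rw [hp] at htry ⊢
    refine (Run.popSome (a := .pair p) (l := tl) ?_ (Run.seq (.push _ _ _)
      (n := ((namedChoices ns t).length + 1) * (T + 10 * ns.length + 15) +
        (numChoices ns l * (T + 10 * ns.length + 17) + (2 * ns.length + 8))) ?_)).mono ?_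
    · simp [searchRegs]
    · convert htry using 1
      funext k
      cases k <;> simp [searchRegs]
    · simp only [numChoices, List.map_cons, List.sum_cons]
      nlinarith

theorem exec_copyChoices {s : Regs} {l : List Letter} (hs : s .c = l) :
    Exec (.foreach .c (fun _ => true) fun x => .push .d x ⨟ .push .t1 x) s
      (update (update (update s .c []) .d (l.reverse ++ s .d)) .t1 (l.reverse ++ s .t1))
      (3 * l.length + 1) := by
  induction l generalizing s with
  | nil =>
    refine (Exec.done (by simp [hs])).to ?_ (by simp)
    funext k
    cases k <;> simp_all
  | cons x l ih =>
    refine (Exec.step hs rfl ((Exec.push _ _ _).seq (.push _ _ _)) (ih ?_)).to ?_ ?_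
    · simp
    · funext k
      cases k <;> simp
    · simp only [List.length_cons]; omega

theorem exec_saveCode {l : List Letter} (hc : s .c = l.reverse) (ht1 : s .t1 = [])
    (hut : s .ut = []) :
    Exec saveCode (searchRegs s (vec ns u) us d r ct)
      (searchRegs s [] (vec ns u ++ .sep :: us) (l ++ .sep :: d) r ct)
      (4 * ns.length + 5 * l.length + 6) := by
  refine ((Exec.push _ _ _).seq ((exec_moveAll (l := vec ns u) (by decide) ?_).seq
    ((exec_moveAll (l := (vec ns u).reverse) (by decide) ?_).seq ((Exec.push _ _ _).seq
    ((exec_copyChoices (l := l.reverse) ?_).seq (exec_moveAll (l := l) (by decide) ?_)))))).to ?_ ?_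
  · simp [searchRegs]
  · simp [searchRegs, hut]
  · simp [searchRegs, hc]
  · simp [searchRegs, ht1]
  · funext k
    cases k <;> simp [searchRegs, hc, ht1, hut]
  · simp only [List.length_reverse, length_vec]; omega

/-- The number of steps of the search with `r` splits, if a split has `D` choices. -/
def searchTime (ns : List Formula) (D : ℕ) : ℕ → ℕ
  | 0 => 50 * (ns.length + 1) ^ 3 + 2
  | r + 1 => D * (searchTime ns D r + 15 * ns.length + 22) + 6 * ns.length + 17

/-- The search returns the verdict on the table on the stack `u`, and restores all other stacks. -/
theorem iter_searchCode {kb q : Formula} (hkb : kb.Objective) (hq : q.Objective)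
    (hns : ns = q.nodes ++ kb.nodes) (hpos : 0 < ns.length)
    (hm : s .m = stream ns ns) (hc : s .c = (choicesLetters ns (leaders [] ns)).reverse)
    (hmt : s .mt = []) (hut : s .ut = []) (hv : s .v = []) (hn : s .n = []) (ht1 : s .t1 = [])
    (ht2 : s .t2 = []) :
    Iter .ctl (fun _ => true) searchCode (searchRegs s (vec ns u) us d r (.down :: ct))
      (searchRegs s [] us d r (.up (eval ns kb q r u) :: ct))
      (searchTime ns (numChoices ns (leaders [] ns)) r) := by
  induction r generalizing u us d ct with
  | zero =>
    refine (Iter.single (a := .down) (l := ct) ?_ rfl (Exec.popNone ?_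
      (exec_leafCode hkb hq hns (u := u) ?_ ?_ ?_ ?_ ?_ ?_ ?_ ?_))).to ?_ ?_
    · simp [searchRegs]
    · simp [searchRegs]
    · simp [searchRegs, hn]
    · simp [searchRegs, hm]
    · simp [searchRegs, hmt]
    · simp [searchRegs, hv]
    · simp [searchRegs, ht1]
    · simp [searchRegs, ht2]
    · simp [searchRegs]
    · simp [searchRegs, hut]
    · funext k
      cases k <;> simp [searchRegs, eval]
    · simp [searchTime]
  | succ r ih =>
    have h := run_nextCode (us := us) (d := d) (ct := ct) (u := u) ht1 hut hpos
      (fun u us d ct => ih (u := u) (us := us) (d := d) (ct := ct)) (leaders [] ns)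
    rw [eval_succ]
    refine (Run.iter (x := .down) (l := ct) ?_ (Run.popSome (a := .sep)
      (l := List.replicate r .sep) ?_ (Run.seq
      (m := 4 * ns.length + 5 * (choicesLetters ns (leaders [] ns)).length + 6) ?_ h))).mono ?_
    · simp [searchRegs]
    · simp [searchRegs, List.replicate_succ]
    · convert exec_saveCode (ns := ns) (us := us) (d := d) (u := u) (r := r) (ct := ct) hc ht1 hut
        using 1
      funext k
      cases k <;> simp [searchRegs]
    · rw [length_choicesLetters]
      simp only [searchTime]
      nlinarith

/-- The number of atoms in a list of formulas. -/
def numAtoms (l : List Formula) : ℕ := l.countP fun a => decide (a.kind = .atom)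

theorem sum_length_namedChoices_le {ts : List FunTerm} (hts : ts.Nodup) (l : List Formula) :
    (ts.map fun t => (namedChoices l t).length).sum ≤ numAtoms l := by
  induction l with
  | nil => simp [namedChoices]
  | cons a l ih =>
    cases a with
    | eq t n =>
      have h : ∀ t', (namedChoices (.eq t n :: l) t').length =
          (if t' = t then 1 else 0) + (namedChoices l t').length := by
        intro t'
        by_cases ht : t' = t
        · simp [namedChoices, ht, add_comm]
        · simp [namedChoices, ht]
      have h₁ : (ts.map fun t' => if t' = t then 1 else 0).sum ≤ 1 := by
        have hcount : (ts.map fun t' => if t' = t then 1 else 0).sum = ts.count t := by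
          clear hts ih
          induction ts with
          | nil => rfl
          | cons t' ts iht => simp [List.count_cons, iht, add_comm]
        exact hcount ▸ List.nodup_iff_count_le_one.1 hts t
      have h₂ : numAtoms (.eq t n :: l) = numAtoms l + 1 := by simp [numAtoms, Formula.kind]
      simp only [h, List.sum_map_add]
      omega
    | _ => exact ih

theorem length_leaders_le (seen : List FunTerm) (l : List Formula) :
    (leaders seen l).length ≤ numAtoms l := by
  induction l generalizing seen with
  | nil => simp [leaders]
  | cons a l ih =>
    cases a with
    | eq t n =>
      have h₂ : numAtoms (.eq t n :: l) = numAtoms l + 1 := by simp [numAtoms, Formula.kind]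
      have h₃ := ih seen
      have h₄ := ih (t :: seen)
      simp only [leaders]
      split
      · omega
      · simp only [List.length_cons]; omega
    | _ => exact ih seen

/-- There is a choice for each atom, and one more for each term. -/
theorem numChoices_leaders_le (ns : List Formula) :
    numChoices ns (leaders [] ns) ≤ 2 * numAtoms ns := by
  have h₁ := sum_length_namedChoices_le (nodup_leaders ns []) ns
  have h₂ := length_leaders_le [] ns
  simp only [numChoices, List.sum_map_add, List.map_const', List.sum_replicate, smul_eq_mul]
  omega

/-- The string of an atom contains the symbols `fn` and `eq`. -/
theorem numAtoms_nodes_le {a : Formula} (ha : a.Objective) : 2 * numAtoms a.nodes ≤ a.length := by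
  induction a with
  | eq t n =>
    simp only [numAtoms, Formula.nodes, Formula.kind, Formula.length, Formula.encode,
      FunTerm.encode, List.length_append, List.length_cons, List.countP_cons, List.countP_nil]
    simp only [decide_true, if_true]
    omega
  | neg a ih =>
    have := ih ha
    simp only [numAtoms, Formula.nodes, Formula.length, Formula.encode, List.countP_append,
      List.length_cons, List.countP_cons, List.countP_nil, Formula.kind] at this ⊢
    simp only [reduceCtorEq, decide_false, Bool.false_eq_true, if_false]
    omega
  | or a b iha ihb =>
    have := iha ha.1
    have := ihb ha.2
    simp only [numAtoms, Formula.nodes, Formula.length, Formula.encode, List.countP_append,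
      List.length_cons, List.length_append, List.countP_cons, List.countP_nil,
      Formula.kind] at *
    simp only [reduceCtorEq, decide_false, Bool.false_eq_true, if_false]
    omega
  | bel k a => exact ha.elim

/-- The number of choices for a split is at most `L`. The factor 2 absorbs the time that is spent
outside the recursive calls. -/
theorem searchTime_le {D L : ℕ} (hD : D ≤ L) (hL : 1 ≤ L) (r : ℕ) :
    searchTime ns D r + 15 * ns.length + 22 ≤ (2 * L) ^ r * (150 * (ns.length + 1) ^ 3) := by
  have h₁ : ns.length + 1 ≤ (ns.length + 1) ^ 3 := Nat.le_self_pow (by omega) _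
  induction r with
  | zero =>
    simp only [searchTime, pow_zero, one_mul]
    omega
  | succ r ih =>
    have h₂ : 1 ≤ (2 * L) ^ r := Nat.one_le_pow _ _ (by omega)
    have h₃ : 1 * (150 * (ns.length + 1) ^ 3) ≤
        L * ((2 * L) ^ r * (150 * (ns.length + 1) ^ 3)) := by
      rw [← mul_assoc L]
      exact Nat.mul_le_mul_right _ (Nat.mul_pos hL h₂)
    have h₄ := Nat.mul_le_mul hD ih
    have h₅ : (2 * L) ^ (r + 1) * (150 * (ns.length + 1) ^ 3) =
        2 * (L * ((2 * L) ^ r * (150 * (ns.length + 1) ^ 3))) := by ring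
    rw [h₅, searchTime]
    omega

/-! ### The whole machine -/

/-- Test the first `m` letters of a stack, and write the result on the stack `fl`. -/
def testCode (k : Reg) : ℕ → (List Letter → Bool) → Code
  | 0, P => .push .fl (.bit (P []))
  | m + 1, P => .popCase k fun o => match o with
    | none => .push .fl (.bit (P []))
    | some x => testCode k m (fun l => P (x :: l)) ⨟ .push k x

theorem exec_testCode {k : Reg} (hk : k ≠ .fl) (m : ℕ) (P : List Letter → Bool) (s : Regs) :
    Exec (testCode k m P) s (update s .fl (.bit (P ((s k).take m)) :: s .fl)) (2 * m + 1) := by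
  induction m generalizing P s with
  | zero => exact (Exec.push _ _ _).to (by simp) (by omega)
  | succ m ih =>
    cases hs : s k with
    | nil => exact (Exec.popNone hs (.push _ _ _)).to (by simp) (by omega)
    | cons x l =>
      refine (Exec.popSome hs ((ih _ _).seq (.push _ _ _))).to ?_ (by omega)
      funext j
      by_cases hj : j = k
      · subst hj; simp [hk, hs]
      · by_cases hf : j = .fl
        · subst hf; simp [hj]
        · simp [hj, hf]

/-- The number that is written in binary, least significant bit first. -/
def bitsValue : List Bool → ℕ
  | [] => 0
  | b :: l => b.toNat + 2 * bitsValue l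

theorem bitsValue_encodePosNum (p : PosNum) :
    bitsValue (Computability.encodePosNum p) = (p : ℕ) ∧
      (Computability.encodePosNum p).length ≤ (p : ℕ) := by
  induction p with
  | one => simp [Computability.encodePosNum, bitsValue]
  | bit1 p ih =>
    simp only [Computability.encodePosNum, bitsValue, PosNum.cast_bit1, List.length_cons,
      Bool.toNat_true]
    omega
  | bit0 p ih =>
    have := PosNum.cast_pos (α := ℕ) p
    simp only [Computability.encodePosNum, bitsValue, PosNum.cast_bit0, List.length_cons,
      Bool.toNat_false]
    omega

theorem bitsValue_encodeNat (n : ℕ) :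
    bitsValue (Computability.encodeNat n) = n ∧ (Computability.encodeNat n).length ≤ n := by
  have h : ((n : Num) : ℕ) = n := Num.to_of_nat n
  unfold Computability.encodeNat
  cases hn : (n : Num) with
  | zero =>
    rw [hn] at h
    simp [Computability.encodeNum, bitsValue, ← h]
  | pos p =>
    rw [hn] at h
    have := bitsValue_encodePosNum p
    simp only [Num.cast_pos] at h
    rw [h] at this
    exact this

/-- Bits, as they are stored on a stack. -/
def bitLetters (l : List Bool) : List Letter := l.map fun b => .sym (.bit b)

/-- Decrement the number on the stack `b`, and push a letter on the stack `r` unless the number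
was zero. -/
def decrementCode : Code :=
  move .b .t1 (fun x => decide (x = .sym (.bit false))) (fun _ => .sym (.bit true)) ⨟
    .popCase .b fun o => match o with
      | some _ => .push .b (.sym (.bit false)) ⨟ moveAll .t1 .b ⨟ .push .r .sep
      | none => move .t1 .b (fun _ => true) fun _ => .sym (.bit false)

theorem bitsValue_replicate_append (i : ℕ) (l : List Bool) :
    bitsValue (List.replicate i false ++ true :: l) =
      bitsValue (List.replicate i true ++ false :: l) + 1 := by
  induction i with
  | zero => simp [bitsValue]; omega
  | succ i ih =>
    simp only [List.replicate_succ, List.cons_append, bitsValue, ih, Bool.toNat_false,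
      Bool.toNat_true]
    omega

theorem bitsValue_replicate_false (i : ℕ) : bitsValue (List.replicate i false) = 0 := by
  induction i with
  | zero => rfl
  | succ i ih => simp [List.replicate_succ, bitsValue, ih]

theorem exec_decrementCode {s : Regs} {l : List Bool} (hb : s .b = bitLetters l)
    (ht1 : s .t1 = []) :
    ∃ l' : List Bool, l'.length = l.length ∧ bitsValue l' = bitsValue l - 1 ∧
      Exec decrementCode s (update (update s .b (bitLetters l'))
        .r ((if bitsValue l = 0 then [] else [.sep]) ++ s .r)) (4 * l.length + 10) := by
  obtain ⟨i, rfl | ⟨l, rfl⟩⟩ : ∃ i, l = List.replicate i false ∨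
      ∃ l', l = List.replicate i false ++ true :: l' := by
    clear hb
    induction l with
    | nil => exact ⟨0, .inl rfl⟩
    | cons b l ih =>
      cases b with
      | true => exact ⟨0, .inr ⟨l, rfl⟩⟩
      | false =>
        obtain ⟨i, rfl | ⟨l', rfl⟩⟩ := ih
        · exact ⟨i + 1, .inl rfl⟩
        · exact ⟨i + 1, .inr ⟨l', rfl⟩⟩
  · have h₀ := bitsValue_replicate_false i
    refine ⟨List.replicate i false, rfl, by omega, ?_⟩
    refine ((exec_move (l := bitLetters (List.replicate i false)) (rest := []) (by decide) _ ?_ ?_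
      ?_).seq (Exec.popNone ?_ (exec_move (l := List.replicate i (.sym (.bit true))) (rest := [])
      (by decide) _ ?_ ?_ ?_))).to ?_ ?_
    · simp [hb]
    · simp [bitLetters]
    · simp
    · simp
    · simp [bitLetters, ht1]
    · simp
    · simp
    · funext k
      cases k <;> simp [bitLetters, ht1, h₀]
    · simp [bitLetters]; omega
  · have h₁ := bitsValue_replicate_append i l
    have h₀ : ¬ bitsValue (List.replicate i false ++ true :: l) = 0 := by omega
    refine ⟨List.replicate i true ++ false :: l, by simp, by omega, ?_⟩
    refine ((exec_move (l := bitLetters (List.replicate i false))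
      (rest := .sym (.bit true) :: bitLetters l) (by decide) _ ?_ ?_ ?_).seq
      (Exec.popSome (a := .sym (.bit true)) (l := bitLetters l) ?_ ((Exec.push _ _ _).seq
      ((exec_moveAll (l := List.replicate i (.sym (.bit true))) (by decide) ?_).seq
      (.push _ _ _))))).to ?_ ?_
    · simp [hb, bitLetters]
    · simp [bitLetters]
    · simp
    · simp
    · simp [bitLetters, ht1]
    · funext k
      cases k <;> simp [bitLetters, ht1, h₀]
    · simp [bitLetters]; omega

/-- The level `bitsValue l` is decremented once for each of the `j` terms, and a letter is pushed on
the stack `r` until it is zero. -/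
theorem exec_depthLoop {s : Regs} {l : List Bool} {j : ℕ} (hg : s .g = List.replicate j .sep)
    (hb : s .b = bitLetters l) (ht1 : s .t1 = []) :
    ∃ b, Exec (.foreach .g (fun _ => true) fun _ => decrementCode) s
      (update (update (update s .g []) .b b)
        .r (List.replicate (min (bitsValue l) j) .sep ++ s .r))
      (j * (4 * l.length + 11) + 1) := by
  induction j generalizing s l with
  | zero =>
    refine ⟨s .b, (Exec.done (by simp [hg])).to ?_ (by simp)⟩
    funext k
    cases k <;> simp_all
  | succ j ih =>
    obtain ⟨l', hlen, hval, h⟩ := exec_decrementCode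
      (s := update s .g (List.replicate j .sep)) (l := l) (by simp [hb]) (by simp [ht1])
    obtain ⟨b, h'⟩ := ih (s := update (update (update s .g (List.replicate j .sep))
      .b (bitLetters l')) .r ((if bitsValue l = 0 then [] else [.sep]) ++
        update s .g (List.replicate j .sep) .r)) (l := l')
      (by simp) (by simp) (by simp [ht1])
    refine ⟨b, (Exec.step (a := .sep) (l := List.replicate j .sep) hg rfl h h').to ?_ ?_⟩
    · funext k
      cases k
      case r =>
        rw [hval]
        by_cases h₀ : bitsValue l = 0
        · simp [h₀]
        · have : min (bitsValue l) (j + 1) = min (bitsValue l - 1) j + 1 := by omega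
          simp only [h₀, if_false, this, List.replicate_succ', update_self, List.append_assoc,
            ne_eq, reduceCtorEq, not_false_eq_true, update_of_ne]
      all_goals simp
    · rw [hlen]; ring_nf; omega

/-- Prepare the search. -/
def prepareCode : Code :=
  loadCode ⨟ tableCode ⨟ .foreach .m3 (fun _ => true) choiceCode

/-- Start the search if the test has succeeded. -/
def answerCode : Option Letter → Code
  | some (.bit true) => (.foreach .g (fun _ => true) fun _ => decrementCode) ⨟
      .push .ctl .down ⨟ .foreach .ctl (fun _ => true) searchCode
  | _ => .push .res (.bit false)

/-- Decide the question, provided that the first `m` letters of the stack `k` satisfy `P`. -/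
def mainCode (k : Reg) (m : ℕ) (P : List Letter → Bool) : Code :=
  prepareCode ⨟ testCode k m P ⨟ .popCase .fl answerCode

theorem objective_of_mem_nodes {a b : Formula} (ha : a.Objective) (hb : b ∈ a.nodes) :
    b.Objective := by
  induction a with
  | eq t n =>
    simp only [Formula.nodes, List.mem_singleton] at hb
    subst hb
    trivial
  | neg a ih =>
    simp only [Formula.nodes, List.mem_append, List.mem_singleton] at hb
    rcases hb with hb | rfl
    · exact ih ha hb
    · exact ha
  | or a a' ih ih' =>
    simp only [Formula.nodes, List.mem_append, List.mem_singleton] at hb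
    rcases hb with hb | hb | rfl
    · exact ih' ha.2 hb
    · exact ih ha.1 hb
    · exact ha
  | bel k a => exact ha.elim

theorem length_nodes_pos {a : Formula} (ha : a.Objective) : 0 < a.nodes.length := by
  cases a with
  | bel k a => exact ha.elim
  | _ => simp [Formula.nodes]

/-- The stacks after the preparation of the search. -/
def preparedRegs (x : Instance) (mask : List Letter) : Regs := fun k => match k with
  | .w => x.query.letters ++ x.kb.letters
  | .m => stream x.nodes x.nodes
  | .u => vec x.nodes fun _ => (false, false)
  | .b => bitLetters (Computability.encodeNat x.level)
  | .c => (choicesLetters x.nodes (leaders [] x.nodes)).reverse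
  | .g => List.replicate (leaders [] x.nodes).length .sep
  | .mask => mask
  | _ => []

theorem exec_prepare (x : Instance) : ∃ mask, Exec prepareCode
    (update (fun _ => []) .inp (x.encode.reverse.map Letter.sym)) (preparedRegs x mask)
    (100 * (x.kb.length + x.query.length + 1) ^ 3 + 10 * (encodeNum x.level).length + 60) := by
  have hkb : x.kb.Objective := x.kb_cnf.objective
  have hq := x.query_objective
  have hobj : ∀ a ∈ x.nodes, a.Objective := by
    intro a ha
    rcases List.mem_append.1 ha with ha | ha
    · exact objective_of_mem_nodes hq ha
    · exact objective_of_mem_nodes hkb ha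
  obtain ⟨mask, h⟩ := iter_choiceCode (ns := x.nodes) (l := x.nodes) (seen := [])
    (s := fun k => match k with
      | .w => x.query.letters ++ x.kb.letters
      | .m => stream x.nodes x.nodes
      | .m3 => stream x.nodes x.nodes
      | .u => vec x.nodes fun _ => (false, false)
      | .b => bitLetters (Computability.encodeNat x.level)
      | .mask => x.nodes.map fun _ => .bit false
      | _ => []) hobj (fun _ h => h) rfl rfl rfl rfl rfl rfl
      (List.map_congr_left fun a _ => by cases a <;> simp [termIn])
  refine ⟨mask, ((exec_loadCode (x := x) hkb ?_ ?_ ?_ ?_ ?_ ?_).seq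
    (((exec_tableCode (ns := x.nodes) hkb hq rfl ?_ ?_ ?_ ?_ ?_ ?_ ?_ ?_ ?_ ?_ ?_ ?_).to ?_
      le_rfl).seq (h.finish ?_))).to ?_ ?_⟩
  all_goals try simp
  · funext k
    cases k <;> simp [bitLetters, encodeNum]
  · funext k
    cases k <;> simp [preparedRegs]
  · have h₁ := length_nodes_le hkb
    have h₂ := length_nodes_le hq
    have h₃ : x.nodes.length = x.query.nodes.length + x.kb.nodes.length := List.length_append
    rw [length_encode]
    generalize hL : x.kb.length + x.query.length = L at *
    have h₄ : x.nodes.length ≤ L := by omega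
    have h₅ : x.nodes.length * (40 * (x.nodes.length + 1) ^ 2) ≤ L * (40 * (L + 1) ^ 2) := by
      gcongr
    nlinarith

/-- The search answers the question on the instance that has been loaded. -/
theorem exec_search (x : Instance) {s : Regs} (hm : s .m = stream x.nodes x.nodes)
    (hc : s .c = (choicesLetters x.nodes (leaders [] x.nodes)).reverse)
    (hu : s .u = vec x.nodes fun _ => (false, false)) (hr : s .r = List.replicate x.depth .sep)
    (hctl : s .ctl = [.down]) (hus : s .us = []) (hd : s .d = []) (hres : s .res = [])
    (hmt : s .mt = []) (hut : s .ut = []) (hv : s .v = []) (hn : s .n = []) (ht1 : s .t1 = [])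
    (ht2 : s .t2 = []) : ∃ b s', Exec (.foreach .ctl (fun _ => true) searchCode) s s'
      ((2 * (x.kb.length + x.query.length)) ^ x.depth *
        (150 * (x.kb.length + x.query.length + 1) ^ 3) + 5) ∧
      s' .res = [.bit b] ∧ (b = true ↔ x.Holds) := by
  have hkb : x.kb.Objective := x.kb_cnf.objective
  have hq := x.query_objective
  have h₁ := length_nodes_le hkb
  have h₂ := length_nodes_le hq
  have h₃ : x.nodes.length = x.query.nodes.length + x.kb.nodes.length := List.length_append
  have h₄ := length_nodes_pos hq
  have h := iter_searchCode (ns := x.nodes) (kb := x.kb) (q := x.query) (us := []) (d := [])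
    (ct := []) (r := x.depth) (u := fun _ => (false, false)) hkb hq rfl (by omega) hm hc hmt hut hv
    hn ht1 ht2
  have hs : searchRegs s (vec x.nodes fun _ => (false, false)) [] [] x.depth [.down] = s := by
    funext k
    cases k <;> simp [searchRegs, *]
  rw [hs] at h
  generalize hb : eval x.nodes x.kb x.query x.depth (fun _ => (false, false)) = b at h
  have hstep : Exec (searchCode (.up b)) (searchRegs s [] [] [] x.depth [])
      (update (searchRegs s [] [] [] x.depth []) .res [.bit b]) 2 := by
    cases b <;> refine (Exec.popNone ?_ (.push _ _ _)).to ?_ le_rfl <;> simp [searchRegs, hres]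
  refine ⟨b, update (searchRegs s [] [] [] x.depth []) .res [.bit b],
    ((h.trans (Iter.single (a := .up b) (l := []) ?_ rfl (s₁ := update (searchRegs s [] [] []
      x.depth []) .res [.bit b]) (m := 2) ?_)).finish ?_).mono ?_, by simp, ?_⟩
  · simp [searchRegs]
  · convert hstep using 1
    funext k
    cases k <;> simp [searchRegs]
  · simp [searchRegs]
  · have h₅ := numChoices_leaders_le x.nodes
    have h₆ : numAtoms x.nodes = numAtoms x.query.nodes + numAtoms x.kb.nodes :=
      List.countP_append
    have h₇ := numAtoms_nodes_le hkb
    have h₈ := numAtoms_nodes_le hq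
    have h₉ := searchTime_le (ns := x.nodes) (D := numChoices x.nodes (leaders [] x.nodes))
      (L := x.kb.length + x.query.length) (by omega) (by omega) x.depth
    have h₀ : (2 * (x.kb.length + x.query.length)) ^ x.depth *
        (150 * (x.nodes.length + 1) ^ 3) ≤ (2 * (x.kb.length + x.query.length)) ^ x.depth *
        (150 * (x.kb.length + x.query.length + 1) ^ 3) := by
      gcongr
      omega
    omega
  · rw [x.holds_iff_eval, hb]

/-- The number of steps of the decision procedure with a test of `m` letters, when at most `r`
splits are made, the formulas have length `L`, and the level has `E` digits. -/
def runTime (r m L E : ℕ) : ℕ :=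
  (2 * L) ^ r * (250 * (L + 1) ^ 3) + 21 * (L + 1) * (E + 1) + 2 * m + 100

theorem bitsValue_level (x : Instance) :
    min (bitsValue (Computability.encodeNat x.level)) (leaders [] x.nodes).length = x.depth := by
  rw [(bitsValue_encodeNat _).1, Instance.depth]

/-- The decision procedure is correct. -/
theorem exec_mainCode (x : Instance) {k : Reg} (hk : k ≠ .fl) (hk' : k ≠ .mask) {m r : ℕ}
    {P : List Letter → Bool}
    (hr : P ((preparedRegs x [] k).take m) = true → x.depth ≤ r) :
    ∃ b s, Exec (mainCode k m P) (update (fun _ => []) .inp (x.encode.reverse.map Letter.sym)) s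
      (runTime r m (x.kb.length + x.query.length) (encodeNum x.level).length) ∧
      s .res = [.bit b] ∧ (b = true ↔ P ((preparedRegs x [] k).take m) = true ∧ x.Holds) := by
  obtain ⟨mask, h⟩ := exec_prepare x
  have hmask : preparedRegs x mask k = preparedRegs x [] k := by
    cases k <;> first | rfl | exact absurd rfl hk'
  have htest := exec_testCode hk m P (preparedRegs x mask)
  rw [hmask] at htest
  have h₁ := length_nodes_le x.query_objective
  have h₂ := length_nodes_pos x.query_objective
  have h₃ : x.nodes.length = x.query.nodes.length + x.kb.nodes.length := List.length_append
  have h₄ := length_nodes_le x.kb_cnf.objective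
  generalize hE : (encodeNum x.level).length = E at *
  have hlen : (Computability.encodeNat x.level).length = E := by
    rw [← hE, encodeNum, List.length_map]
  cases hP : P ((preparedRegs x [] k).take m) with
  | false =>
    rw [hP] at htest
    have hpush := Exec.push Reg.res (.bit false)
      (update (update (preparedRegs x mask) .fl [.bit false]) .fl [])
    refine ⟨false, _, (h.seq (htest.seq (Exec.popSome (a := .bit false) (l := []) ?_
      hpush))).mono ?_, ?_, ?_⟩
    · simp [preparedRegs]
    · have hpow : 1 ≤ (2 * (x.kb.length + x.query.length)) ^ r := Nat.one_le_pow _ _ (by omega)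
      have hcube := Nat.mul_le_mul_right (250 * (x.kb.length + x.query.length + 1) ^ 3) hpow
      have hbits : 21 * 1 * (E + 1) ≤ 21 * (x.kb.length + x.query.length + 1) * (E + 1) := by
        gcongr
        omega
      have := Nat.zero_le ((x.kb.length + x.query.length + 1) ^ 3)
      simp only [runTime]
      linarith
    · simp [preparedRegs]
    · simp
  | true =>
    rw [hP] at htest
    obtain ⟨bs, hdepth⟩ := exec_depthLoop
      (s := update (update (preparedRegs x mask) .fl [.bit true]) .fl [])
      (l := Computability.encodeNat x.level) (j := (leaders [] x.nodes).length)
      (by simp [preparedRegs]) (by simp [preparedRegs]) (by simp [preparedRegs])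
    rw [bitsValue_level] at hdepth
    generalize hs : update (update (update (update (update (preparedRegs x mask) .fl [.bit true])
      .fl []) .g []) .b bs) .r (List.replicate x.depth .sep ++
        update (update (preparedRegs x mask) .fl [.bit true]) .fl [] .r) = s at hdepth
    obtain ⟨b, s', hsearch, hres, hb⟩ := exec_search x (s := update s .ctl (.down :: s .ctl))
      (by simp [← hs, preparedRegs]) (by simp [← hs, preparedRegs]) (by simp [← hs, preparedRegs])
      (by simp [← hs, preparedRegs]) (by simp [← hs, preparedRegs]) (by simp [← hs, preparedRegs])
      (by simp [← hs, preparedRegs]) (by simp [← hs, preparedRegs]) (by simp [← hs, preparedRegs])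
      (by simp [← hs, preparedRegs]) (by simp [← hs, preparedRegs]) (by simp [← hs, preparedRegs])
      (by simp [← hs, preparedRegs]) (by simp [← hs, preparedRegs])
    have hrun := hdepth.seq ((Exec.push .ctl .down s).seq hsearch)
    refine ⟨b, s', (h.seq (htest.seq (Exec.popSome (f := answerCode) (a := .bit true) (l := []) ?_
      hrun))).mono ?_, hres, ?_⟩
    · simp [preparedRegs]
    · have h₅ := length_leaders_le [] x.nodes
      have h₆ : numAtoms x.nodes ≤ x.nodes.length := List.countP_le_length
      have hpow : 1 ≤ (2 * (x.kb.length + x.query.length)) ^ r := Nat.one_le_pow _ _ (by omega)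
      have hcube := Nat.mul_le_mul_right (100 * (x.kb.length + x.query.length + 1) ^ 3) hpow
      have h₇ : (2 * (x.kb.length + x.query.length)) ^ x.depth ≤
          (2 * (x.kb.length + x.query.length)) ^ r := Nat.pow_le_pow_right (by omega) (hr hP)
      have h₈ := Nat.mul_le_mul_right (150 * (x.kb.length + x.query.length + 1) ^ 3) h₇
      have h₉ : (leaders [] x.nodes).length * (4 * E + 11) ≤
          (x.kb.length + x.query.length) * (4 * E + 11) := Nat.mul_le_mul_right _ (by omega)
      rw [hlen]
      simp only [runTime]
      nlinarith
    · rw [hb]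
      simp

/-- The machine of the decision procedure. -/
noncomputable def mainMachine (k : Reg) (m : ℕ) (P : List Letter → Bool) :
    Turing.TM2ComputableAux Sym Bool :=
  (mainCode k m P).machine .inp .res Letter.sym Letter.getBit

theorem answersWithin_mainMachine (x : Instance) {k : Reg} (hk : k ≠ .fl) (hk' : k ≠ .mask)
    {m r : ℕ} {P : List Letter → Bool} {Q : Instance → Prop}
    (hr : P ((preparedRegs x [] k).take m) = true → x.depth ≤ r)
    (hQ : Q x ↔ P ((preparedRegs x [] k).take m) = true ∧ x.Holds) :
    AnswersWithin (mainMachine k m P) Instance.encode Q x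
      (3 * runTime r m (x.kb.length + x.query.length) (encodeNum x.level).length +
        3 * x.encode.length + 28) := by
  obtain ⟨b, s, h, hres, hb⟩ := exec_mainCode x hk hk' hr
  exact h.answersWithin hres (dec := Letter.getBit) (by rw [hQ, ← hb]; rfl)

theorem AnswersWithin.mono {α Γ : Type} {M : Turing.TM2ComputableAux Γ Bool} {enc : α → List Γ}
    {P : α → Prop} {a : α} {m n : ℕ} (h : AnswersWithin M enc P a m) (hmn : m ≤ n) :
    AnswersWithin M enc P a n :=
  h.map fun h => ⟨h.toEvalsTo, h.steps_le_m.trans hmn⟩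

/-- If the number of splits is bounded, the procedure runs in polynomial time. -/
theorem inPTIME_of_test {k : Reg} (hk : k ≠ .fl) (hk' : k ≠ .mask) {m r : ℕ}
    {P : List Letter → Bool} {Q : Instance → Prop}
    (hr : ∀ x : Instance, P ((preparedRegs x [] k).take m) = true → x.depth ≤ r)
    (hQ : ∀ x : Instance, Q x ↔ P ((preparedRegs x [] k).take m) = true ∧ x.Holds) :
    InPTIME Instance.encode Q := by
  let p : Polynomial ℕ := 3 * ((2 * .X) ^ r * (250 * (.X + 1) ^ 3) + 21 * (.X + 1) * (.X + 1) +
    2 * .C m + 100) + 3 * .X + 28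
  have hp : ∀ n, p.eval n = 3 * runTime r m n n + 3 * n + 28 := by
    intro n
    simp [p, runTime]
  have h : ∀ x : Instance, AnswersWithin (mainMachine k m P) Instance.encode Q x
      (p.eval x.encode.length) := by
    intro x
    refine (answersWithin_mainMachine x hk hk' (hr x) (hQ x)).mono ?_
    have hlen := length_encode x
    rw [hp]
    have h₁ : runTime r m (x.kb.length + x.query.length) (encodeNum x.level).length ≤
        runTime r m x.encode.length x.encode.length := by
      have h₂ : x.kb.length + x.query.length ≤ x.encode.length := by omega
      have h₃ : (encodeNum x.level).length ≤ x.encode.length := by omega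
      unfold runTime
      gcongr
    omega
  exact ⟨{ mainMachine k m P with
    time := p
    outputsFun := fun x => (h x).some }⟩

theorem bitLetters_encodeNat_inj {m n : ℕ} :
    bitLetters (Computability.encodeNat m) = bitLetters (Computability.encodeNat n) ↔ m = n := by
  refine ⟨fun h => ?_, fun h => h ▸ rfl⟩
  have h₁ : Computability.encodeNat m = Computability.encodeNat n :=
    List.map_injective_iff.2 (fun _ _ h => by simpa using h) h
  rw [← (bitsValue_encodeNat m).1, h₁, (bitsValue_encodeNat n).1]

theorem take_length_add_one {α : Type} {l l' : List α} :
    l.take (l'.length + 1) = l' ↔ l = l' := by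
  refine ⟨fun h => ?_, fun h => by subst h; simp⟩
  have h₁ := congrArg List.length h
  rw [List.length_take] at h₁
  rwa [List.take_of_length_le (by omega)] at h

/-- For a constant level, the machine first compares the digits of the level. -/
theorem inPTIME_level (k : ℕ) :
    InPTIME Instance.encode (fun x : Instance => x.level = k ∧ x.Holds) := by
  have h : ∀ x : Instance, decide ((preparedRegs x [] .b).take
      ((bitLetters (Computability.encodeNat k)).length + 1) =
      bitLetters (Computability.encodeNat k)) = true ↔ x.level = k := by
    intro x
    rw [decide_eq_true_iff, take_length_add_one]
    exact bitLetters_encodeNat_inj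
  refine inPTIME_of_test (k := .b) (m := (bitLetters (Computability.encodeNat k)).length + 1)
    (r := k) (P := fun l => decide (l = bitLetters (Computability.encodeNat k)))
    (by decide) (by decide) ?_ ?_
  · intro x hx
    exact ((h x).1 hx) ▸ min_le_left _ _
  · intro x
    rw [h x]

/-- For a constant number of terms, the machine first counts the terms. -/
theorem inPTIME_terms (c : ℕ) :
    InPTIME Instance.encode (fun x : Instance => x.funTerms.card ≤ c ∧ x.Holds) := by
  have h : ∀ x : Instance, decide (((preparedRegs x [] .g).take (c + 1)).length ≤ c) = true ↔
      x.funTerms.card ≤ c := by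
    intro x
    rw [decide_eq_true_iff, ← x.length_leaders]
    simp only [preparedRegs, List.length_take, List.length_replicate]
    omega
  refine inPTIME_of_test (k := .g) (m := c + 1)
    (r := c) (P := fun l => decide (l.length ≤ c)) (by decide) (by decide) ?_ ?_
  · intro x hx
    exact (min_le_right _ _).trans (x.length_leaders.trans_le ((h x).1 hx))
  · intro x
    rw [h x]

/-- The bound of degree `level + 3`: a leaf of the search takes cubic time, and there are at most
`(2 * L) ^ level` leaves, up to a constant factor. The number of digits of the level is bounded by
`2 ^ level`. -/
theorem answersWithin_holds (x : Instance) :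
    AnswersWithin (mainMachine .b 0 fun _ => true) Instance.encode Instance.Holds x
      (10000 * (2 ^ x.level * (x.kb.length + x.query.length) ^ (x.level + 3))) := by
  refine (answersWithin_mainMachine x (r := x.level) (by decide) (by decide) ?_ ?_).mono ?_
  · exact fun _ => min_le_left _ _
  · simp
  · have h₁ := length_nodes_le x.query_objective
    have h₂ := length_nodes_pos x.query_objective
    have hbits : (encodeNum x.level).length ≤ x.level := by
      rw [encodeNum, List.length_map]
      exact (bitsValue_encodeNat _).2
    have hlevel : x.level + 1 ≤ 2 ^ x.level := Nat.lt_two_pow_self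
    rw [length_encode]
    generalize hL : x.kb.length + x.query.length = L
    have hL1 : 1 ≤ L := by omega
    generalize (encodeNum x.level).length = E at *
    generalize x.level = k at *
    have hmul : (2 * L) ^ k * L ^ 3 = 2 ^ k * L ^ (k + 3) := by ring
    have hLk : L ≤ L ^ (k + 3) := Nat.le_self_pow (by omega) _
    have h₃ : (E + 1) * L ≤ 2 ^ k * L ^ (k + 3) := Nat.mul_le_mul (by omega) hLk
    have h₄ : (L + 1) ^ 3 ≤ 8 * L ^ 3 := by
      calc (L + 1) ^ 3 ≤ (2 * L) ^ 3 := Nat.pow_le_pow_left (by omega) 3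
        _ = 8 * L ^ 3 := by ring
    have h₅ : (2 * L) ^ k * (250 * (L + 1) ^ 3) ≤ 2000 * (2 ^ k * L ^ (k + 3)) := by
      rw [← hmul]
      calc (2 * L) ^ k * (250 * (L + 1) ^ 3) ≤ (2 * L) ^ k * (250 * (8 * L ^ 3)) := by gcongr
        _ = 2000 * ((2 * L) ^ k * L ^ 3) := by ring
    have h₆ : 21 * (L + 1) * (E + 1) ≤ 42 * ((E + 1) * L) := by nlinarith
    have h₇ : E + L ≤ 2 * ((E + 1) * L) := by nlinarith
    have h₈ : 1 ≤ (E + 1) * L := Nat.mul_pos (by omega) hL1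
    simp only [runTime]
    omega

end LimitedBelief

theorem corollary1 :
    -- constant belief level
    (∀ k : ℕ, LimitedBelief.InPTIME LimitedBelief.Instance.encode
      (fun x : LimitedBelief.Instance => x.level = k ∧ x.Holds)) ∧
    -- constant number of function terms (the belief level is part of the input)
    (∀ c : ℕ, LimitedBelief.InPTIME LimitedBelief.Instance.encode
      (fun x : LimitedBelief.Instance => x.funTerms.card ≤ c ∧ x.Holds)) ∧
    -- one decision procedure for the whole problem, of degree `k + 3` at belief level `k`
    (∃ (M : Turing.TM2ComputableAux LimitedBelief.Sym Bool) (C : ℕ),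
      ∀ x : LimitedBelief.Instance,
        LimitedBelief.AnswersWithin M LimitedBelief.Instance.encode LimitedBelief.Instance.Holds x
          (C * (2 ^ x.level * (x.kb.length + x.query.length) ^ (x.level + 3)))) ∧
    -- the belief level `k = |F|` suffices
    (∀ (x : LimitedBelief.Instance) (F : Finset LimitedBelief.FunTerm),
      x.funTerms ⊆ F → F.card ≤ x.level →
        (x.Holds ↔ ({ x with level := F.card } : LimitedBelief.Instance).Holds)) :=
  ⟨LimitedBelief.inPTIME_level, LimitedBelief.inPTIME_terms,
    ⟨LimitedBelief.mainMachine .b 0 fun _ => true, 10000, LimitedBelief.answersWithin_holds⟩,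
    fun x F => x.holds_level_card F⟩
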